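/- Let $M$ be a compact smooth manifold without boundary of dimension $2n$ (not necessarily orientable or connected). A bivector field $w\in\Gamma(\wedge^2TM)$ is Poisson if $\{f,g\}=w(df,dg)$ is a Lie bracket on $C^\infty(M)$; $\mathrm{Poiss}(M)$ denotes the set of Poisson structures with the $C^1$-topology. A Poisson structure $\pi$ is log symplectic if the section $\wedge^n\pi$ of $\wedge^{2n}TM$ is transverse to the zero section; its singular locus is $(\wedge^n\pi)^{-1}(0)$. For a closed embedded hypersurface $Z\subset M$, let $T_ZM$ be the b-tangent bundle, whose sections are the vector fields on $M$ tangent to $Z$; sections of $\wedge^2T_ZM$ are the bivector fields tangent to $Z$. Let $\mathrm{Log}(M,Z)\subset\Gamma(\wedge^2T_ZM)$ be the set of log symplectic structures on $M$ with singular locus exactly $Z$, with the topology induced by the $C^0$-topology on $\Gamma(\wedge^2T_ZM)$, i.e. uniform convergence of components with respect to local frames of $T_ZM$ (near $Z=\{t=0\}$, the frame $t\,\partial_t,\partial_{x_1},\dots,\partial_{x_{2n-1}}$). Let $\pi$ be a log symplectic structure on $M$ with singular locus $Z$. Then every Poisson structure sufficiently $C^1$-close to $\pi$ is log symplectic, with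 singular locus diffeomorphic to $Z$. More precisely, there are a $C^1$-open subset $\mathcal V\subset\mathrm{Poiss}(M)$ containing $\pi$ and a map $\Phi:\mathcal V\to\mathrm{Diff}(M)$ such that $\Phi(\pi)=\mathrm{id}_M$ and, for every $\pi'\in\mathcal V$, $\pi'$ is log symplectic, $\Phi(\pi')$ maps its singular locus onto $Z$, and $\Phi(\pi')_*(\pi')\in\mathrm{Log}(M,Z)$. Moreover, the map $$\Psi:\mathcal V\to\mathrm{Log}(M,Z),\qquad \Psi(\pi')=\Phi(\pi')_*(\pi'),$$ is continuous for the $C^1$-topology on $\mathcal V$ and the $C^0$-topology on $\mathrm{Log}(M,Z)$. -/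

import Mathlib

open scoped Manifold ContDiff Topology UniformConvergence

noncomputable section

namespace LogSymp

/-- The model space of a manifold of dimension `2n`. -/
abbrev Model (n : ℕ) : Type := EuclideanSpace ℝ (Fin (2 * n))

/-- The cotangent space `T*_x M`. -/
abbrev Cotangent (n : ℕ) {M : Type*} [TopologicalSpace M] [ChartedSpace (Model n) M] (x : M) :
    Type :=
  TangentSpace (𝓡 (2 * n)) x →L[ℝ] ℝ

/-- The differential `df_x ∈ T*_x M` of a real function `f`. -/
def differential (n : ℕ) {M : Type*} [TopologicalSpace M] [ChartedSpace (Model n) M]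
    (f : M → ℝ) (x : M) : Cotangent n x :=
  mvfderiv (𝓡 (2 * n)) f x

/-- The differential at `x` of the `j`-th coordinate function of a chart `e`. -/
def coordDifferential {n : ℕ} {M : Type*} [TopologicalSpace M] [ChartedSpace (Model n) M]
    (e : OpenPartialHomeomorph M (Model n)) (j : Fin (2 * n)) (x : M) : Cotangent n x :=
  differential n (fun x' => e x' j) x

/-- All charts of the smooth structure of `M`. -/
abbrev charts (n : ℕ) (M : Type*) [TopologicalSpace M] [ChartedSpace (Model n) M] :
    Set (OpenPartialHomeomorph M (Model n)) :=
  IsManifold.maximalAtlas (𝓡 (2 * n)) ∞ M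

/-- The component `w^{jk} = w(dy_j, dy_k)` in a chart `e` of a field `w` of bilinear forms on the
cotangent spaces, as a function of the coordinates `y` (meaningful on `e.target`). -/
def component {n : ℕ} {M : Type*} [TopologicalSpace M] [ChartedSpace (Model n) M]
    (w : ∀ x : M, LinearMap.BilinForm ℝ (Cotangent n x))
    (e : OpenPartialHomeomorph M (Model n)) (j k : Fin (2 * n)) (y : Model n) : ℝ :=
  w (e.symm y) (coordDifferential e j (e.symm y)) (coordDifferential e k (e.symm y))

/-- Smooth bivector fields on `M`, i.e. smooth sections of `⋀² TM`. An element of `⋀² T_x M` is an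
alternating bilinear form on `T*_x M`; smoothness means that the components in all charts are
smooth. -/
structure BivectorField (n : ℕ) (M : Type*) [TopologicalSpace M] [ChartedSpace (Model n) M] where
  toFun : ∀ x : M, LinearMap.BilinForm ℝ (Cotangent n x)
  isAlt : ∀ x, (toFun x).IsAlt
  smooth : ∀ e ∈ charts n M, ∀ j k, ContDiffOn ℝ ∞ (component toFun e j k) e.target

/-- Compact subsets of the image of a chart. -/
abbrev chartCompacts {n : ℕ} {M : Type*} [TopologicalSpace M]
    (e : OpenPartialHomeomorph M (Model n)) : Set (Set (Model n)) :=
  {K | IsCompact K ∧ K ⊆ e.target}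

/-- The `C¹`-topology on bivector fields: uniform convergence of the components and of their first
derivatives on the compact subsets of the image of every chart. -/
instance BivectorField.c1Topology (n : ℕ) (M : Type*) [TopologicalSpace M]
    [ChartedSpace (Model n) M] : TopologicalSpace (BivectorField n M) :=
  ⨅ (e ∈ charts n M) (j : Fin (2 * n)) (k : Fin (2 * n)),
    TopologicalSpace.induced
        (fun w : BivectorField n M =>
          UniformOnFun.ofFun (chartCompacts e) (component w.toFun e j k)) inferInstance ⊓
      TopologicalSpace.induced
        (fun w : BivectorField n M =>
          UniformOnFun.ofFun (chartCompacts e) (fderiv ℝ (component w.toFun e j k))) inferInstance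

/-- The bracket `{f, g} = w(df, dg)`. -/
def BivectorField.bracket {n : ℕ} {M : Type*} [TopologicalSpace M] [ChartedSpace (Model n) M]
    (w : BivectorField n M) (f g : M → ℝ) (x : M) : ℝ :=
  w.toFun x (differential n f x) (differential n g x)

/-- `w` is a Poisson structure: its bracket is a Lie bracket on `C^∞(M)`. Bilinearity, antisymmetry
and the Leibniz rule hold for every bivector field, so this is the Jacobi identity. -/
def BivectorField.IsPoisson {n : ℕ} {M : Type*} [TopologicalSpace M] [ChartedSpace (Model n) M]
    (w : BivectorField n M) : Prop :=
  ∀ f g h : C^∞⟮𝓡 (2 * n), M; ℝ⟯, ∀ x : M,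
    w.bracket f (w.bracket g h) x + w.bracket g (w.bracket h f) x
      + w.bracket h (w.bracket f g) x = 0

/-- The space of Poisson structures, with the topology induced by the `C¹`-topology. -/
abbrev Poiss (n : ℕ) (M : Type*) [TopologicalSpace M] [ChartedSpace (Model n) M] : Type _ :=
  {w : BivectorField n M // w.IsPoisson}

/-- The wedge power `⋀ⁿ w (x) ∈ ⋀^{2n} T_x M`, as an alternating `2n`-form on `T*_x M`:
`(α₁, …, α_{2n}) ↦ 2⁻ⁿ ∑_σ sgn σ ∏_k w(α_{σ(2k)}, α_{σ(2k+1)})`. -/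
def BivectorField.wedgePow {n : ℕ} {M : Type*} [TopologicalSpace M] [ChartedSpace (Model n) M]
    (w : BivectorField n M) (x : M) (α : Fin (2 * n) → Cotangent n x) : ℝ :=
  (1 / 2 ^ n) * ∑ σ : Equiv.Perm (Fin (2 * n)), ((Equiv.Perm.sign σ : ℤ) : ℝ) *
    ∏ k : Fin n, w.toFun x (α (σ ⟨2 * k, by omega⟩)) (α (σ ⟨2 * k + 1, by omega⟩))

/-- The section `⋀ⁿ w` of the line bundle `⋀^{2n} TM` in the trivialization
`s ↦ s(dy_1, …, dy_{2n})` over a chart `e`, as a function of the coordinates. -/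
def BivectorField.wedgePowComponent {n : ℕ} {M : Type*} [TopologicalSpace M]
    [ChartedSpace (Model n) M] (w : BivectorField n M)
    (e : OpenPartialHomeomorph M (Model n)) (y : Model n) : ℝ :=
  w.wedgePow (e.symm y) (fun j => coordDifferential e j (e.symm y))

/-- `⋀ⁿ w : M → ⋀^{2n} TM` is transverse to the zero section: in the local trivialization over each
chart, wherever the section `y ↦ (y, s(y))` meets the zero section, the image of its differential
and the tangent space `ℝ^{2n} × 0` of the zero section together span `ℝ^{2n} × ℝ`. -/
def BivectorField.WedgePowTransverse {n : ℕ} {M : Type*} [TopologicalSpace M]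
    [ChartedSpace (Model n) M] (w : BivectorField n M) : Prop :=
  ∀ e ∈ charts n M, ∀ y ∈ e.target, w.wedgePowComponent e y = 0 →
    LinearMap.range
        (fderiv ℝ (fun y' : Model n => (y', w.wedgePowComponent e y')) y :
          Model n →ₗ[ℝ] Model n × ℝ) ⊔
      Submodule.prod ⊤ ⊥ = ⊤

/-- Log symplectic structures. -/
def BivectorField.IsLogSymplectic {n : ℕ} {M : Type*} [TopologicalSpace M]
    [ChartedSpace (Model n) M] (w : BivectorField n M) : Prop :=
  w.IsPoisson ∧ w.WedgePowTransverse

/-- The singular locus `(⋀ⁿ w)⁻¹(0)`. -/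
def BivectorField.singularLocus {n : ℕ} {M : Type*} [TopologicalSpace M]
    [ChartedSpace (Model n) M] (w : BivectorField n M) : Set M :=
  {x | w.wedgePow x = 0}

/-- `e` is a chart in which `Z` is the coordinate hyperplane `{y_i = 0}`. -/
def IsAdapted {n : ℕ} {M : Type*} [TopologicalSpace M] [ChartedSpace (Model n) M]
    (Z : Set M) (e : OpenPartialHomeomorph M (Model n)) (i : Fin (2 * n)) : Prop :=
  e ∈ charts n M ∧ ∀ x ∈ e.source, x ∈ Z ↔ e x i = 0

/-- Smooth sections of `⋀² T_Z M` for a hypersurface `Z`: the bivector fields tangent to `Z`,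
i.e. lying in `⋀² TZ` along `Z`. In charts in which `Z = {y_i = 0}`, this says that the
components `w^{ij}` vanish on `{y_i = 0}`. -/
structure BBivectorField (n : ℕ) {M : Type*} [TopologicalSpace M] [ChartedSpace (Model n) M]
    (Z : Set M) extends BivectorField n M where
  tangent : ∀ e i, IsAdapted Z e i → ∀ j, ∀ y ∈ e.target, y i = 0 →
    component toFun e i j y = 0

/-- The quotient `f(y) / y_i`, continued to `{y_i = 0}` by `∂f/∂y_i`. If `f` is smooth and vanishes
on `{y_i = 0}`, this is the smooth function `g` with `f = y_i g`. -/
def divCoord {n : ℕ} (i : Fin (2 * n)) (f : Model n → ℝ) (y : Model n) : ℝ :=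
  if y i = 0 then fderiv ℝ f y (EuclideanSpace.single i 1) else f y / y i

/-- The components of a section of `⋀² T_Z M` in a chart in which `Z = {y_i = 0}`, with respect to
the frame of `T_Z M` that consists of `y_i ∂/∂y_i` and the `∂/∂y_j`, `j ≠ i`. -/
def bComponent {n : ℕ} {M : Type*} [TopologicalSpace M] [ChartedSpace (Model n) M]
    (w : ∀ x : M, LinearMap.BilinForm ℝ (Cotangent n x))
    (e : OpenPartialHomeomorph M (Model n)) (i j k : Fin (2 * n)) : Model n → ℝ :=
  if j = i ∨ k = i then divCoord i (component w e j k) else component w e j k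

/-- The `C⁰`-topology on sections of `⋀² T_Z M`: uniform convergence, on the compact subsets of the
image of the chart, of the components in the local frames of `T_Z M`, namely the coordinate frame
`∂/∂y_j` for charts disjoint from `Z`, and `y_i ∂/∂y_i`, `∂/∂y_j` (`j ≠ i`) for charts in which
`Z = {y_i = 0}`. -/
instance BBivectorField.c0Topology (n : ℕ) {M : Type*} [TopologicalSpace M]
    [ChartedSpace (Model n) M] (Z : Set M) : TopologicalSpace (BBivectorField n Z) :=
  (⨅ (e ∈ charts n M) (_ : Disjoint e.source Z) (j : Fin (2 * n)) (k : Fin (2 * n)),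
    TopologicalSpace.induced
      (fun w : BBivectorField n Z =>
        UniformOnFun.ofFun (chartCompacts e) (component w.toFun e j k)) inferInstance) ⊓
  ⨅ (e : OpenPartialHomeomorph M (Model n)) (i : Fin (2 * n)) (_ : IsAdapted Z e i)
      (j : Fin (2 * n)) (k : Fin (2 * n)),
    TopologicalSpace.induced
      (fun w : BBivectorField n Z =>
        UniformOnFun.ofFun (chartCompacts e) (bComponent w.toFun e i j k)) inferInstance

/-- `Log(M, Z)`: the log symplectic structures with singular locus exactly `Z`, with the topology
induced by the `C⁰`-topology on sections of `⋀² T_Z M`. -/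
abbrev Log (n : ℕ) {M : Type*} [TopologicalSpace M] [ChartedSpace (Model n) M] (Z : Set M) :
    Type _ :=
  {w : BBivectorField n Z //
    w.toBivectorField.IsLogSymplectic ∧ w.toBivectorField.singularLocus = Z}

/-- The group `Diff(M)` of smooth diffeomorphisms of `M`. -/
abbrev Diff (n : ℕ) (M : Type*) [TopologicalSpace M] [ChartedSpace (Model n) M] : Type _ :=
  Diffeomorph (𝓡 (2 * n)) (𝓡 (2 * n)) M M ∞

/-- `w' = φ_* w`, i.e. `w'_{φ(x)}(α, β) = w_x(φ^* α, φ^* β)`. As `φ` is bijective, this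
determines `w'`. -/
def IsPushforward {n : ℕ} {M : Type*} [TopologicalSpace M] [ChartedSpace (Model n) M]
    (φ : Diff n M) (w w' : BivectorField n M) : Prop :=
  ∀ (x : M) (α β : Cotangent n (φ x)),
    w'.toFun (φ x) α β =
      w.toFun x (α.comp (mfderiv (𝓡 (2 * n)) (𝓡 (2 * n)) φ x))
        (β.comp (mfderiv (𝓡 (2 * n)) (𝓡 (2 * n)) φ x))

end LogSymp

end

/-! The section `⋀ⁿp` depends continuously, with its first derivatives, on `p` in the `C¹`-topology,
and `⋀ⁿπ` is transverse to zero. So the zero set of `⋀ⁿp` is a small displacement of `Z`, and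
transversality persists by compactness. The diffeomorphisms are built by hand, so that `⋀ⁿπ ∘ Φ p`
equals `⋀ⁿp` up to a non-vanishing factor near `Z`.

Near a point of `Z`, the local expression of `⋀ⁿπ` is a coordinate function of some chart
(`exists_chart_coord_eq`). Moving along this coordinate with a cut-off `b` replaces `⋀ⁿπ ∘ Φ p` by
the convex combination `(1 - b) ⋀ⁿπ ∘ Φ p + b ⋀ⁿp` (`wedgePowComponent_adjust`). If `⋀ⁿπ ∘ Φ p = c
⋀ⁿp` held before, the new factor is `(1 - b) c + b`, still `1` at `p = π`. Hence finitely many such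
moves, starting from the identity, achieve the matching along all of the compact set `Z`
(`exists_family_matchesAt`). A family of maps through the identity that is jointly continuous with
its first derivatives consists of diffeomorphisms near the parameter `π` (`eventually_diffeomorph`),
and the matching shows that `Φ p` maps the singular locus of `p` onto `Z`.

The delicate point is continuity in the b-frame. The components of the push-forward contain the
first derivatives of `Φ p`, so they vary only in `C⁰`, whereas dividing those with normal index by
`y_i` seems to cost one more derivative. The Jacobi identity supplies it: `w(d Pf(w), dy_k) = Pf(w)
∑_l ∂_l w^{lk}` (`sum_component_mul_partialDeriv_wedgePowComponent`), which says that contracting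
`w` with the differential of its own Pfaffian gives the Pfaffian times a first-order expression.
Through `⋀ⁿπ ∘ Φ p = c ⋀ⁿp` this becomes a statement about the push-forward contracted with
`d(⋀ⁿπ)`. Transversality then allows one to solve for the normal components as `y_i` times a jointly
continuous function (`exists_pushComponent_eq_coord_mul`). By `fderiv_coord_mul` this function is
the b-component on `{y_i = 0}` too, and joint continuity gives uniform convergence on compact sets.
-/

noncomputable section

namespace LogSymp

/-! ### The Pfaffian -/

section Pfaffian

variable {n : ℕ} {N : Type*} [AddCommGroup N] [Module ℝ N]

/-- Every index lies in exactly one pair `{2k, 2k+1}`, so changing one argument affects a single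
factor, in which it enters linearly. This gives multilinearity of `pairProd`. -/
theorem exists_prod_update_eq (B : LinearMap.BilinForm ℝ N) (α : Fin (2 * n) → N)
    (i : Fin (2 * n)) : ∃ L : N →ₗ[ℝ] ℝ, ∀ z : N,
      ∏ k : Fin n, B (Function.update α i z ⟨2 * k, by omega⟩)
        (Function.update α i z ⟨2 * k + 1, by omega⟩) = L z := by
  obtain ⟨k, hk⟩ : ∃ k : Fin n, i = ⟨2 * k, by omega⟩ ∨ i = ⟨2 * k + 1, by omega⟩ :=
    ⟨⟨i / 2, by omega⟩, by simp only [Fin.ext_iff]; omega⟩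
  have hk' : (i : ℕ) = 2 * k ∨ (i : ℕ) = 2 * k + 1 := by simpa only [Fin.ext_iff] using hk
  have hne : ∀ (z : N) (l : Fin n), l ∈ Finset.univ.erase k →
      B (Function.update α i z ⟨2 * l, by omega⟩) (Function.update α i z ⟨2 * l + 1, by omega⟩) =
        B (α ⟨2 * l, by omega⟩) (α ⟨2 * l + 1, by omega⟩) := by
    intro z l hl
    have hlk : (l : ℕ) ≠ k := fun h => (Finset.ne_of_mem_erase hl) (Fin.ext h)
    rw [Function.update_of_ne, Function.update_of_ne]
    all_goals
      intro h
      have := congrArg Fin.val h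
      simp only at this
      omega
  set c := ∏ l ∈ Finset.univ.erase k, B (α ⟨2 * l, by omega⟩) (α ⟨2 * l + 1, by omega⟩)
  rcases hk with hk | hk
  · refine ⟨c • B.flip (α ⟨2 * k + 1, by omega⟩), fun z => ?_⟩
    rw [← Finset.mul_prod_erase Finset.univ _ (Finset.mem_univ k),
      Finset.prod_congr rfl (hne z)]
    rw [hk, Function.update_self, Function.update_of_ne (by simp)]
    exact mul_comm _ _
  · refine ⟨c • B (α ⟨2 * k, by omega⟩), fun z => ?_⟩
    rw [← Finset.mul_prod_erase Finset.univ _ (Finset.mem_univ k),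
      Finset.prod_congr rfl (hne z)]
    rw [hk, Function.update_self, Function.update_of_ne (by simp)]
    exact mul_comm _ _

/-- The multilinear map `α ↦ ∏ₖ B(α_{2k}, α_{2k+1})`. -/
def pairProd (B : LinearMap.BilinForm ℝ N) : MultilinearMap ℝ (fun _ : Fin (2 * n) => N) ℝ where
  toFun α := ∏ k : Fin n, B (α ⟨2 * k, by omega⟩) (α ⟨2 * k + 1, by omega⟩)
  map_update_add' := by
    intro inst α i x y
    obtain rfl : inst = instDecidableEqFin _ := Subsingleton.elim _ _
    obtain ⟨L, hL⟩ := exists_prod_update_eq B α i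
    rw [hL, hL, hL, map_add]
  map_update_smul' := by
    intro inst α i c x
    obtain rfl : inst = instDecidableEqFin _ := Subsingleton.elim _ _
    obtain ⟨L, hL⟩ := exists_prod_update_eq B α i
    rw [hL, hL, map_smul]

/-- An alternating form of top degree transforms by the determinant. -/
theorem alternatingMap_linear_combination {m : ℕ} (f : N [⋀^Fin m]→ₗ[ℝ] ℝ)
    (A : Matrix (Fin m) (Fin m) ℝ) (β : Fin m → N) :
    f (fun j => ∑ k, A j k • β k) = A.det * f β := by
  -- Pulling `f` back along the linear map that takes the standard basis to `β` gives a top-degree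
  -- form on `ℝ^m`, hence a multiple of the determinant.
  let g : (Fin m → ℝ) [⋀^Fin m]→ₗ[ℝ] ℝ := f.compLinearMap (Fintype.linearCombination ℝ β)
  have hg := congrArg (fun h => h A) (g.eq_smul_basis_det (Pi.basisFun ℝ (Fin m)))
  have h1 : g A = f (fun j => ∑ k, A j k • β k) := rfl
  have h2 : g (Pi.basisFun ℝ (Fin m)) = f β := by
    simp only [g, AlternatingMap.compLinearMap_apply]
    congr 1
    ext j
    simp [Fintype.linearCombination_apply]
  simp only [h2, h1] at hg
  rw [hg, mul_comm]
  exact congrArg (f β * ·) (Pi.basisFun_det_apply A)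

/-- The `n`-th wedge power of an alternating form of degree two. -/
def wedgePowForm (n : ℕ) (B : LinearMap.BilinForm ℝ N) (α : Fin (2 * n) → N) : ℝ :=
  (1 / 2 ^ n) * ∑ σ : Equiv.Perm (Fin (2 * n)), ((Equiv.Perm.sign σ : ℤ) : ℝ) *
    ∏ k : Fin n, B (α (σ ⟨2 * k, by omega⟩)) (α (σ ⟨2 * k + 1, by omega⟩))

/-- The sum over permutations is the alternatization of `pairProd`, an alternating form of top
degree. No symmetry of `B` is involved. -/
theorem wedgePowForm_linear_combination (B : LinearMap.BilinForm ℝ N)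
    (A : Matrix (Fin (2 * n)) (Fin (2 * n)) ℝ) (β : Fin (2 * n) → N) :
    wedgePowForm n B (fun j => ∑ k, A j k • β k) = A.det * wedgePowForm n B β := by
  have h : ∀ α : Fin (2 * n) → N, wedgePowForm n B α =
      ((1 / 2 ^ n : ℝ) • MultilinearMap.alternatization (pairProd (n := n) B)) α := by
    intro α
    simp only [wedgePowForm, AlternatingMap.smul_apply, MultilinearMap.alternatization_apply,
      smul_eq_mul, MultilinearMap.domDomCongr_apply]
    congr 1
    refine Finset.sum_congr rfl fun σ _ => ?_
    rw [Units.smul_def, zsmul_eq_mul]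
    rfl
  rw [h, h, alternatingMap_linear_combination]

/-- `⋀ⁿ` of the bivector with matrix `W`: the Pfaffian of `W` up to a constant factor. -/
def pfaffian (W : Matrix (Fin (2 * n)) (Fin (2 * n)) ℝ) : ℝ :=
  (1 / 2 ^ n) * ∑ σ : Equiv.Perm (Fin (2 * n)), ((Equiv.Perm.sign σ : ℤ) : ℝ) *
    ∏ k : Fin n, W (σ ⟨2 * k, by omega⟩) (σ ⟨2 * k + 1, by omega⟩)

/-- The rows of `A` are combinations of the standard basis, and their Gram matrix for the form `W`
is `A W Aᵀ`. Differentiating this law at `A = 1` gives `fderiv_pfaffian_apply`. -/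
theorem pfaffian_mul_mul_transpose (A W : Matrix (Fin (2 * n)) (Fin (2 * n)) ℝ) :
    pfaffian (A * W * A.transpose) = A.det * pfaffian W := by
  have h := wedgePowForm_linear_combination (n := n) (Matrix.toBilin' W) A
    (fun k => Pi.single k (1 : ℝ))
  have h1 : wedgePowForm n (Matrix.toBilin' W) (fun k => Pi.single k (1 : ℝ)) = pfaffian W := by
    simp only [wedgePowForm, pfaffian, Matrix.toBilin'_single]
  have h2 : wedgePowForm n (Matrix.toBilin' W) (fun j => ∑ k, A j k • Pi.single k (1 : ℝ)) =
      pfaffian (A * W * A.transpose) := by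
    have : ∀ j, (∑ k, A j k • Pi.single k (1 : ℝ) : Fin (2 * n) → ℝ) = A j := by
      intro j
      ext l
      simp [Finset.sum_apply, Pi.single_apply]
    simp only [wedgePowForm, pfaffian, this, Matrix.toBilin'_apply, Matrix.mul_apply,
      Matrix.transpose_apply, Finset.sum_mul]
    congr 1
    refine Finset.sum_congr rfl fun σ _ => ?_
    congr 1
    refine Finset.prod_congr rfl fun k _ => ?_
    rw [Finset.sum_comm]
  rw [← h1, ← h, h2]

theorem contDiff_pfaffian {m : WithTop ℕ∞} : ContDiff ℝ m
    (fun W : Fin (2 * n) → Fin (2 * n) → ℝ => pfaffian (Matrix.of W)) := by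
  unfold pfaffian
  simp only [Matrix.of_apply]
  fun_prop

theorem hasDerivAt_det_one_add_smul {m : ℕ} (B : Matrix (Fin m) (Fin m) ℝ) :
    HasDerivAt (fun t : ℝ => (1 + t • B).det) B.trace 0 := by
  -- The polynomial `q` is the remainder in `det (1 + tB) = 1 + t tr B + t² q(t)`.
  generalize hq :
    ((1 : Matrix _ _ (Polynomial ℝ)) + Polynomial.X (R := ℝ) • B.map Polynomial.C).det.divX.divX = q
  have : (fun t : ℝ => (1 + t • B).det) = fun t => 1 + B.trace * t + q.eval t * t ^ 2 := by
    funext t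
    rw [Matrix.det_one_add_smul, hq]
  rw [this]
  have h4 := ((hasDerivAt_const (0 : ℝ) (1 : ℝ)).add
    ((hasDerivAt_id (0 : ℝ)).const_mul B.trace)).add
    ((q.hasDerivAt (0 : ℝ)).mul (hasDerivAt_pow 2 (0 : ℝ)))
  have h5 : (0 + B.trace * 1 + (q.derivative.eval 0 * 0 ^ 2 +
      q.eval 0 * ((2 : ℕ) * 0 ^ (2 - 1))) : ℝ) = B.trace := by simp
  rw [h5] at h4
  exact h4

theorem hasDerivAt_conj {m : ℕ} (B W : Matrix (Fin m) (Fin m) ℝ) :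
    HasDerivAt (fun t : ℝ => (Matrix.of.symm ((1 + t • B) * W * (1 + t • B).transpose) :
      Fin m → Fin m → ℝ)) (Matrix.of.symm (B * W + W * B.transpose)) 0 := by
  refine hasDerivAt_pi.2 fun a => hasDerivAt_pi.2 fun b => ?_
  have heq : (fun t : ℝ => Matrix.of.symm ((1 + t • B) * W * (1 + t • B).transpose) a b) =
      fun t => W a b + t * (B * W + W * B.transpose) a b + t ^ 2 * (B * W * B.transpose) a b := by
    funext t
    have : (1 + t • B) * W * (1 + t • B).transpose =
        W + t • (B * W + W * B.transpose) + t ^ 2 • (B * W * B.transpose) := by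
      simp only [Matrix.transpose_add, Matrix.transpose_one, Matrix.transpose_smul, add_mul,
        mul_add, one_mul, mul_one, Matrix.smul_mul, Matrix.mul_smul, smul_add, smul_smul, pow_two]
      abel
    rw [this]
    rfl
  rw [heq]
  have h1 := ((hasDerivAt_const (0 : ℝ) (W a b)).add
    ((hasDerivAt_id (0 : ℝ)).mul_const ((B * W + W * B.transpose) a b))).add
    ((hasDerivAt_pow 2 (0 : ℝ)).mul_const ((B * W * B.transpose) a b))
  have h2 : (0 + 1 * (B * W + W * B.transpose) a b +
      ((2 : ℕ) * 0 ^ (2 - 1)) * (B * W * B.transpose) a b : ℝ) =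
      (B * W + W * B.transpose) a b := by simp
  rw [h2] at h1
  exact h1

/-- The infinitesimal form of `pfaffian_mul_mul_transpose`. -/
theorem fderiv_pfaffian_apply (B W : Matrix (Fin (2 * n)) (Fin (2 * n)) ℝ) :
    fderiv ℝ (fun W : Fin (2 * n) → Fin (2 * n) → ℝ => pfaffian (Matrix.of W)) (Matrix.of.symm W)
      (Matrix.of.symm (B * W + W * B.transpose)) = B.trace * pfaffian W := by
  set P := fun W : Fin (2 * n) → Fin (2 * n) → ℝ => pfaffian (Matrix.of W) with hP
  have hd : HasFDerivAt P (fderiv ℝ P (Matrix.of.symm W))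
      (Matrix.of.symm ((1 + (0 : ℝ) • B) * W * (1 + (0 : ℝ) • B).transpose)) := by
    have h0 : (1 + (0 : ℝ) • B) * W * (1 + (0 : ℝ) • B).transpose = W := by simp
    rw [h0]
    exact ((contDiff_pfaffian (m := 1)).differentiable one_ne_zero _).hasFDerivAt
  have h1 := hd.comp_hasDerivAt (0 : ℝ) (hasDerivAt_conj B W)
  have h2 : (P ∘ fun t : ℝ => (Matrix.of.symm ((1 + t • B) * W * (1 + t • B).transpose) :
      Fin (2 * n) → Fin (2 * n) → ℝ)) = fun t => (1 + t • B).det * pfaffian W := by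
    funext t
    exact pfaffian_mul_mul_transpose _ _
  rw [h2] at h1
  exact h1.unique ((hasDerivAt_det_one_add_smul B).mul_const _)

/-- If the derivatives `W' l = ∂_l W` satisfy the Jacobi identity, then
`∑_l W^{lk} ∂_l Pf(W) = Pf(W) ∑_l ∂_l W^{lk}`. -/
theorem sum_mul_fderiv_pfaffian (W : Fin (2 * n) → Fin (2 * n) → ℝ)
    (hW : ∀ a b, W a b = -W b a)
    (W' : Fin (2 * n) → Fin (2 * n) → Fin (2 * n) → ℝ) (hW' : ∀ l a b, W' l a b = -W' l b a)
    (hJ : ∀ i j k, ∑ l, (W i l * W' l j k + W j l * W' l k i + W k l * W' l i j) = 0)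
    (k : Fin (2 * n)) :
    ∑ l, W l k *
        fderiv ℝ (fun W : Fin (2 * n) → Fin (2 * n) → ℝ => pfaffian (Matrix.of W)) W (W' l) =
      pfaffian (Matrix.of W) * ∑ l, W' l l k := by
  -- `B` is the Jacobian matrix of the vector field `∑_l W^{lk} ∂_l`, which is Hamiltonian up to
  -- sign. The Jacobi identity says that `W` is invariant under it, so the derivative of `W` along
  -- it is `B W + W Bᵀ`; the trace of `B` is its divergence.
  let B : Matrix (Fin (2 * n)) (Fin (2 * n)) ℝ := Matrix.of fun b l => W' l b k
  have hD : ∑ l, W l k • W' l =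
      Matrix.of.symm (B * Matrix.of W + Matrix.of W * B.transpose) := by
    ext a b
    have h := hJ a b k
    simp only [Finset.sum_add_distrib] at h
    simp only [Finset.sum_apply, Pi.smul_apply, smul_eq_mul, Matrix.of_symm_apply,
      Matrix.add_apply, Matrix.mul_apply, Matrix.transpose_apply, Matrix.of_apply, B]
    have e1 : ∑ l, W l k * W' l a b = -∑ l, W k l * W' l a b := by
      rw [← Finset.sum_neg_distrib]
      exact Finset.sum_congr rfl fun l _ => by rw [hW l k]; ring
    have e2 : ∑ l, W' l a k * W l b = ∑ l, W b l * W' l k a :=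
      Finset.sum_congr rfl fun l _ => by rw [hW l b, hW' l a k]; ring
    linarith
  have h := fderiv_pfaffian_apply B (Matrix.of W)
  rw [← hD] at h
  simp only [map_sum, map_smul, smul_eq_mul] at h
  rw [mul_comm (pfaffian _)]
  exact h

attribute [irreducible] pfaffian wedgePowForm

end Pfaffian

/-! ### Calculus in charts -/

section Charts

variable {n : ℕ} {M : Type*} [TopologicalSpace M] [ChartedSpace (Model n) M]

/-- The partial derivative `∂f/∂y_a`. -/
def partialDeriv {m : ℕ} (a : Fin m) (f : EuclideanSpace ℝ (Fin m) → ℝ)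
    (y : EuclideanSpace ℝ (Fin m)) : ℝ :=
  fderiv ℝ f y (EuclideanSpace.single a 1)

/-- The `j`-th coordinate as a linear form. -/
def coordL {m : ℕ} (j : Fin m) : EuclideanSpace ℝ (Fin m) →L[ℝ] ℝ :=
  EuclideanSpace.proj j

theorem coordL_apply {m : ℕ} (j : Fin m) (v : EuclideanSpace ℝ (Fin m)) : coordL j v = v j :=
  rfl

theorem eq_sum_single {m : ℕ} (v : EuclideanSpace ℝ (Fin m)) :
    v = ∑ a, v a • EuclideanSpace.single a (1 : ℝ) := by
  ext b
  simp [Pi.single_apply]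

theorem fderiv_apply_eq_sum {m : ℕ} (f : EuclideanSpace ℝ (Fin m) → ℝ)
    (y v : EuclideanSpace ℝ (Fin m)) :
    fderiv ℝ f y v = ∑ a, partialDeriv a f y * v a := by
  conv_lhs => rw [eq_sum_single v]
  simp only [map_sum, map_smul, smul_eq_mul, partialDeriv]
  exact Finset.sum_congr rfl fun a _ => mul_comm _ _

theorem contDiffAt_transition {e e₂ : OpenPartialHomeomorph M (Model n)} (he : e ∈ charts n M)
    (he₂ : e₂ ∈ charts n M) {y : Model n} (hy : y ∈ e.target) (hy₂ : e.symm y ∈ e₂.source) :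
    ContDiffAt ℝ ∞ (fun y => e₂ (e.symm y)) y := by
  rw [← contMDiffAt_iff_contDiffAt]
  exact (contMDiffAt_of_mem_maximalAtlas he₂ hy₂).comp y
    (contMDiffAt_symm_of_mem_maximalAtlas he hy)

theorem mdifferentiableAt_chart {e : OpenPartialHomeomorph M (Model n)} (he : e ∈ charts n M)
    {x : M} (hx : x ∈ e.source) : MDifferentiableAt (𝓡 (2 * n)) (𝓡 (2 * n)) e x :=
  (contMDiffAt_of_mem_maximalAtlas he hx).mdifferentiableAt (by simp)

/-- The differential of a chart. -/
def chartDeriv (e : OpenPartialHomeomorph M (Model n)) (x : M) :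
    TangentSpace (𝓡 (2 * n)) x →L[ℝ] Model n :=
  mfderiv (𝓡 (2 * n)) (𝓡 (2 * n)) e x

/-- The differential of a function with coordinate expression `g`. -/
theorem differential_apply_of_eventuallyEq {e : OpenPartialHomeomorph M (Model n)}
    (he : e ∈ charts n M) {x : M} (hx : x ∈ e.source) {f : M → ℝ} {g : Model n → ℝ}
    (hfg : f =ᶠ[𝓝 x] fun x' => g (e x')) (hg : DifferentiableAt ℝ g (e x))
    (v : TangentSpace (𝓡 (2 * n)) x) :
    differential n f x v = fderiv ℝ g (e x) (chartDeriv e x v) := by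
  have h1 : HasMFDerivAt (𝓡 (2 * n)) 𝓘(ℝ, ℝ) (g ∘ e) x
      ((fderiv ℝ g (e x)).comp (mfderiv (𝓡 (2 * n)) (𝓡 (2 * n)) e x)) :=
    HasMFDerivAt.comp x hg.hasFDerivAt.hasMFDerivAt
      (mdifferentiableAt_chart he hx).hasMFDerivAt
  have h2 := (h1.congr_of_eventuallyEq hfg).mfderiv
  have h3 : differential n f x v = (mfderiv (𝓡 (2 * n)) 𝓘(ℝ, ℝ) f x v : ℝ) := rfl
  rw [h3, h2]
  rfl

theorem coordDifferential_apply {e : OpenPartialHomeomorph M (Model n)} (he : e ∈ charts n M)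
    {x : M} (hx : x ∈ e.source) (j : Fin (2 * n)) (v : TangentSpace (𝓡 (2 * n)) x) :
    coordDifferential e j x v = chartDeriv e x v j := by
  have h : HasFDerivAt (fun y : Model n => y j)
      (coordL j) (e x) := (coordL j).hasFDerivAt
  rw [coordDifferential, differential_apply_of_eventuallyEq he hx (g := fun y => y j)
    Filter.EventuallyEq.rfl h.differentiableAt, h.fderiv]
  rfl

theorem differential_eq_sum {e : OpenPartialHomeomorph M (Model n)}
    (he : e ∈ charts n M) {x : M} (hx : x ∈ e.source) {f : M → ℝ} {g : Model n → ℝ}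
    (hfg : f =ᶠ[𝓝 x] fun x' => g (e x')) (hg : DifferentiableAt ℝ g (e x)) :
    differential n f x = ∑ j, partialDeriv j g (e x) • coordDifferential e j x := by
  ext v
  rw [differential_apply_of_eventuallyEq he hx hfg hg, fderiv_apply_eq_sum]
  simp only [_root_.sum_apply, _root_.smul_apply,
    coordDifferential_apply he hx, smul_eq_mul]

theorem exists_eq_sum_coordDifferential {e : OpenPartialHomeomorph M (Model n)}
    (he : e ∈ charts n M) {x : M} (hx : x ∈ e.source) (α : Cotangent n x) :
    ∃ a : Fin (2 * n) → ℝ, α = ∑ j, a j • coordDifferential e j x := by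
  have hM : e.MDifferentiable (𝓡 (2 * n)) (𝓡 (2 * n)) :=
    ⟨(contMDiffOn_of_mem_maximalAtlas he).mdifferentiableOn (by simp),
      (contMDiffOn_symm_of_mem_maximalAtlas he).mdifferentiableOn (by simp)⟩
  let A : TangentSpace (𝓡 (2 * n)) x ≃L[ℝ] Model n := hM.mfderiv hx
  refine ⟨fun j => α (A.symm (EuclideanSpace.single j 1)), ?_⟩
  ext v
  have hv2 : v = ∑ j, (A v) j • A.symm (EuclideanSpace.single j (1 : ℝ)) := by
    apply A.injective
    conv_lhs => rw [eq_sum_single (A v)]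
    simp [map_sum]
  conv_lhs => rw [hv2]
  simp only [map_sum, map_smul, smul_eq_mul, _root_.sum_apply,
    _root_.smul_apply, coordDifferential_apply he hx]
  exact Finset.sum_congr rfl fun a _ => mul_comm _ _

/-- The Jacobian matrix at `y` of a map of the model space. -/
def jacobian (F : Model n → Model n) (y : Model n) : Matrix (Fin (2 * n)) (Fin (2 * n)) ℝ :=
  Matrix.of fun j a => partialDeriv a (fun y' => F y' j) y

theorem jacobian_apply {F : Model n → Model n} {y : Model n} (hF : DifferentiableAt ℝ F y)
    (j a : Fin (2 * n)) : jacobian F y j a = fderiv ℝ F y (EuclideanSpace.single a 1) j := by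
  have h := ((coordL j).hasFDerivAt.comp y
    hF.hasFDerivAt).fderiv
  change fderiv ℝ (fun y' => F y' j) y (EuclideanSpace.single a 1) = _
  have h' : fderiv ℝ (fun y' => F y' j) y = _ := h
  rw [h']
  rfl

theorem partialDeriv_comp {F : Model n → Model n} {y : Model n} (hF : DifferentiableAt ℝ F y)
    {g : Model n → ℝ} (hg : DifferentiableAt ℝ g (F y)) (a : Fin (2 * n)) :
    partialDeriv a (fun y' => g (F y')) y = ∑ j, partialDeriv j g (F y) * jacobian F y j a := by
  have h := (hg.hasFDerivAt.comp y hF.hasFDerivAt).fderiv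
  have h' : fderiv ℝ (fun y' => g (F y')) y = _ := h
  rw [partialDeriv, h', ContinuousLinearMap.comp_apply, fderiv_apply_eq_sum]
  exact Finset.sum_congr rfl fun j _ => by rw [jacobian_apply hF]

theorem coordDifferential_eq_sum {e e₂ : OpenPartialHomeomorph M (Model n)} (he : e ∈ charts n M)
    (he₂ : e₂ ∈ charts n M) {x : M} (hx : x ∈ e.source) (hx₂ : x ∈ e₂.source) (j : Fin (2 * n)) :
    coordDifferential e₂ j x =
      ∑ a, jacobian (fun y => e₂ (e.symm y)) (e x) j a • coordDifferential e a x := by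
  have hd : DifferentiableAt ℝ (fun y => e₂ (e.symm y) j) (e x) := by
    have := (contDiffAt_transition he he₂ (e.map_source hx)
      (by rwa [e.left_inv hx])).differentiableAt (by simp)
    exact (coordL j).differentiableAt.comp _
      this
  refine differential_eq_sum he hx (g := fun y => e₂ (e.symm y) j) ?_ hd
  filter_upwards [e.open_source.mem_nhds hx] with x' hx'
  rw [e.left_inv hx']

theorem component_apply_chart (w : ∀ x : M, LinearMap.BilinForm ℝ (Cotangent n x))
    {e : OpenPartialHomeomorph M (Model n)} {x : M} (hx : x ∈ e.source) (j k : Fin (2 * n)) :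
    component w e j k (e x) = w x (coordDifferential e j x) (coordDifferential e k x) := by
  rw [component, e.left_inv hx]

theorem component_change {e e₂ : OpenPartialHomeomorph M (Model n)} (he : e ∈ charts n M)
    (he₂ : e₂ ∈ charts n M) (w : ∀ x : M, LinearMap.BilinForm ℝ (Cotangent n x)) {x : M}
    (hx : x ∈ e.source) (hx₂ : x ∈ e₂.source) (j k : Fin (2 * n)) :
    component w e₂ j k (e₂ x) = ∑ a, ∑ b, jacobian (fun y => e₂ (e.symm y)) (e x) j a *
      jacobian (fun y => e₂ (e.symm y)) (e x) k b * component w e a b (e x) := by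
  simp only [component_apply_chart _ hx, component_apply_chart _ hx₂,
    coordDifferential_eq_sum he he₂ hx hx₂,
    map_sum, map_smul, LinearMap.sum_apply, LinearMap.smul_apply, smul_eq_mul]
  simp only [Finset.mul_sum]
  rw [Finset.sum_comm]
  exact Finset.sum_congr rfl fun a _ => Finset.sum_congr rfl fun b _ => by ring

theorem wedgePow_eq_wedgePowForm (w : BivectorField n M) (x : M)
    (α : Fin (2 * n) → Cotangent n x) : w.wedgePow x α = wedgePowForm n (w.toFun x) α := by
  unfold wedgePowForm
  rfl

theorem wedgePowComponent_apply_chart (w : BivectorField n M)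
    {e : OpenPartialHomeomorph M (Model n)} {x : M} (hx : x ∈ e.source) :
    w.wedgePowComponent e (e x) =
      wedgePowForm n (w.toFun x) (fun j => coordDifferential e j x) := by
  rw [BivectorField.wedgePowComponent, wedgePow_eq_wedgePowForm, e.left_inv hx]

theorem wedgePowComponent_change {e e₂ : OpenPartialHomeomorph M (Model n)} (he : e ∈ charts n M)
    (he₂ : e₂ ∈ charts n M) (w : BivectorField n M) {x : M}
    (hx : x ∈ e.source) (hx₂ : x ∈ e₂.source) :
    w.wedgePowComponent e₂ (e₂ x) =
      (jacobian (fun y => e₂ (e.symm y)) (e x)).det * w.wedgePowComponent e (e x) := by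
  have h := wedgePowForm_linear_combination (n := n) (w.toFun x)
    (jacobian (fun y => e₂ (e.symm y)) (e x)) (fun a => coordDifferential e a x)
  simp only [wedgePowComponent_apply_chart _ hx, wedgePowComponent_apply_chart _ hx₂,
    coordDifferential_eq_sum he he₂ hx hx₂]
  exact h

/-- The coordinate differentials span the cotangent space, so a top-degree form vanishes as soon as
it vanishes on them. -/
theorem wedgePow_eq_zero_iff {e : OpenPartialHomeomorph M (Model n)} (he : e ∈ charts n M)
    (w : BivectorField n M) {x : M} (hx : x ∈ e.source) :
    x ∈ w.singularLocus ↔ w.wedgePowComponent e (e x) = 0 := by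
  constructor
  · intro h
    have h' : w.wedgePow x = 0 := h
    rw [wedgePowComponent_apply_chart _ hx]
    rw [← wedgePow_eq_wedgePowForm, h']
    rfl
  · intro h
    change w.wedgePow x = 0
    funext α
    choose A hA using fun j => exists_eq_sum_coordDifferential he hx (α j)
    have h1 := wedgePowForm_linear_combination (n := n) (w.toFun x)
      (Matrix.of A) (fun a => coordDifferential e a x)
    have h2 : α = fun j => ∑ k, Matrix.of A j k • coordDifferential e k x := funext hA
    rw [wedgePowComponent_apply_chart _ hx] at h
    rw [wedgePow_eq_wedgePowForm, h2, h1, h, mul_zero]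
    rfl

theorem component_swap (w : BivectorField n M) (e : OpenPartialHomeomorph M (Model n))
    (j k : Fin (2 * n)) (y : Model n) :
    component w.toFun e j k y = -component w.toFun e k j y :=
  (LinearMap.IsAlt.neg (w.isAlt (e.symm y)) _ _).symm

theorem wedgePowComponent_eq_pfaffian (w : BivectorField n M)
    (e : OpenPartialHomeomorph M (Model n)) (y : Model n) :
    w.wedgePowComponent e y = pfaffian (Matrix.of fun j k => component w.toFun e j k y) := by
  unfold pfaffian
  rfl

theorem contDiffAt_component (w : BivectorField n M) {e : OpenPartialHomeomorph M (Model n)}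
    (he : e ∈ charts n M) {y : Model n} (hy : y ∈ e.target) (j k : Fin (2 * n)) :
    ContDiffAt ℝ ∞ (component w.toFun e j k) y :=
  (w.smooth e he j k).contDiffAt (e.open_target.mem_nhds hy)

theorem contDiffAt_wedgePowComponent (w : BivectorField n M)
    {e : OpenPartialHomeomorph M (Model n)} (he : e ∈ charts n M) {y : Model n}
    (hy : y ∈ e.target) : ContDiffAt ℝ ∞ (w.wedgePowComponent e) y := by
  have h : ContDiffAt ℝ ∞ (fun y j k => component w.toFun e j k y) y :=
    contDiffAt_pi.2 fun j => contDiffAt_pi.2 fun k => contDiffAt_component w he hy j k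
  have h2 : w.wedgePowComponent e = fun y => (fun W : Fin (2 * n) → Fin (2 * n) → ℝ =>
      pfaffian (Matrix.of W)) (fun j k => component w.toFun e j k y) :=
    funext fun y => wedgePowComponent_eq_pfaffian w e y
  rw [h2]
  exact ContDiffAt.comp (g := fun W : Fin (2 * n) → Fin (2 * n) → ℝ => pfaffian (Matrix.of W)) y
    contDiff_pfaffian.contDiffAt h

/-- The image of the differential is the graph of a linear form. Together with the horizontal space
it spans exactly when this form is nonzero. -/
theorem wedgePowTransverse_iff (w : BivectorField n M) :
    w.WedgePowTransverse ↔ ∀ e ∈ charts n M, ∀ y ∈ e.target, w.wedgePowComponent e y = 0 →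
      fderiv ℝ (w.wedgePowComponent e) y ≠ 0 := by
  refine forall₄_congr fun e he y hy => imp_congr_right fun _ => ?_
  have hd : DifferentiableAt ℝ (w.wedgePowComponent e) y :=
    (contDiffAt_wedgePowComponent w he hy).differentiableAt (by simp)
  have h1 : fderiv ℝ (fun y' : Model n => (y', w.wedgePowComponent e y')) y =
      (ContinuousLinearMap.id ℝ (Model n)).prod (fderiv ℝ (w.wedgePowComponent e) y) :=
    ((hasFDerivAt_id y).prodMk hd.hasFDerivAt).fderiv
  rw [h1]
  constructor
  · intro h h0
    have : ((0 : Model n), (1 : ℝ)) ∈ (⊤ : Submodule ℝ (Model n × ℝ)) := trivial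
    rw [← h, h0, Submodule.mem_sup] at this
    obtain ⟨u, ⟨v, rfl⟩, u', hu', huu⟩ := this
    have h2 := congrArg Prod.snd huu
    have h3 : u'.2 = 0 := by simpa using hu'.2
    simp [h3] at h2
  · intro h
    obtain ⟨v, hv⟩ : ∃ v, fderiv ℝ (w.wedgePowComponent e) y v ≠ 0 := by
      by_contra! hc
      exact h (ContinuousLinearMap.ext hc)
    rw [eq_top_iff]
    rintro ⟨a, b⟩ -
    rw [Submodule.mem_sup]
    set t := b / fderiv ℝ (w.wedgePowComponent e) y v
    refine ⟨(t • v, b), ⟨t • v, ?_⟩, (a - t • v, 0), ⟨trivial, by simp⟩, by simp⟩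
    simp [t, hv]

theorem jacobian_id (y : Model n) : jacobian (fun y : Model n => y) y = 1 := by
  ext j a
  refine (jacobian_apply differentiableAt_id j a).trans ?_
  have : fderiv ℝ (fun y : Model n => y) y = ContinuousLinearMap.id ℝ _ := fderiv_id
  change fderiv ℝ (fun y : Model n => y) y _ _ = _
  rw [this]
  simp [Matrix.one_apply]

theorem jacobian_congr {F G : Model n → Model n} {y : Model n} (h : F =ᶠ[𝓝 y] G) :
    jacobian F y = jacobian G y := by
  ext j a
  have : (fun y' => F y' j) =ᶠ[𝓝 y] fun y' => G y' j := h.mono fun y' h' => by simp only [h']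
  simp only [jacobian, partialDeriv, Matrix.of_apply, this.fderiv_eq]

theorem jacobian_comp {F G : Model n → Model n} {y : Model n} (hF : DifferentiableAt ℝ F y)
    (hG : DifferentiableAt ℝ G (F y)) :
    jacobian (fun y => G (F y)) y = jacobian G (F y) * jacobian F y := by
  ext j a
  have hGj : DifferentiableAt ℝ (fun y => G y j) (F y) :=
    (coordL j).differentiableAt.comp _ hG
  exact partialDeriv_comp hF hGj a

theorem det_jacobian_transition_ne_zero {e e₂ : OpenPartialHomeomorph M (Model n)}
    (he : e ∈ charts n M) (he₂ : e₂ ∈ charts n M) {y : Model n} (hy : y ∈ e.target)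
    (hy₂ : e.symm y ∈ e₂.source) : (jacobian (fun y => e₂ (e.symm y)) y).det ≠ 0 := by
  have h1 := (contDiffAt_transition he he₂ hy hy₂).differentiableAt (by simp)
  have h2 := (contDiffAt_transition he₂ he (e₂.map_source hy₂)
    (by rw [e₂.left_inv hy₂]; exact e.map_target hy)).differentiableAt (by simp)
  have h3 := jacobian_comp h1 h2
  have h4 : (fun y => e (e₂.symm (e₂ (e.symm y)))) =ᶠ[𝓝 y] fun y => y := by
    filter_upwards [e.open_target.mem_nhds hy, (e.continuousAt_symm hy).preimage_mem_nhds
      (e₂.open_source.mem_nhds hy₂)] with y' hy' hy₂'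
    rw [e₂.left_inv hy₂', e.right_inv hy']
  rw [jacobian_congr h4, jacobian_id] at h3
  intro h0
  have := congrArg Matrix.det h3
  rw [Matrix.det_mul, h0, mul_zero, Matrix.det_one] at this
  exact one_ne_zero this

end Charts

/-! ### The Jacobi identity and the modular vector field in coordinates -/

section Jacobi

variable {n : ℕ} {M : Type*} [TopologicalSpace M] [ChartedSpace (Model n) M]

theorem differential_congr {f g : M → ℝ} {x : M} (h : f =ᶠ[𝓝 x] g) :
    differential n f x = differential n g x := by
  have h1 : mfderiv (𝓡 (2 * n)) 𝓘(ℝ, ℝ) f x = mfderiv (𝓡 (2 * n)) 𝓘(ℝ, ℝ) g x := h.mfderiv_eq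
  ext v
  change (mfderiv (𝓡 (2 * n)) 𝓘(ℝ, ℝ) f x v : ℝ) = (mfderiv (𝓡 (2 * n)) 𝓘(ℝ, ℝ) g x v : ℝ)
  rw [h1]
  rfl

variable [T2Space M] [IsManifold (𝓡 (2 * n)) ∞ M]

theorem exists_bump {U : Set M} (hU : IsOpen U) {x : M} (hx : x ∈ U) :
    ∃ b : M → ℝ, ContMDiff (𝓡 (2 * n)) 𝓘(ℝ, ℝ) ∞ b ∧ b =ᶠ[𝓝 x] 1 ∧ tsupport b ⊆ U := by
  obtain ⟨b, -, hb⟩ := (SmoothBumpFunction.nhds_basis_tsupport (I := 𝓡 (2 * n)) x).mem_iff.1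
    (hU.mem_nhds hx)
  exact ⟨b, b.contMDiff, b.eventuallyEq_one, hb⟩

/-- `IsPoisson` tests only global smooth functions, so coordinate functions have to be cut off
before the Jacobi identity applies to them. -/
theorem exists_contMDiffMap_eventuallyEq {e : OpenPartialHomeomorph M (Model n)}
    (he : e ∈ charts n M) {x : M} (hx : x ∈ e.source) (j : Fin (2 * n)) :
    ∃ F : C^∞⟮𝓡 (2 * n), M; ℝ⟯, (F : M → ℝ) =ᶠ[𝓝 x] fun x' => e x' j := by
  obtain ⟨b, hb, hb1, hbs⟩ := exists_bump (n := n) e.open_source hx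
  have hF : ContMDiff (𝓡 (2 * n)) 𝓘(ℝ, ℝ) ∞ (fun x' => b x' * coordL j (e x')) := by
    refine contMDiff_of_tsupport fun x' hx' => ?_
    have hx'e : x' ∈ e.source := hbs (closure_mono (fun z hz => by
      simp only [Function.mem_support] at hz ⊢
      exact fun h0 => hz (by rw [h0, zero_mul])) hx')
    have h1 : ContMDiffAt (𝓡 (2 * n)) 𝓘(ℝ, ℝ) ∞ (fun x' => coordL j (e x')) x' :=
      (coordL j).contDiff.contMDiff.contMDiffAt.comp x' (contMDiffAt_of_mem_maximalAtlas he hx'e)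
    exact hb.contMDiffAt.mul h1
  refine ⟨⟨_, hF⟩, ?_⟩
  filter_upwards [hb1] with x' hx'
  change b x' * coordL j (e x') = e x' j
  rw [hx', coordL_apply, Pi.one_apply, one_mul]

/-- The Jacobi identity in coordinates. -/
theorem jacobi_component {w : BivectorField n M} (hw : w.IsPoisson)
    {e : OpenPartialHomeomorph M (Model n)} (he : e ∈ charts n M) {y : Model n}
    (hy : y ∈ e.target) (i j k : Fin (2 * n)) :
    ∑ l, (component w.toFun e i l y * partialDeriv l (component w.toFun e j k) y +
      component w.toFun e j l y * partialDeriv l (component w.toFun e k i) y +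
      component w.toFun e k l y * partialDeriv l (component w.toFun e i j) y) = 0 := by
  obtain ⟨x, hx, rfl⟩ : ∃ x ∈ e.source, e x = y := ⟨e.symm y, e.map_target hy, e.right_inv hy⟩
  choose F hF using fun j => exists_contMDiffMap_eventuallyEq he hx j
  -- Agreement is needed on a neighbourhood and not only at `x`, because the inner bracket is
  -- differentiated again.
  have hd : ∀ j, ∀ᶠ x' in 𝓝 x, differential n (F j) x' = coordDifferential e j x' := fun j =>
    (hF j).eventually_nhds.mono fun x' hx' => differential_congr hx'
  have hb : ∀ j k, w.bracket (F j) (F k) =ᶠ[𝓝 x] fun x' => component w.toFun e j k (e x') := by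
    intro j k
    filter_upwards [hd j, hd k, e.open_source.mem_nhds hx] with x' h1 h2 h3
    rw [BivectorField.bracket, h1, h2, component_apply_chart _ h3]
  have hbb : ∀ i j k, w.bracket (F i) (w.bracket (F j) (F k)) x =
      ∑ l, component w.toFun e i l (e x) * partialDeriv l (component w.toFun e j k) (e x) := by
    intro i j k
    rw [BivectorField.bracket, (hd i).self_of_nhds, differential_eq_sum he hx (hb j k)
      ((contDiffAt_component w he (e.map_source hx) j k).differentiableAt (by simp))]
    simp only [map_sum, map_smul, smul_eq_mul]
    exact Finset.sum_congr rfl fun l _ => by rw [component_apply_chart _ hx, mul_comm]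
  have h := hw (F i) (F j) (F k) x
  rw [hbb, hbb, hbb] at h
  simpa only [Finset.sum_add_distrib] using h

/-- In coordinates, the modular vector field of a Poisson structure satisfies
`w(d Pf(w), dy_k) = Pf(w) ∑_l ∂_l w^{lk}`. -/
theorem sum_component_mul_partialDeriv_wedgePowComponent {w : BivectorField n M}
    (hw : w.IsPoisson) {e : OpenPartialHomeomorph M (Model n)} (he : e ∈ charts n M)
    {y : Model n} (hy : y ∈ e.target) (k : Fin (2 * n)) :
    ∑ l, component w.toFun e l k y * partialDeriv l (w.wedgePowComponent e) y =
      w.wedgePowComponent e y * ∑ l, partialDeriv l (component w.toFun e l k) y := by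
  have hd : ∀ a b, DifferentiableAt ℝ (component w.toFun e a b) y := fun a b =>
    (contDiffAt_component w he hy a b).differentiableAt (by simp)
  have hpi : HasFDerivAt (fun y a b => component w.toFun e a b y)
      (ContinuousLinearMap.pi fun a => ContinuousLinearMap.pi fun b =>
        fderiv ℝ (component w.toFun e a b) y) y :=
    hasFDerivAt_pi.2 fun a => hasFDerivAt_pi.2 fun b => (hd a b).hasFDerivAt
  have h1 : ∀ l, partialDeriv l (w.wedgePowComponent e) y =
      fderiv ℝ (fun W : Fin (2 * n) → Fin (2 * n) → ℝ => pfaffian (Matrix.of W))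
        (fun a b => component w.toFun e a b y)
        (fun a b => partialDeriv l (component w.toFun e a b) y) := by
    intro l
    have h2 : w.wedgePowComponent e = (fun W : Fin (2 * n) → Fin (2 * n) → ℝ =>
        pfaffian (Matrix.of W)) ∘ (fun y a b => component w.toFun e a b y) :=
      funext fun y => wedgePowComponent_eq_pfaffian w e y
    have h3 := (((contDiff_pfaffian (n := n) (m := 1)).differentiable one_ne_zero
      (fun a b => component w.toFun e a b y)).hasFDerivAt.comp y hpi).fderiv
    rw [partialDeriv, h2, h3]
    rfl
  simp only [h1]
  rw [sum_mul_fderiv_pfaffian (fun a b => component w.toFun e a b y)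
    (fun a b => component_swap w e a b y)
    (fun l a b => partialDeriv l (component w.toFun e a b) y) _
    (fun i j k => jacobi_component hw he hy i j k) k, wedgePowComponent_eq_pfaffian]
  intro l a b
  have : component w.toFun e a b = fun y => -component w.toFun e b a y :=
    funext fun y => component_swap w e a b y
  have h2 : fderiv ℝ (component w.toFun e a b) y = -fderiv ℝ (component w.toFun e b a) y := by
    rw [this]
    exact fderiv_fun_neg
  rw [partialDeriv, h2]
  rfl

end Jacobi

/-! ### Push-forward -/

section Pushforward

variable {n : ℕ} {M : Type*} [TopologicalSpace M] [ChartedSpace (Model n) M]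

/-- The pull-back of covectors by the differential of `φ` at `x`, for `y = φ x`. -/
def pullback (φ : Diff n M) (x y : M) : Cotangent n y →ₗ[ℝ] Cotangent n x where
  toFun α := ContinuousLinearMap.comp (M₂ := Model n) α (mfderiv (𝓡 (2 * n)) (𝓡 (2 * n)) φ x)
  map_add' _ _ := rfl
  map_smul' _ _ := rfl

theorem pullback_differential (φ : Diff n M) {x y : M} (h : φ x = y) (f : M → ℝ) :
    pullback φ x y (differential n f y) = differential n (fun x' => f (φ x')) x := by
  subst h
  have hφ : MDifferentiableAt (𝓡 (2 * n)) (𝓡 (2 * n)) φ x :=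
    φ.contMDiff.contMDiffAt.mdifferentiableAt (by simp)
  have key : mfderiv (𝓡 (2 * n)) 𝓘(ℝ, ℝ) (f ∘ φ) x =
      (mfderiv (𝓡 (2 * n)) 𝓘(ℝ, ℝ) f (φ x)).comp (mfderiv (𝓡 (2 * n)) (𝓡 (2 * n)) φ x) := by
    -- No regularity of `f` is assumed. As `φ` is invertible, `f` and `f ∘ φ` are differentiable at
    -- corresponding points together; otherwise both derivatives have the default value zero.
    by_cases hf : MDifferentiableAt (𝓡 (2 * n)) 𝓘(ℝ, ℝ) f (φ x)
    · exact mfderiv_comp x hf hφ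
    · have hf' : ¬ MDifferentiableAt (𝓡 (2 * n)) 𝓘(ℝ, ℝ) (f ∘ φ) x := by
        intro h
        apply hf
        have h2 : MDifferentiableAt (𝓡 (2 * n)) 𝓘(ℝ, ℝ) ((f ∘ φ) ∘ φ.symm) (φ x) := by
          refine MDifferentiableAt.comp (φ x) ?_
            (φ.symm.contMDiff.contMDiffAt.mdifferentiableAt (by simp))
          rwa [φ.symm_apply_apply]
        convert h2 using 1
        funext z
        simp
      rw [mfderiv_zero_of_not_mdifferentiableAt hf, mfderiv_zero_of_not_mdifferentiableAt hf']
      rfl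
  ext v
  change (mfderiv (𝓡 (2 * n)) 𝓘(ℝ, ℝ) f (φ x) (mfderiv (𝓡 (2 * n)) (𝓡 (2 * n)) φ x v) : ℝ) =
    (mfderiv (𝓡 (2 * n)) 𝓘(ℝ, ℝ) (f ∘ φ) x v : ℝ)
  rw [key]
  rfl

/-- The chart `e ∘ φ`. -/
def pullChart (φ : Diff n M) (e : OpenPartialHomeomorph M (Model n)) :
    OpenPartialHomeomorph M (Model n) :=
  φ.toHomeomorph.transOpenPartialHomeomorph e

theorem pullChart_apply (φ : Diff n M) (e : OpenPartialHomeomorph M (Model n)) (x : M) :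
    pullChart φ e x = e (φ x) :=
  rfl

theorem pullChart_source (φ : Diff n M) (e : OpenPartialHomeomorph M (Model n)) :
    (pullChart φ e).source = φ ⁻¹' e.source :=
  rfl

theorem pullChart_mem_charts [IsManifold (𝓡 (2 * n)) ∞ M] (φ : Diff n M)
    {e : OpenPartialHomeomorph M (Model n)} (he : e ∈ charts n M) :
    pullChart φ e ∈ charts n M := by
  refine OpenPartialHomeomorph.mem_maximalAtlas_of_contMDiffOn _ ?_ ?_
  · exact (contMDiffOn_of_mem_maximalAtlas he).comp φ.contMDiff.contMDiffOn (fun x hx => hx)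
  · exact φ.symm.contMDiff.comp_contMDiffOn (contMDiffOn_symm_of_mem_maximalAtlas he)

/-- The push-forward as a field of bilinear forms. -/
def pushforwardFun (φ : Diff n M) (w : BivectorField n M) (y : M) :
    LinearMap.BilinForm ℝ (Cotangent n y) :=
  (w.toFun (φ.symm y)).compl₁₂ (pullback φ (φ.symm y) y) (pullback φ (φ.symm y) y)

/-- The components of `φ_* w` in `e` are those of `w` in `e ∘ φ`. Smoothness and transversality of
the push-forward thus reduce to those of `w` in another chart. -/
theorem component_pushforwardFun (φ : Diff n M) (w : BivectorField n M)
    (e : OpenPartialHomeomorph M (Model n)) (j k : Fin (2 * n)) (y : Model n) :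
    component (pushforwardFun φ w) e j k y = component w.toFun (pullChart φ e) j k y := by
  have h : ∀ j, pullback φ (φ.symm (e.symm y)) (e.symm y) (coordDifferential e j (e.symm y)) =
      coordDifferential (pullChart φ e) j (φ.symm (e.symm y)) := fun j =>
    pullback_differential φ (φ.apply_symm_apply _) _
  rw [component, pushforwardFun, LinearMap.compl₁₂_apply, h, h]
  rfl

variable [IsManifold (𝓡 (2 * n)) ∞ M]

/-- The push-forward `φ_* w`. -/
def pushforward (φ : Diff n M) (w : BivectorField n M) : BivectorField n M where
  toFun := pushforwardFun φ w
  isAlt y α := w.isAlt (φ.symm y) (pullback φ (φ.symm y) y α)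
  smooth e he j k := by
    have h : component (pushforwardFun φ w) e j k = component w.toFun (pullChart φ e) j k :=
      funext fun y => component_pushforwardFun φ w e j k y
    rw [h]
    exact w.smooth _ (pullChart_mem_charts φ he) j k

theorem component_pushforward (φ : Diff n M) (w : BivectorField n M)
    (e : OpenPartialHomeomorph M (Model n)) (j k : Fin (2 * n)) :
    component (pushforward φ w).toFun e j k = component w.toFun (pullChart φ e) j k :=
  funext fun y => component_pushforwardFun φ w e j k y

theorem wedgePowComponent_pushforward (φ : Diff n M) (w : BivectorField n M)
    (e : OpenPartialHomeomorph M (Model n)) :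
    (pushforward φ w).wedgePowComponent e = w.wedgePowComponent (pullChart φ e) := by
  funext y
  simp only [wedgePowComponent_eq_pfaffian, component_pushforward]

theorem isPushforward_pushforward (φ : Diff n M) (w : BivectorField n M) :
    IsPushforward φ w (pushforward φ w) := by
  intro x α β
  change w.toFun (φ.symm (φ x)) (pullback φ (φ.symm (φ x)) (φ x) α)
    (pullback φ (φ.symm (φ x)) (φ x) β) = w.toFun x (pullback φ x (φ x) α) (pullback φ x (φ x) β)
  rw [φ.symm_apply_apply]

theorem bracket_pushforward (φ : Diff n M) (w : BivectorField n M) (f g : M → ℝ) (x : M) :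
    (pushforward φ w).bracket f g (φ x) =
      w.bracket (fun x' => f (φ x')) (fun x' => g (φ x')) x := by
  rw [BivectorField.bracket, isPushforward_pushforward φ w x, BivectorField.bracket,
    ← pullback_differential φ rfl f, ← pullback_differential φ rfl g]
  rfl

theorem isPoisson_pushforward (φ : Diff n M) {w : BivectorField n M} (hw : w.IsPoisson) :
    (pushforward φ w).IsPoisson := by
  intro f g h y
  obtain ⟨x, rfl⟩ : ∃ x, φ x = y := φ.surjective y
  simp only [bracket_pushforward]
  exact hw (f.comp ⟨φ, φ.contMDiff⟩) (g.comp ⟨φ, φ.contMDiff⟩) (h.comp ⟨φ, φ.contMDiff⟩) x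

theorem isLogSymplectic_pushforward (φ : Diff n M) {w : BivectorField n M}
    (hw : w.IsLogSymplectic) : (pushforward φ w).IsLogSymplectic := by
  refine ⟨isPoisson_pushforward φ hw.1, ?_⟩
  intro e he
  rw [wedgePowComponent_pushforward]
  exact hw.2 _ (pullChart_mem_charts φ he)

theorem mem_singularLocus_pushforward (φ : Diff n M) (w : BivectorField n M) (x : M) :
    φ x ∈ (pushforward φ w).singularLocus ↔ x ∈ w.singularLocus := by
  have he : chartAt (Model n) (φ x) ∈ charts n M := IsManifold.chart_mem_maximalAtlas _
  rw [wedgePow_eq_zero_iff he _ (mem_chart_source _ _), wedgePowComponent_pushforward,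
    wedgePow_eq_zero_iff (pullChart_mem_charts φ he) w (x := x) (mem_chart_source _ (φ x)),
    pullChart_apply]

end Pushforward

/-! ### Joint continuity -/

section Topology

variable {n : ℕ} {M : Type*} [TopologicalSpace M] [ChartedSpace (Model n) M]

theorem exists_chartCompact {M : Type*} [TopologicalSpace M] {e : OpenPartialHomeomorph M (Model n)} {y : Model n}
    (hy : y ∈ e.target) : ∃ K ∈ chartCompacts e, K ∈ 𝓝 y := by
  obtain ⟨K, hK, hyK, hKe⟩ := exists_compact_subset e.open_target hy
  exact ⟨K, ⟨hK, hKe⟩, mem_interior_iff_mem_nhds.1 hyK⟩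

theorem c1Topology_le {e : OpenPartialHomeomorph M (Model n)} (he : e ∈ charts n M)
    (j k : Fin (2 * n)) : BivectorField.c1Topology n M ≤
    TopologicalSpace.induced
        (fun w : BivectorField n M =>
          UniformOnFun.ofFun (chartCompacts e) (component w.toFun e j k)) inferInstance ⊓
      TopologicalSpace.induced
        (fun w : BivectorField n M =>
          UniformOnFun.ofFun (chartCompacts e) (fderiv ℝ (component w.toFun e j k)))
            inferInstance :=
  iInf_le_of_le e (iInf_le_of_le he (iInf_le_of_le j (iInf_le _ k)))

/-- Locally uniform convergence makes evaluation jointly continuous at a continuous function. This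
lemma and the next turn the `C¹`-topology into joint continuity in `(w, y)`, the form in which it is
used from here on. -/
theorem continuousAt_component {e : OpenPartialHomeomorph M (Model n)} (he : e ∈ charts n M)
    (w : BivectorField n M) {y : Model n} (hy : y ∈ e.target) (j k : Fin (2 * n)) :
    ContinuousAt (fun q : BivectorField n M × Model n => component q.1.toFun e j k q.2)
      (w, y) := by
  have h1 : Continuous (fun w : BivectorField n M =>
      UniformOnFun.ofFun (chartCompacts e) (component w.toFun e j k)) :=
    continuous_iff_le_induced.2 ((c1Topology_le he j k).trans inf_le_left)
  have h2 := UniformOnFun.continuousAt_eval₂ (𝔖 := chartCompacts e)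
    (f := UniformOnFun.ofFun (chartCompacts e) (component w.toFun e j k)) (x := y)
    (exists_chartCompact hy)
    ((w.smooth e he j k).continuousOn.continuousAt (e.open_target.mem_nhds hy))
  exact ContinuousAt.comp (x := (w, y)) (f := fun q : BivectorField n M × Model n =>
    (UniformOnFun.ofFun (chartCompacts e) (component q.1.toFun e j k), q.2)) h2
    ((h1.comp continuous_fst).prodMk continuous_snd).continuousAt

theorem continuousAt_fderiv_component {e : OpenPartialHomeomorph M (Model n)}
    (he : e ∈ charts n M) (w : BivectorField n M) {y : Model n} (hy : y ∈ e.target)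
    (j k : Fin (2 * n)) :
    ContinuousAt (fun q : BivectorField n M × Model n =>
      fderiv ℝ (component q.1.toFun e j k) q.2) (w, y) := by
  have h1 : Continuous (fun w : BivectorField n M =>
      UniformOnFun.ofFun (chartCompacts e) (fderiv ℝ (component w.toFun e j k))) :=
    continuous_iff_le_induced.2 ((c1Topology_le he j k).trans inf_le_right)
  have h2 := UniformOnFun.continuousAt_eval₂ (𝔖 := chartCompacts e)
    (f := UniformOnFun.ofFun (chartCompacts e) (fderiv ℝ (component w.toFun e j k))) (x := y)
    (exists_chartCompact hy)
    (((w.smooth e he j k).contDiffAt (e.open_target.mem_nhds hy)).continuousAt_fderiv (by simp))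
  exact ContinuousAt.comp (x := (w, y)) (f := fun q : BivectorField n M × Model n =>
    (UniformOnFun.ofFun (chartCompacts e) (fderiv ℝ (component q.1.toFun e j k)), q.2)) h2
    ((h1.comp continuous_fst).prodMk continuous_snd).continuousAt

/-- A jointly continuous family of functions is continuous for the topology of compact
convergence. -/
theorem continuous_ofFun_of_continuousAt {X Y : Type*} [TopologicalSpace X] [TopologicalSpace Y]
    {𝔖 : Set (Set Y)} {F : X → Y → ℝ}
    (h : ∀ K ∈ 𝔖, IsCompact K ∧ ∀ x, ∀ y ∈ K, ContinuousAt (Function.uncurry F) (x, y)) :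
    Continuous (fun x => UniformOnFun.ofFun 𝔖 (F x)) := by
  rw [continuous_iff_continuousAt]
  intro x
  rw [ContinuousAt, UniformOnFun.tendsto_iff_tendstoUniformlyOn]
  intro K hK u hu
  obtain ⟨v, hv, hvu⟩ := (h K hK).1.mem_uniformity_of_prod (f := F) (s := Set.univ) (q := x)
    (fun q hq => ((h K hK).2 q.1 q.2 hq.2).continuousWithinAt) (Set.mem_univ x)
    (symm_le_uniformity hu)
  rw [nhdsWithin_univ] at hv
  filter_upwards [hv] with x' hx' y hy using hvu x' hx' y hy

end Topology

/-! ### Families of smooth functions that are jointly continuous with their first derivatives -/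

section ParamC1

variable {P : Type*} [TopologicalSpace P] {E F G H : Type*} [NormedAddCommGroup E]
  [NormedSpace ℝ E] [NormedAddCommGroup F] [NormedSpace ℝ F] [NormedAddCommGroup G]
  [NormedSpace ℝ G] [NormedAddCommGroup H] [NormedSpace ℝ H]

/-- Near `(p, y)`, the functions `f p` are smooth, and they and their first derivatives are jointly
continuous. -/
def ParamC1At (f : P → E → F) (p : P) (y : E) : Prop :=
  ∀ᶠ q : P × E in 𝓝 (p, y), ContDiffAt ℝ ∞ (f q.1) q.2 ∧
    ContinuousAt (fun q : P × E => f q.1 q.2) q ∧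
    ContinuousAt (fun q : P × E => fderiv ℝ (f q.1) q.2) q

namespace ParamC1At

variable {f : P → E → F} {p : P} {y : E}

theorem contDiffAt (h : ParamC1At f p y) : ContDiffAt ℝ ∞ (f p) y :=
  h.self_of_nhds.1

theorem differentiableAt (h : ParamC1At f p y) : DifferentiableAt ℝ (f p) y :=
  h.contDiffAt.differentiableAt (by simp)

theorem continuousAt (h : ParamC1At f p y) : ContinuousAt (fun q : P × E => f q.1 q.2) (p, y) :=
  h.self_of_nhds.2.1

theorem continuousAt_fderiv (h : ParamC1At f p y) :
    ContinuousAt (fun q : P × E => fderiv ℝ (f q.1) q.2) (p, y) :=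
  h.self_of_nhds.2.2

theorem eventually (h : ParamC1At f p y) : ∀ᶠ q : P × E in 𝓝 (p, y), ParamC1At f q.1 q.2 :=
  h.eventually_nhds

theorem congr {f' : P → E → F} (h : ParamC1At f p y)
    (hff' : ∀ᶠ q : P × E in 𝓝 (p, y), f' q.1 q.2 = f q.1 q.2) : ParamC1At f' p y := by
  -- Derivatives are taken with the parameter fixed, so agreement near `(p, y)` must be turned into
  -- agreement of the slices near each nearby point.
  have hslice : ∀ᶠ q : P × E in 𝓝 (p, y), f' q.1 =ᶠ[𝓝 q.2] f q.1 :=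
    hff'.eventually_nhds.mono fun q hq => by
      have hq' : ∀ᶠ r : P × E in 𝓝 q.1 ×ˢ 𝓝 q.2, f' r.1 r.2 = f r.1 r.2 := by
        rwa [← nhds_prod_eq]
      exact hq'.curry.self_of_nhds
  filter_upwards [h, hff'.eventually_nhds, hslice, hslice.eventually_nhds]
    with q hq hev hs hse
  refine ⟨hq.1.congr_of_eventuallyEq hs, hq.2.1.congr_of_eventuallyEq hev, ?_⟩
  exact hq.2.2.congr_of_eventuallyEq (hse.mono fun r hr => hr.fderiv_eq)

theorem of_contDiffAt {g : E → F} (hg : ∀ᶠ y' in 𝓝 y, ContDiffAt ℝ ∞ g y') (p : P) :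
    ParamC1At (fun _ => g) p y := by
  have h : ∀ᶠ q : P × E in 𝓝 (p, y), ContDiffAt ℝ ∞ g q.2 :=
    continuousAt_snd.eventually hg
  filter_upwards [h] with q hq
  refine ⟨hq, ContinuousAt.comp (f := Prod.snd) hq.continuousAt continuousAt_snd, ?_⟩
  exact ContinuousAt.comp (f := Prod.snd) (g := fderiv ℝ g) (hq.continuousAt_fderiv (by simp))
    continuousAt_snd

theorem of_contDiff {g : E → F} (hg : ContDiff ℝ ∞ g) (p : P) (y : E) :
    ParamC1At (fun _ => g) p y :=
  of_contDiffAt (Filter.Eventually.of_forall fun _ => hg.contDiffAt) p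

theorem comp {g : P → F → G} (hg : ParamC1At g p (f p y)) (hf : ParamC1At f p y) :
    ParamC1At (fun p y => g p (f p y)) p y := by
  have hT : ∀ q : P × E, ContinuousAt (fun q : P × E => f q.1 q.2) q →
      ContinuousAt (fun q : P × E => (q.1, f q.1 q.2)) q :=
    fun q hq => continuousAt_fst.prodMk hq
  have h1 : ∀ᶠ q : P × E in 𝓝 (p, y), ParamC1At g q.1 (f q.1 q.2) :=
    (hT _ hf.continuousAt).eventually hg.eventually
  have h2 : ∀ᶠ q : P × E in 𝓝 (p, y), fderiv ℝ (fun y => g q.1 (f q.1 y)) q.2 =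
      (fderiv ℝ (g q.1) (f q.1 q.2)).comp (fderiv ℝ (f q.1) q.2) := by
    filter_upwards [h1, hf.eventually] with q hgq hfq
    exact (hgq.differentiableAt.hasFDerivAt.comp q.2 hfq.differentiableAt.hasFDerivAt).fderiv
  filter_upwards [h1, hf.eventually, h2.eventually_nhds] with q hgq hfq hev
  refine ⟨hgq.contDiffAt.comp q.2 hfq.contDiffAt,
    ContinuousAt.comp (f := fun q : P × E => (q.1, f q.1 q.2)) hgq.continuousAt
      (hT q hfq.continuousAt), ?_⟩
  refine ContinuousAt.congr_of_eventuallyEq ?_ hev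
  exact (ContinuousAt.comp (f := fun q : P × E => (q.1, f q.1 q.2)) hgq.continuousAt_fderiv
    (hT q hfq.continuousAt)).clm_comp hfq.continuousAt_fderiv

theorem contDiff_comp {g : F → G} (hg : ContDiff ℝ ∞ g) (hf : ParamC1At f p y) :
    ParamC1At (fun p y => g (f p y)) p y :=
  comp (g := fun _ => g) (of_contDiff hg p _) hf

theorem prodMk {g : P → E → G} (hf : ParamC1At f p y) (hg : ParamC1At g p y) :
    ParamC1At (fun p y => (f p y, g p y)) p y := by
  have h2 : ∀ᶠ q : P × E in 𝓝 (p, y), fderiv ℝ (fun y => (f q.1 y, g q.1 y)) q.2 =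
      (fderiv ℝ (f q.1) q.2).prod (fderiv ℝ (g q.1) q.2) := by
    filter_upwards [hg.eventually, hf.eventually] with q hgq hfq
    exact (hfq.differentiableAt.hasFDerivAt.prodMk hgq.differentiableAt.hasFDerivAt).fderiv
  filter_upwards [hg.eventually, hf.eventually, h2.eventually_nhds] with q hgq hfq hev
  refine ⟨hfq.contDiffAt.prodMk hgq.contDiffAt, hfq.continuousAt.prodMk hgq.continuousAt, ?_⟩
  refine ContinuousAt.congr_of_eventuallyEq ?_ hev
  have h3 : ∀ (A : E →L[ℝ] F) (B : E →L[ℝ] G), A.prod B =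
      (ContinuousLinearMap.inl ℝ F G).comp A + (ContinuousLinearMap.inr ℝ F G).comp B := by
    intro A B
    ext v <;> simp
  simp only [h3]
  exact (continuousAt_const.clm_comp hfq.continuousAt_fderiv).add
    (continuousAt_const.clm_comp hgq.continuousAt_fderiv)

theorem pi {ι : Type*} [Fintype ι] {f : P → E → ι → F}
    (hf : ∀ i, ParamC1At (fun p y => f p y i) p y) : ParamC1At f p y := by
  have hev : ∀ᶠ q : P × E in 𝓝 (p, y), ∀ i, ParamC1At (fun p y => f p y i) q.1 q.2 :=
    Filter.eventually_all.2 fun i => (hf i).eventually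
  have h2 : ∀ᶠ q : P × E in 𝓝 (p, y), fderiv ℝ (f q.1) q.2 =
      ContinuousLinearMap.pi fun i => fderiv ℝ (fun y => f q.1 y i) q.2 := by
    filter_upwards [hev] with q hq
    exact (hasFDerivAt_pi.2 fun i => (hq i).differentiableAt.hasFDerivAt).fderiv
  filter_upwards [hev, h2.eventually_nhds] with q hq hev'
  refine ⟨contDiffAt_pi.2 fun i => (hq i).contDiffAt,
    continuousAt_pi.2 fun i => (hq i).continuousAt, ?_⟩
  refine ContinuousAt.congr_of_eventuallyEq ?_ hev'
  classical
  have h3 : ∀ A : ι → E →L[ℝ] F, ContinuousLinearMap.pi A =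
      ∑ i, (ContinuousLinearMap.single ℝ (fun _ : ι => F) i).comp (A i) := by
    intro A
    ext v i
    simp [Finset.sum_apply, Pi.single_apply]
  simp only [h3]
  exact tendsto_finsetSum _ fun i _ => continuousAt_const.clm_comp (hq i).continuousAt_fderiv

theorem mul {f g : P → E → ℝ} (hf : ParamC1At f p y) (hg : ParamC1At g p y) :
    ParamC1At (fun p y => f p y * g p y) p y :=
  contDiff_comp (g := fun v : ℝ × ℝ => v.1 * v.2) (contDiff_fst.mul contDiff_snd) (hf.prodMk hg)

theorem sub {g : P → E → F} (hf : ParamC1At f p y) (hg : ParamC1At g p y) :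
    ParamC1At (fun p y => f p y - g p y) p y :=
  contDiff_comp (g := fun v : F × F => v.1 - v.2) (contDiff_fst.sub contDiff_snd) (hf.prodMk hg)

theorem add {g : P → E → F} (hf : ParamC1At f p y) (hg : ParamC1At g p y) :
    ParamC1At (fun p y => f p y + g p y) p y :=
  contDiff_comp (g := fun v : F × F => v.1 + v.2) (contDiff_fst.add contDiff_snd) (hf.prodMk hg)

theorem const (c : F) (p : P) (y : E) : ParamC1At (fun _ _ => c) p y :=
  of_contDiff (g := fun _ => c) contDiff_const p y

theorem id (p : P) (y : E) : ParamC1At (fun _ y => y) p y :=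
  of_contDiff (g := fun y => y) contDiff_id p y

theorem div {f g : P → E → ℝ} (hf : ParamC1At f p y) (hg : ParamC1At g p y)
    (h0 : g p y ≠ 0) : ParamC1At (fun p y => f p y / g p y) p y := by
  have hinv : ParamC1At (fun (_ : P) (t : ℝ) => t⁻¹) p (g p y) :=
    of_contDiffAt (Filter.Eventually.mono (isOpen_ne.mem_nhds h0)
      fun t ht => contDiffAt_inv ℝ ht) p
  exact (hf.mul (comp hinv hg)).congr
    (Filter.Eventually.of_forall fun q => div_eq_mul_inv _ _)

end ParamC1At

end ParamC1

/-! ### Families of maps of a manifold -/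

section Families

section Prod

variable {n : ℕ} {M : Type*} [TopologicalSpace M] {P : Type*} [TopologicalSpace P]

theorem tendsto_prod_symm {e : OpenPartialHomeomorph M (Model n)} (p : P) {x : M}
    (hx : x ∈ e.source) :
    Filter.Tendsto (fun q : P × Model n => (q.1, e.symm q.2)) (𝓝 (p, e x)) (𝓝 (p, x)) := by
  have h : ContinuousAt (fun q : P × Model n => (q.1, e.symm q.2)) (p, e x) :=
    continuousAt_fst.prodMk (ContinuousAt.comp (f := Prod.snd)
      (e.continuousAt_symm (e.map_source hx)) continuousAt_snd)
  simpa only [ContinuousAt, e.left_inv hx] using h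

theorem tendsto_prod_chart {e : OpenPartialHomeomorph M (Model n)} (p : P) {x : M}
    (hx : x ∈ e.source) :
    Filter.Tendsto (fun q : P × M => (q.1, e q.2)) (𝓝 (p, x)) (𝓝 (p, e x)) :=
  continuousAt_fst.prodMk (ContinuousAt.comp (f := Prod.snd) (e.continuousAt hx) continuousAt_snd)

end Prod

variable {n : ℕ} {M : Type*} [TopologicalSpace M] [ChartedSpace (Model n) M]

theorem paramC1At_component {e : OpenPartialHomeomorph M (Model n)} (he : e ∈ charts n M)
    (p : Poiss n M) {y : Model n} (hy : y ∈ e.target) (j k : Fin (2 * n)) :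
    ParamC1At (fun (p : Poiss n M) y => component p.1.toFun e j k y) p y := by
  have h : ∀ᶠ q : Poiss n M × Model n in 𝓝 (p, y), q.2 ∈ e.target :=
    continuousAt_snd.eventually (e.open_target.mem_nhds hy)
  have hc : Continuous (fun q : Poiss n M × Model n => (q.1.1, q.2)) :=
    (continuous_subtype_val.comp continuous_fst).prodMk continuous_snd
  filter_upwards [h] with q hq
  exact ⟨contDiffAt_component q.1.1 he hq j k,
    ContinuousAt.comp (f := fun q : Poiss n M × Model n => (q.1.1, q.2))
      (continuousAt_component he q.1.1 hq j k) hc.continuousAt,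
    ContinuousAt.comp (f := fun q : Poiss n M × Model n => (q.1.1, q.2))
      (continuousAt_fderiv_component he q.1.1 hq j k) hc.continuousAt⟩

theorem paramC1At_wedgePowComponent {e : OpenPartialHomeomorph M (Model n)} (he : e ∈ charts n M)
    (p : Poiss n M) {y : Model n} (hy : y ∈ e.target) :
    ParamC1At (fun (p : Poiss n M) y => p.1.wedgePowComponent e y) p y := by
  have h : ParamC1At (fun (p : Poiss n M) y j k => component p.1.toFun e j k y) p y :=
    ParamC1At.pi fun j => ParamC1At.pi fun k => paramC1At_component he p hy j k
  exact (ParamC1At.contDiff_comp (contDiff_pfaffian (n := n)) h).congr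
    (Filter.Eventually.of_forall fun q => wedgePowComponent_eq_pfaffian _ _ _)

variable {P : Type*} [TopologicalSpace P]

/-- `Φ` is, near `(p, x)`, a family of smooth maps that is jointly continuous together with its
first derivatives. -/
def FamilyAt (Φ : P → M → M) (p : P) (x : M) : Prop :=
  ∃ e ∈ charts n M, ∃ e' ∈ charts n M, x ∈ e.source ∧
    (∀ᶠ q : P × M in 𝓝 (p, x), Φ q.1 q.2 ∈ e'.source) ∧
    ParamC1At (fun p y => e' (Φ p (e.symm y))) p (e x)

namespace FamilyAt

variable {Φ : P → M → M} {p : P} {x : M}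

theorem continuousAt (h : FamilyAt (n := n) Φ p x) :
    ContinuousAt (fun q : P × M => Φ q.1 q.2) (p, x) := by
  obtain ⟨e, he, e', he', hx, hev, hc⟩ := h
  have h1 : ContinuousAt (fun q : P × M => e'.symm (e' (Φ q.1 (e.symm (e q.2))))) (p, x) := by
    refine ContinuousAt.comp (g := e'.symm) (f := fun q : P × M => e' (Φ q.1 (e.symm (e q.2)))) ?_ ?_
    · refine e'.continuousAt_symm (e'.map_source ?_)
      simpa only [e.left_inv hx] using hev.self_of_nhds
    · exact hc.continuousAt.tendsto.comp (tendsto_prod_chart p hx)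
  refine h1.congr ?_
  filter_upwards [hev, continuousAt_snd.eventually (e.open_source.mem_nhds hx)] with q hq hqe
  rw [e.left_inv hqe, e'.left_inv hq]

theorem eventually (h : FamilyAt (n := n) Φ p x) :
    ∀ᶠ q : P × M in 𝓝 (p, x), FamilyAt (n := n) Φ q.1 q.2 := by
  obtain ⟨e, he, e', he', hx, hev, hc⟩ := h
  filter_upwards [hev.eventually_nhds, continuousAt_snd.eventually (e.open_source.mem_nhds hx),
    (tendsto_prod_chart p hx).eventually hc.eventually] with q h1 h2 h3
  exact ⟨e, he, e', he', h2, h1, h3⟩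

/-- `FamilyAt` provides one pair of charts; composing with the smooth transition maps on both sides
reaches every other pair. -/
theorem paramC1At (h : FamilyAt (n := n) Φ p x) {e e' : OpenPartialHomeomorph M (Model n)}
    (he : e ∈ charts n M) (he' : e' ∈ charts n M) (hx : x ∈ e.source)
    (hΦ : Φ p x ∈ e'.source) : ParamC1At (fun p y => e' (Φ p (e.symm y))) p (e x) := by
  have hΦev : ∀ᶠ q : P × M in 𝓝 (p, x), Φ q.1 q.2 ∈ e'.source :=
    h.continuousAt.eventually (e'.open_source.mem_nhds hΦ)
  obtain ⟨e₁, he₁, e₁', he₁', hx₁, hev, hc⟩ := h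
  have h1 : ∀ᶠ y in 𝓝 (e x), ContDiffAt ℝ ∞ (fun y => e₁ (e.symm y)) y := by
    filter_upwards [e.open_target.mem_nhds (e.map_source hx),
      (e.continuousAt_symm (e.map_source hx)).preimage_mem_nhds
        (e₁.open_source.mem_nhds (by rwa [e.left_inv hx]))] with y hy hy'
    exact contDiffAt_transition he he₁ hy hy'
  have hΦ1 : Φ p x ∈ e₁'.source := hev.self_of_nhds
  have h2 : ∀ᶠ y in 𝓝 (e₁' (Φ p x)), ContDiffAt ℝ ∞ (fun y => e' (e₁'.symm y)) y := by
    filter_upwards [e₁'.open_target.mem_nhds (e₁'.map_source hΦ1),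
      (e₁'.continuousAt_symm (e₁'.map_source hΦ1)).preimage_mem_nhds
        (e'.open_source.mem_nhds (by rwa [e₁'.left_inv hΦ1]))] with y hy hy'
    exact contDiffAt_transition he₁' he' hy hy'
  have c1 := ParamC1At.of_contDiffAt h1 p
  have c2 : ParamC1At (fun p y => e₁' (Φ p (e₁.symm (e₁ (e.symm y))))) p (e x) :=
    ParamC1At.comp (g := fun p y => e₁' (Φ p (e₁.symm y))) (f := fun _ y => e₁ (e.symm y))
      (by simpa only [e.left_inv hx] using hc) c1
  have c3 := ParamC1At.comp (g := fun _ y => e' (e₁'.symm y))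
    (f := fun p y => e₁' (Φ p (e₁.symm (e₁ (e.symm y))))) (p := p) (y := e x)
    (ParamC1At.of_contDiffAt (by simpa only [e.left_inv hx, e₁.left_inv hx₁] using h2) p) c2
  refine c3.congr ?_
  filter_upwards [(tendsto_prod_symm p hx).eventually hev, (tendsto_prod_symm p hx).eventually
    (continuousAt_snd.eventually (e₁.open_source.mem_nhds hx₁))] with q hq hq1
  rw [e₁.left_inv hq1, e₁'.left_inv hq]

theorem congr {Φ' : P → M → M} (h : FamilyAt (n := n) Φ p x)
    (hΦ : ∀ᶠ q : P × M in 𝓝 (p, x), Φ' q.1 q.2 = Φ q.1 q.2) : FamilyAt (n := n) Φ' p x := by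
  obtain ⟨e, he, e', he', hx, hev, hc⟩ := h
  refine ⟨e, he, e', he', hx, ?_, hc.congr ?_⟩
  · filter_upwards [hev, hΦ] with q h1 h2
    rwa [h2]
  · filter_upwards [(tendsto_prod_symm p hx).eventually hΦ] with q h2
    rw [h2]

theorem of_id [IsManifold (𝓡 (2 * n)) ∞ M] (p : P) (x : M) :
    FamilyAt (n := n) (fun _ : P => fun x : M => x) p x := by
  have he : chartAt (Model n) x ∈ charts n M := IsManifold.chart_mem_maximalAtlas _
  refine ⟨_, he, _, he, mem_chart_source _ x, continuousAt_snd.eventually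
    ((chartAt (Model n) x).open_source.mem_nhds (mem_chart_source _ x)), ?_⟩
  refine (ParamC1At.id p _).congr ?_
  filter_upwards [continuousAt_snd.eventually ((chartAt (Model n) x).open_target.mem_nhds
    (mem_chart_target _ x))] with q hq
  exact (chartAt (Model n) x).right_inv hq

end FamilyAt

end Families

/-! ### Straightening the singular locus -/

section Straighten

/-- A local inverse theorem for smooth maps. -/
theorem exists_openPartialHomeomorph_of_contDiffAt {E : Type*} [NormedAddCommGroup E]
    [NormedSpace ℝ E] [CompleteSpace E] {G : E → E} {U : Set E} (hU : IsOpen U)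
    (hG : ∀ y ∈ U, ContDiffAt ℝ ∞ G y) {a : E} (ha : a ∈ U) {A : E ≃L[ℝ] E}
    (hA : HasFDerivAt G (A : E →L[ℝ] E) a) :
    ∃ g : OpenPartialHomeomorph E E, a ∈ g.source ∧ g.source ⊆ U ∧ (∀ y, g y = G y) ∧
      ContDiffOn ℝ ∞ g g.source ∧ ContDiffOn ℝ ∞ g.symm g.target := by
  let g₀ := (hG a ha).toOpenPartialHomeomorph G hA (by simp)
  have hcont : ContinuousOn (fderiv ℝ G) U := fun y hy =>
    ((hG y hy).continuousAt_fderiv (by simp)).continuousWithinAt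
  -- The inverse function theorem gives smoothness of the inverse only at points over which the
  -- derivative is invertible. Restricting to the open set of such points makes the inverse smooth
  -- on its whole domain.
  let S := U ∩ fderiv ℝ G ⁻¹' Set.range ((↑) : (E ≃L[ℝ] E) → E →L[ℝ] E)
  have hS : IsOpen S := hcont.isOpen_inter_preimage hU ContinuousLinearEquiv.isOpen
  have haS : a ∈ S := ⟨ha, A, hA.fderiv.symm⟩
  let g := g₀.restrOpen S hS
  have hg : ∀ y, g y = G y := fun y => rfl
  have hsrc : g.source ⊆ S := fun y hy => hy.2
  refine ⟨g, ⟨(hG a ha).mem_toOpenPartialHomeomorph_source hA (by simp), haS⟩,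
    fun y hy => (hsrc hy).1, hg, ?_, ?_⟩
  · intro y hy
    exact (hG y (hsrc hy).1).contDiffWithinAt
  · intro y hy
    obtain ⟨hyU, B, hB⟩ := hsrc (g.map_target hy)
    have hd : HasFDerivAt g (B : E →L[ℝ] E) (g.symm y) := by
      rw [hB]
      exact ((hG _ hyU).differentiableAt (by simp)).hasFDerivAt
    exact (g.contDiffAt_symm hy hd (hG _ hyU)).contDiffWithinAt

/-- The map replaces the `i`-th coordinate of `v` by `L v`. A vector in its kernel is a multiple of
the `i`-th basis vector and is killed by `L`, hence is zero. -/
theorem exists_equiv_replace_coord {m : ℕ} (L : EuclideanSpace ℝ (Fin m) →L[ℝ] ℝ) {i : Fin m}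
    (hL : L (EuclideanSpace.single i 1) ≠ 0) :
    ∃ A : EuclideanSpace ℝ (Fin m) ≃L[ℝ] EuclideanSpace ℝ (Fin m),
      (A : EuclideanSpace ℝ (Fin m) →L[ℝ] EuclideanSpace ℝ (Fin m)) =
        ContinuousLinearMap.id ℝ _ +
          (L - coordL i).smulRight (EuclideanSpace.single i (1 : ℝ)) := by
  set D := ContinuousLinearMap.id ℝ (EuclideanSpace ℝ (Fin m)) +
    (L - coordL i).smulRight (EuclideanSpace.single i (1 : ℝ)) with hD
  have hinj : Function.Injective (D : EuclideanSpace ℝ (Fin m) →ₗ[ℝ] EuclideanSpace ℝ (Fin m)) := by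
    rw [injective_iff_map_eq_zero]
    intro v hv
    have hv' : v + (L v - v i) • EuclideanSpace.single i (1 : ℝ) = 0 := hv
    have h1 : v = (v i - L v) • EuclideanSpace.single i (1 : ℝ) := by
      have := eq_neg_of_add_eq_zero_left hv'
      rwa [← neg_smul, neg_sub] at this
    have h2 : L v = 0 := by
      have := congrArg (coordL i) hv'
      simpa [coordL_apply] using this
    rw [h2, sub_zero] at h1
    have h3 := congrArg L h1
    rw [h2, map_smul, smul_eq_mul, eq_comm, mul_eq_zero] at h3
    rw [h1, h3.resolve_right hL, zero_smul]
  refine ⟨(LinearEquiv.ofInjectiveEndo _ hinj).toContinuousLinearEquiv, ?_⟩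
  ext v
  rfl

variable {n : ℕ} {M : Type*} [TopologicalSpace M] [ChartedSpace (Model n) M]
  [IsManifold (𝓡 (2 * n)) ∞ M]

/-- A function with non-vanishing differential is a coordinate function. -/
theorem exists_chart_coord_eq {e₀ : OpenPartialHomeomorph M (Model n)} (he₀ : e₀ ∈ charts n M)
    {f : Model n → ℝ} (hf : ∀ y ∈ e₀.target, ContDiffAt ℝ ∞ f y) {x : M} (hx : x ∈ e₀.source)
    (hfx : fderiv ℝ f (e₀ x) ≠ 0) :
    ∃ (i : Fin (2 * n)) (e : OpenPartialHomeomorph M (Model n)), e ∈ charts n M ∧ x ∈ e.source ∧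
      e.source ⊆ e₀.source ∧ ∀ x' ∈ e.source, e x' i = f (e₀ x') := by
  obtain ⟨i, hi⟩ : ∃ i, fderiv ℝ f (e₀ x) (EuclideanSpace.single i 1) ≠ 0 := by
    by_contra! hc
    refine hfx (ContinuousLinearMap.ext fun v => ?_)
    rw [fderiv_apply_eq_sum]
    simp [partialDeriv, hc]
  obtain ⟨A, hA⟩ := exists_equiv_replace_coord _ hi
  -- `G` exchanges the `i`-th coordinate for `f` and keeps the others.
  let G : Model n → Model n := fun y => y + (f y - coordL i y) • EuclideanSpace.single i (1 : ℝ)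
  have hG : ∀ y ∈ e₀.target, ContDiffAt ℝ ∞ G y := fun y hy =>
    contDiffAt_id.add (((hf y hy).sub (coordL i).contDiff.contDiffAt).smul contDiffAt_const)
  have hGA : HasFDerivAt G (A : Model n →L[ℝ] Model n) (e₀ x) := by
    rw [hA]
    exact (hasFDerivAt_id _).add ((((hf _ (e₀.map_source hx)).differentiableAt
      (by simp)).hasFDerivAt.sub (coordL i).hasFDerivAt).smul_const _)
  obtain ⟨g, hg, hgU, hgG, hgs, hgt⟩ := exists_openPartialHomeomorph_of_contDiffAt
    e₀.open_target hG (e₀.map_source hx) hGA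
  refine ⟨i, e₀.trans g, ?_, ?_, ?_, ?_⟩
  · refine OpenPartialHomeomorph.mem_maximalAtlas_of_contMDiffOn _ ?_ ?_
    · refine (contMDiffOn_iff_contDiffOn.2 hgs).comp
        ((contMDiffOn_of_mem_maximalAtlas he₀).mono ?_) ?_
      · exact fun x' hx' => (e₀.trans_source g ▸ hx').1
      · exact fun x' hx' => (e₀.trans_source g ▸ hx').2
    · refine (contMDiffOn_symm_of_mem_maximalAtlas he₀).comp
        ((contMDiffOn_iff_contDiffOn.2 hgt).mono ?_) ?_
      · exact fun x' hx' => (e₀.trans_target g ▸ hx').1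
      · exact fun x' hx' => (e₀.trans_target g ▸ hx').2
  · rw [e₀.trans_source]
    exact ⟨hx, hg⟩
  · exact fun x' hx' => (e₀.trans_source g ▸ hx').1
  · intro x' hx'
    have : (e₀.trans g) x' = G (e₀ x') := hgG _
    rw [this]
    simp [G, coordL_apply]

end Straighten

/-! ### Comparing defining functions of the singular loci -/

section Ratio

variable {n : ℕ} {M : Type*} [TopologicalSpace M] [ChartedSpace (Model n) M]

theorem contDiffAt_det_jacobian {F : Model n → Model n} {y : Model n} (hF : ContDiffAt ℝ ∞ F y) :
    ContDiffAt ℝ ∞ (fun y => (jacobian F y).det) y := by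
  have h : ∀ j a, ContDiffAt ℝ ∞ (fun y => jacobian F y j a) y := by
    intro j a
    have hFj : ContDiffAt ℝ ∞ (fun y => coordL j (F y)) y :=
      (coordL j).contDiff.contDiffAt.comp y hF
    exact (hFj.fderiv_right (m := ∞) (by simp)).clm_apply contDiffAt_const
  simp only [Matrix.det_apply]
  exact ContDiffAt.sum fun σ _ => (contDiffAt_prod fun j _ => h _ _).const_smul _

theorem paramC1At_det_jacobian {e e₂ : OpenPartialHomeomorph M (Model n)} (he : e ∈ charts n M)
    (he₂ : e₂ ∈ charts n M) {P : Type*} [TopologicalSpace P] (p : P) {y : Model n}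
    (hy : y ∈ e.target) (hy₂ : e.symm y ∈ e₂.source) :
    ParamC1At (fun (_ : P) y => (jacobian (fun y => e₂ (e.symm y)) y).det) p y := by
  refine ParamC1At.of_contDiffAt ?_ p
  filter_upwards [e.open_target.mem_nhds hy,
    (e.continuousAt_symm hy).preimage_mem_nhds (e₂.open_source.mem_nhds hy₂)] with y' h1 h2
  exact contDiffAt_det_jacobian (contDiffAt_transition he he₂ h1 h2)

theorem paramC1At_transition {e e₂ : OpenPartialHomeomorph M (Model n)} (he : e ∈ charts n M)
    (he₂ : e₂ ∈ charts n M) {P : Type*} [TopologicalSpace P] (p : P) {y : Model n}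
    (hy : y ∈ e.target) (hy₂ : e.symm y ∈ e₂.source) :
    ParamC1At (fun (_ : P) y => e₂ (e.symm y)) p y := by
  refine ParamC1At.of_contDiffAt ?_ p
  filter_upwards [e.open_target.mem_nhds hy,
    (e.continuousAt_symm hy).preimage_mem_nhds (e₂.open_source.mem_nhds hy₂)] with y' h1 h2
  exact contDiffAt_transition he he₂ h1 h2

/-- Near `(p, x)`, the function `⋀ⁿπ ∘ Φ p` in the chart `e` is a multiple of `⋀ⁿp` in the chart
`e'`; the factor is a family of smooth functions with value `r` at `(p, x)`. -/
def RatioAt (π : Poiss n M) (Φ : Poiss n M → M → M) (e' e : OpenPartialHomeomorph M (Model n))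
    (p : Poiss n M) (x : M) (r : ℝ) : Prop :=
  ∃ c : Poiss n M → Model n → ℝ, ParamC1At c p (e' x) ∧ c p (e' x) = r ∧
    ∀ᶠ q : Poiss n M × Model n in 𝓝 (p, e' x),
      π.1.wedgePowComponent e (e (Φ q.1 (e'.symm q.2))) =
        c q.1 q.2 * q.1.1.wedgePowComponent e' q.2

variable {π p : Poiss n M} {Φ Φ' : Poiss n M → M → M} {x : M} {r : ℝ}

theorem RatioAt.congr {e e' : OpenPartialHomeomorph M (Model n)} (h : RatioAt π Φ e' e p x r)
    (hx : x ∈ e'.source)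
    (hΦ : ∀ᶠ q : Poiss n M × M in 𝓝 (p, x), Φ' q.1 q.2 = Φ q.1 q.2) :
    RatioAt π Φ' e' e p x r := by
  obtain ⟨c, hc, hr, hev⟩ := h
  refine ⟨c, hc, hr, ?_⟩
  filter_upwards [hev, (tendsto_prod_symm p hx).eventually hΦ] with q h1 h2
  rw [← h1, h2]

theorem RatioAt.eventually {e e' : OpenPartialHomeomorph M (Model n)}
    (h : RatioAt π Φ e' e p x r) (hr : r ≠ 0) (hx : x ∈ e'.source) :
    ∀ᶠ q : Poiss n M × M in 𝓝 (p, x), ∃ r ≠ 0, RatioAt π Φ e' e q.1 q.2 r := by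
  obtain ⟨c, hc, rfl, hev⟩ := h
  have h0 : ∀ᶠ q : Poiss n M × Model n in 𝓝 (p, e' x), c q.1 q.2 ≠ 0 :=
    hc.continuousAt.eventually_ne hr
  filter_upwards [(tendsto_prod_chart p hx).eventually (h0.and
    (hc.eventually.and hev.eventually_nhds))] with q hq
  exact ⟨_, hq.1, c, hq.2.1, rfl, hq.2.2⟩

/-- Each side of the defining identity is multiplied by the Jacobian determinant of its chart
change, so the factor is multiplied by their quotient. -/
theorem RatioAt.change_charts {e e' e₂ e₂' : OpenPartialHomeomorph M (Model n)}
    (h : RatioAt π Φ e' e p x r) (hΦ : FamilyAt (n := n) Φ p x)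
    (he : e ∈ charts n M) (he' : e' ∈ charts n M) (he₂ : e₂ ∈ charts n M) (he₂' : e₂' ∈ charts n M)
    (hx : x ∈ e'.source) (hx₂ : x ∈ e₂'.source) (hΦx : Φ p x ∈ e.source)
    (hΦx₂ : Φ p x ∈ e₂.source) :
    RatioAt π Φ e₂' e₂ p x (r * (jacobian (fun y => e₂ (e.symm y)) (e (Φ p x))).det /
      (jacobian (fun y => e₂' (e'.symm y)) (e' x)).det) := by
  obtain ⟨c, hc, rfl, hev⟩ := h
  have hτ : ParamC1At (fun (_ : Poiss n M) y => e' (e₂'.symm y)) p (e₂' x) :=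
    paramC1At_transition he₂' he' p (e₂'.map_source hx₂) (by rwa [e₂'.left_inv hx₂])
  have h1 : ParamC1At (fun p y => c p (e' (e₂'.symm y))) p (e₂' x) :=
    ParamC1At.comp (f := fun _ y => e' (e₂'.symm y)) (by rwa [e₂'.left_inv hx₂]) hτ
  have h2 : ParamC1At (fun p y => (jacobian (fun y => e₂ (e.symm y))
      (e (Φ p (e₂'.symm y)))).det) p (e₂' x) := by
    refine ParamC1At.comp (g := fun _ y => (jacobian (fun y => e₂ (e.symm y)) y).det)
      (f := fun p y => e (Φ p (e₂'.symm y))) ?_ (hΦ.paramC1At he₂' he hx₂ hΦx)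
    rw [e₂'.left_inv hx₂]
    exact paramC1At_det_jacobian he he₂ p (e.map_source hΦx) (by rwa [e.left_inv hΦx])
  have h3 : ParamC1At (fun (_ : Poiss n M) y => (jacobian (fun y => e₂' (e'.symm y))
      (e' (e₂'.symm y))).det) p (e₂' x) := by
    refine ParamC1At.comp (g := fun _ y => (jacobian (fun y => e₂' (e'.symm y)) y).det)
      (f := fun _ y => e' (e₂'.symm y)) ?_ hτ
    rw [e₂'.left_inv hx₂]
    exact paramC1At_det_jacobian he' he₂' p (e'.map_source hx) (by rwa [e'.left_inv hx])
  refine ⟨_, (h1.mul h2).div h3 ?_, ?_, ?_⟩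
  · rw [e₂'.left_inv hx₂]
    exact det_jacobian_transition_ne_zero he' he₂' (e'.map_source hx) (by rwa [e'.left_inv hx])
  · simp only [e₂'.left_inv hx₂]
  · have hΦev : ∀ᶠ q : Poiss n M × M in 𝓝 (p, x), Φ q.1 q.2 ∈ e.source ∩ e₂.source :=
      hΦ.continuousAt.eventually ((e.open_source.inter e₂.open_source).mem_nhds ⟨hΦx, hΦx₂⟩)
    have hxev : ∀ᶠ q : Poiss n M × M in 𝓝 (p, x), q.2 ∈ e'.source ∩ e₂'.source :=
      continuousAt_snd.eventually ((e'.open_source.inter e₂'.open_source).mem_nhds ⟨hx, hx₂⟩)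
    filter_upwards [(tendsto_prod_symm p hx₂).eventually (hΦev.and (hxev.and
      ((tendsto_prod_chart p hx).eventually hev))),
      continuousAt_snd.eventually (e₂'.open_target.mem_nhds (e₂'.map_source hx₂))] with q hq hqt
    obtain ⟨⟨hq1, hq2⟩, ⟨hq3, hq4⟩, hq5⟩ := hq
    have hne := det_jacobian_transition_ne_zero he' he₂' (e'.map_source hq3)
      (by rwa [e'.left_inv hq3])
    have h6 := wedgePowComponent_change he' he₂' q.1.1 hq3 hq4
    rw [e₂'.right_inv hqt] at h6
    simp only [e'.left_inv hq3] at hq5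
    rw [wedgePowComponent_change he he₂ π.1 hq1 hq2, hq5, h6]
    field_simp

end Ratio

/-! ### The family of diffeomorphisms -/

section Step

variable {n : ℕ} {M : Type*} [TopologicalSpace M] [ChartedSpace (Model n) M]

/-- Near `π`, `Φ` is a smooth family of maps with `Φ π = id`. -/
def IsFamilyThroughId (π : Poiss n M) (Φ : Poiss n M → M → M) : Prop :=
  (∀ x, Φ π x = x) ∧ ∀ x, FamilyAt (n := n) Φ π x

/-- Near `(π, x)`, the function `⋀ⁿπ ∘ Φ p` is a positive multiple of `⋀ⁿp`. -/
def MatchesAt (π : Poiss n M) (Φ : Poiss n M → M → M) (x : M) : Prop :=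
  ∃ e ∈ charts n M, x ∈ e.source ∧ RatioAt π Φ e e π x 1

open Classical in
/-- Move `Φ p x` in the direction of the `i`-th coordinate of the chart `e` so that this coordinate
becomes `⋀ⁿp` in the chart `e₀`, as far as the cut-off function `b` permits. -/
def adjust (e₀ e : OpenPartialHomeomorph M (Model n)) (i : Fin (2 * n)) (b : M → ℝ)
    (Φ : Poiss n M → M → M) (p : Poiss n M) (x : M) : M :=
  if Φ p x ∈ e.source then
    e.symm (e (Φ p x) + (b (Φ p x) * (p.1.wedgePowComponent e₀ (e₀ x) - coordL i (e (Φ p x)))) •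
      EuclideanSpace.single i (1 : ℝ))
  else Φ p x

variable {π : Poiss n M} {Φ : Poiss n M → M → M}

theorem adjust_eq_self {e₀ e : OpenPartialHomeomorph M (Model n)} {i : Fin (2 * n)} {b : M → ℝ}
    {p : Poiss n M} {x : M} (h : b (Φ p x) = 0) : adjust e₀ e i b Φ p x = Φ p x := by
  unfold adjust
  split_ifs with hs
  · rw [h, zero_mul, zero_smul, add_zero, e.left_inv hs]
  · rfl

theorem paramC1At_comp_family {b : M → ℝ} (hb : ContMDiff (𝓡 (2 * n)) 𝓘(ℝ, ℝ) ∞ b)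
    {p : Poiss n M} {x : M} (hΦ : FamilyAt (n := n) Φ p x)
    {e e' : OpenPartialHomeomorph M (Model n)} (he : e ∈ charts n M) (he' : e' ∈ charts n M)
    (hx : x ∈ e.source) (hΦx : Φ p x ∈ e'.source) :
    ParamC1At (fun p y => b (Φ p (e.symm y))) p (e x) := by
  have h1 : ∀ᶠ y in 𝓝 (e' (Φ p x)), ContDiffAt ℝ ∞ (fun y => b (e'.symm y)) y := by
    filter_upwards [e'.open_target.mem_nhds (e'.map_source hΦx)] with y hy
    rw [← contMDiffAt_iff_contDiffAt]
    exact hb.contMDiffAt.comp y (contMDiffAt_symm_of_mem_maximalAtlas he' hy)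
  have h2 := ParamC1At.comp (g := fun _ y => b (e'.symm y)) (f := fun p y => e' (Φ p (e.symm y)))
    (p := p) (y := e x) (ParamC1At.of_contDiffAt (by simpa only [e.left_inv hx] using h1) p)
    (hΦ.paramC1At he he' hx hΦx)
  refine h2.congr ?_
  filter_upwards [(tendsto_prod_symm p hx).eventually
    (hΦ.continuousAt.eventually (e'.open_source.mem_nhds hΦx))] with q hq
  rw [e'.left_inv hq]

/-- `e` is a chart inside `e₀` whose `i`-th coordinate is `⋀ⁿπ` in the chart `e₀`, and `b` is a
cut-off function for `e`. -/
structure IsAdjustData (π : Poiss n M) (e₀ e : OpenPartialHomeomorph M (Model n))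
    (i : Fin (2 * n)) (b : M → ℝ) : Prop where
  he₀ : e₀ ∈ charts n M
  he : e ∈ charts n M
  source_subset : e.source ⊆ e₀.source
  coord_eq : ∀ x ∈ e.source, e x i = π.1.wedgePowComponent e₀ (e₀ x)
  contMDiff : ContMDiff (𝓡 (2 * n)) 𝓘(ℝ, ℝ) ∞ b
  tsupport_subset : tsupport b ⊆ e.source

section

variable {e₀ e : OpenPartialHomeomorph M (Model n)} {i : Fin (2 * n)} {b : M → ℝ}

/-- At `p = π` the displacement is zero, since `Φ π` is the identity and the `i`-th coordinate of
`e` is `⋀ⁿπ` itself. By continuity the displaced point stays in `e.target` nearby, where `e.symm`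
can be undone. -/
theorem adjust_local (h : IsAdjustData π e₀ e i b)
    (hΦ : IsFamilyThroughId π Φ) {x : M} (hx : x ∈ e.source) :
    ParamC1At (fun p y => e (Φ p (e.symm y)) + (b (Φ p (e.symm y)) *
      (p.1.wedgePowComponent e₀ (e₀ (e.symm y)) - coordL i (e (Φ p (e.symm y))))) •
        EuclideanSpace.single i (1 : ℝ)) π (e x) ∧
    ∀ᶠ q : Poiss n M × M in 𝓝 (π, x), q.2 ∈ e.source ∧ Φ q.1 q.2 ∈ e.source ∧
      adjust e₀ e i b Φ q.1 q.2 ∈ e.source ∧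
      e (adjust e₀ e i b Φ q.1 q.2) = e (Φ q.1 q.2) + (b (Φ q.1 q.2) *
        (q.1.1.wedgePowComponent e₀ (e₀ q.2) - coordL i (e (Φ q.1 q.2)))) •
          EuclideanSpace.single i (1 : ℝ) := by
  obtain ⟨he₀, he, hee₀, hi, hb, -⟩ := h
  have hΦx : Φ π x ∈ e.source := by rwa [hΦ.1]
  have hQ := (hΦ.2 x).paramC1At he he hx hΦx
  have hB := paramC1At_comp_family hb (hΦ.2 x) he he hx hΦx
  have hW : ParamC1At (fun (p : Poiss n M) y => p.1.wedgePowComponent e₀ (e₀ (e.symm y)))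
      π (e x) :=
    ParamC1At.comp (g := fun (p : Poiss n M) y => p.1.wedgePowComponent e₀ y)
      (f := fun _ y => e₀ (e.symm y))
      (paramC1At_wedgePowComponent he₀ π (by
        rw [e.left_inv hx]
        exact e₀.map_source (hee₀ hx)))
      (paramC1At_transition he he₀ π (e.map_source hx) (by rw [e.left_inv hx]; exact hee₀ hx))
  have hT := hB.mul (hW.sub (ParamC1At.contDiff_comp (coordL i).contDiff hQ))
  have hR := hQ.add (ParamC1At.contDiff_comp
    (g := fun t : ℝ => t • (EuclideanSpace.single i (1 : ℝ) : Model n))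
    (contDiff_id.smul contDiff_const) hT)
  refine ⟨hR, ?_⟩
  have hval : e (Φ π (e.symm (e x))) + (b (Φ π (e.symm (e x))) *
      (π.1.wedgePowComponent e₀ (e₀ (e.symm (e x))) - coordL i (e (Φ π (e.symm (e x)))))) •
        EuclideanSpace.single i (1 : ℝ) = e x := by
    rw [e.left_inv hx, hΦ.1, coordL_apply, hi x hx, sub_self, mul_zero, zero_smul, add_zero]
  have hmem : ∀ᶠ q : Poiss n M × Model n in 𝓝 (π, e x),
      e (Φ q.1 (e.symm q.2)) + (b (Φ q.1 (e.symm q.2)) *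
        (q.1.1.wedgePowComponent e₀ (e₀ (e.symm q.2)) - coordL i (e (Φ q.1 (e.symm q.2))))) •
          EuclideanSpace.single i (1 : ℝ) ∈ e.target :=
    hR.continuousAt.eventually (e.open_target.mem_nhds (by
      simp only [hval]
      exact e.map_source hx))
  filter_upwards [(tendsto_prod_chart π hx).eventually hmem,
    continuousAt_snd.eventually (e.open_source.mem_nhds hx),
    (hΦ.2 x).continuousAt.eventually (e.open_source.mem_nhds hΦx)] with q h1 h2 h3
  rw [e.left_inv h2] at h1
  have h4 : adjust e₀ e i b Φ q.1 q.2 = e.symm (e (Φ q.1 q.2) + (b (Φ q.1 q.2) *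
      (q.1.1.wedgePowComponent e₀ (e₀ q.2) - coordL i (e (Φ q.1 q.2)))) •
        EuclideanSpace.single i (1 : ℝ)) := by
    unfold adjust
    exact if_pos h3
  refine ⟨h2, h3, ?_, ?_⟩
  · rw [h4]
    exact e.map_target h1
  · rw [h4, e.right_inv h1]

/-- In the chart `e`, `⋀ⁿπ` is a linear coordinate, so the move interpolates affinely between its
old value and `⋀ⁿp`. This form of the result makes successive adjustments compatible. -/
theorem wedgePowComponent_adjust (h : IsAdjustData π e₀ e i b)
    (hΦ : IsFamilyThroughId π Φ) {x : M} (hx : x ∈ e.source) :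
    ∀ᶠ q : Poiss n M × M in 𝓝 (π, x),
      π.1.wedgePowComponent e₀ (e₀ (adjust e₀ e i b Φ q.1 q.2)) =
        (1 - b (Φ q.1 q.2)) * π.1.wedgePowComponent e₀ (e₀ (Φ q.1 q.2)) +
          b (Φ q.1 q.2) * q.1.1.wedgePowComponent e₀ (e₀ q.2) := by
  filter_upwards [(adjust_local h hΦ hx).2] with q hq
  obtain ⟨-, h2, h3, h4⟩ := hq
  have h5 := congrArg (coordL i) h4
  rw [map_add, map_smul, coordL_apply, coordL_apply, coordL_apply, h.coord_eq _ h3,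
    h.coord_eq _ h2] at h5
  rw [h5]
  simp only [PiLp.single_apply, if_true, smul_eq_mul, mul_one]
  ring

/-- Outside `tsupport b` nothing moves, so the two cases in `adjust` fit together smoothly. -/
theorem adjust_eventually_eq (h : IsAdjustData π e₀ e i b)
    (hΦ : IsFamilyThroughId π Φ) {x : M} (hx : x ∉ e.source) :
    ∀ᶠ q : Poiss n M × M in 𝓝 (π, x), adjust e₀ e i b Φ q.1 q.2 = Φ q.1 q.2 := by
  have hx' : Φ π x ∉ tsupport b := by
    rw [hΦ.1]
    exact fun hb => hx (h.tsupport_subset hb)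
  filter_upwards [(hΦ.2 x).continuousAt.eventually
    ((isClosed_tsupport b).isOpen_compl.mem_nhds hx')] with q hq
  exact adjust_eq_self (image_eq_zero_of_notMem_tsupport hq)

theorem isFamilyThroughId_adjust (h : IsAdjustData π e₀ e i b)
    (hΦ : IsFamilyThroughId π Φ) :
    IsFamilyThroughId π (adjust e₀ e i b Φ) := by
  refine ⟨fun x => ?_, fun x => ?_⟩
  · by_cases hx : x ∈ e.source
    · unfold adjust
      rw [hΦ.1, if_pos hx, coordL_apply, h.coord_eq x hx, sub_self, mul_zero, zero_smul,
        add_zero, e.left_inv hx]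
    · unfold adjust
      rw [hΦ.1, if_neg hx]
  · by_cases hx : x ∈ e.source
    · obtain ⟨h1, h2⟩ := adjust_local h hΦ hx
      refine ⟨e, h.he, e, h.he, hx, h2.mono fun q hq => hq.2.2.1, h1.congr ?_⟩
      filter_upwards [(tendsto_prod_symm π hx).eventually h2] with q hq
      exact hq.2.2.2
    · exact (hΦ.2 x).congr (adjust_eventually_eq h hΦ hx)

/-- A factor `c` becomes `(1 - b ∘ Φ p) c + b ∘ Φ p`, which is `1` at `(π, x)` whatever the value of
`b`. -/
theorem matchesAt_adjust_of_matchesAt (h : IsAdjustData π e₀ e i b)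
    (hΦ : IsFamilyThroughId π Φ) {x : M}
    (hm : MatchesAt π Φ x) : MatchesAt π (adjust e₀ e i b Φ) x := by
  obtain ⟨e₁, he₁, hx₁, hr⟩ := hm
  have he₀ := h.he₀
  by_cases hx : x ∈ e.source
  · have hx₀ := h.source_subset hx
    have hr₀ := hr.change_charts (hΦ.2 x) he₁ he₁ he₀ he₀ hx₁ hx₀ (by rwa [hΦ.1])
      (by rwa [hΦ.1])
    -- The same chart change is made at source and target and `Φ π x = x`, so the two determinants
    -- cancel.
    rw [hΦ.1, one_mul, div_self (det_jacobian_transition_ne_zero he₁ he₀ (e₁.map_source hx₁)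
      (by rwa [e₁.left_inv hx₁]))] at hr₀
    obtain ⟨c, hc, hc1, hev⟩ := hr₀
    have hB := paramC1At_comp_family h.contMDiff (hΦ.2 x) he₀ he₀ hx₀ (by rwa [hΦ.1])
    refine ⟨e₀, he₀, hx₀, _, (((ParamC1At.const (1 : ℝ) π (e₀ x)).sub hB).mul hc).add hB, ?_, ?_⟩
    · rw [hc1]
      ring
    · filter_upwards [hev, (tendsto_prod_symm π hx₀).eventually
        (wedgePowComponent_adjust h hΦ hx),
        continuousAt_snd.eventually (e₀.open_target.mem_nhds (e₀.map_source hx₀))] with q h1 h2 h3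
      rw [h2, h1, e₀.right_inv h3]
      ring
  · exact ⟨e₁, he₁, hx₁, hr.congr hx₁ (adjust_eventually_eq h hΦ hx)⟩

theorem matchesAt_adjust_of_eq_one (h : IsAdjustData π e₀ e i b)
    (hΦ : IsFamilyThroughId π Φ) {x : M} (hx : x ∈ e.source) (hbx : b =ᶠ[𝓝 x] 1) :
    MatchesAt π (adjust e₀ e i b Φ) x := by
  have hx₀ := h.source_subset hx
  refine ⟨e₀, h.he₀, hx₀, fun _ _ => 1, ParamC1At.const 1 π _, rfl, ?_⟩
  have hb1 : ∀ᶠ q : Poiss n M × M in 𝓝 (π, x), b (Φ q.1 q.2) = 1 :=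
    (hΦ.2 x).continuousAt.eventually (p := fun z => b z = 1) (by
      simp only [hΦ.1]
      exact hbx)
  filter_upwards [(tendsto_prod_symm π hx₀).eventually
    ((wedgePowComponent_adjust h hΦ hx).and hb1),
    continuousAt_snd.eventually (e₀.open_target.mem_nhds (e₀.map_source hx₀))] with q h2 h3
  rw [h2.1, h2.2, e₀.right_inv h3]
  ring

end

variable [IsManifold (𝓡 (2 * n)) ∞ M]

theorem isClosed_singularLocus (w : BivectorField n M) : IsClosed w.singularLocus := by
  rw [← isOpen_compl_iff, isOpen_iff_mem_nhds]
  intro x hx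
  have he : chartAt (Model n) x ∈ charts n M := IsManifold.chart_mem_maximalAtlas _
  set e := chartAt (Model n) x
  have hxe : x ∈ e.source := mem_chart_source _ x
  have hx' : w.wedgePowComponent e (e x) ≠ 0 := fun h => hx ((wedgePow_eq_zero_iff he w hxe).2 h)
  have hc : ContinuousAt (fun x' => w.wedgePowComponent e (e x')) x :=
    ContinuousAt.comp (g := w.wedgePowComponent e) (contDiffAt_wedgePowComponent w he (e.map_source hxe)).continuousAt
      (e.continuousAt hxe)
  filter_upwards [hc.eventually_ne hx', e.open_source.mem_nhds hxe] with x' h1 h2 h3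
  exact h1 ((wedgePow_eq_zero_iff he w h2).1 h3)

variable [T2Space M]

/-- The neighbourhood `U` is chosen before `Φ`. Therefore a finite cover of the singular locus can
be fixed first and the adjustments made one after another. -/
theorem exists_nhds_forall_adjust (hπ : π.1.IsLogSymplectic) {z : M}
    (hz : z ∈ π.1.singularLocus) :
    ∃ U ∈ 𝓝 z, ∀ Φ, IsFamilyThroughId π Φ → ∃ Φ', IsFamilyThroughId π Φ' ∧
      (∀ x ∈ U, MatchesAt π Φ' x) ∧ ∀ x, MatchesAt π Φ x → MatchesAt π Φ' x := by
  have he₀ : chartAt (Model n) z ∈ charts n M := IsManifold.chart_mem_maximalAtlas _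
  set e₀ := chartAt (Model n) z
  have hz₀ : z ∈ e₀.source := mem_chart_source _ z
  have hd := (wedgePowTransverse_iff π.1).1 hπ.2 e₀ he₀ (e₀ z) (e₀.map_source hz₀)
    ((wedgePow_eq_zero_iff he₀ π.1 hz₀).1 hz)
  obtain ⟨i, e, he, hze, hee₀, hi⟩ := exists_chart_coord_eq he₀
    (fun y hy => contDiffAt_wedgePowComponent π.1 he₀ hy) hz₀ hd
  obtain ⟨b, hb, hb1, hbs⟩ := exists_bump (n := n) e.open_source hze
  have h : IsAdjustData π e₀ e i b := ⟨he₀, he, hee₀, hi, hb, hbs⟩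
  refine ⟨{x | x ∈ e.source ∧ b =ᶠ[𝓝 x] 1},
    Filter.inter_mem (e.open_source.mem_nhds hze) hb1.eventually_nhds, fun Φ hΦ =>
    ⟨adjust e₀ e i b Φ, isFamilyThroughId_adjust h hΦ, fun x hx => ?_,
      fun x hx => matchesAt_adjust_of_matchesAt h hΦ hx⟩⟩
  exact matchesAt_adjust_of_eq_one h hΦ hx.1 hx.2

/-- Induction over a finite cover, from the identity: each adjustment gains one neighbourhood and
loses no earlier match. -/
theorem exists_family_matchesAt [CompactSpace M] (hπ : π.1.IsLogSymplectic) :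
    ∃ Φ, IsFamilyThroughId π Φ ∧ ∀ x ∈ π.1.singularLocus, MatchesAt π Φ x := by
  have hZ : IsCompact π.1.singularLocus := (isClosed_singularLocus π.1).isCompact
  choose! U hU hstep using fun z (hz : z ∈ π.1.singularLocus) => exists_nhds_forall_adjust hπ hz
  obtain ⟨t, ht, hcov⟩ := hZ.elim_nhds_subcover U hU
  have key : ∀ s : Finset M, (∀ z ∈ s, z ∈ π.1.singularLocus) →
      ∃ Φ, IsFamilyThroughId π Φ ∧ ∀ z ∈ s, ∀ x ∈ U z, MatchesAt π Φ x := by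
    classical
    intro s
    induction s using Finset.induction_on with
    | empty =>
      exact fun _ => ⟨fun _ x => x, ⟨fun _ => rfl, fun x => FamilyAt.of_id π x⟩, by simp⟩
    | insert z s _ ih =>
      intro hs
      obtain ⟨Φ, hΦ, hm⟩ := ih fun z' hz' => hs z' (Finset.mem_insert_of_mem hz')
      obtain ⟨Φ', hΦ', hm', hmm⟩ := hstep z (hs z (Finset.mem_insert_self _ _)) Φ hΦ
      refine ⟨Φ', hΦ', fun z' hz' x hx => ?_⟩
      rcases Finset.mem_insert.1 hz' with rfl | hz'
      · exact hm' x hx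
      · exact hmm x (hm z' hz' x hx)
  obtain ⟨Φ, hΦ, hm⟩ := key t ht
  refine ⟨Φ, hΦ, fun x hx => ?_⟩
  obtain ⟨z, hz, hxz⟩ := Set.mem_iUnion₂.1 (hcov hx)
  exact hm z hz x hxz

end Step

/-! ### Families of maps near the identity consist of diffeomorphisms -/

section Diffeo

theorem exists_diffeomorph_of_bijective {n : ℕ} {M : Type*} [TopologicalSpace M]
    [ChartedSpace (Model n) M] {f : M → M}
    (hf : IsLocalDiffeomorph (𝓡 (2 * n)) (𝓡 (2 * n)) ∞ f) (hb : Function.Bijective f) :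
    ∃ φ : Diff n M, ⇑φ = f :=
  ⟨hf.diffeomorphOfBijective hb, rfl⟩

variable {n : ℕ} {M : Type*} [TopologicalSpace M] [ChartedSpace (Model n) M]

/-- A map is a local diffeomorphism where its coordinate expression has an invertible
derivative. -/
theorem isLocalDiffeomorphAt_of_fderiv {f : M → M} {x : M} (hf : ContinuousAt f x)
    {e e' : OpenPartialHomeomorph M (Model n)} (he : e ∈ charts n M) (he' : e' ∈ charts n M)
    (hx : x ∈ e.source) (hfx : f x ∈ e'.source)
    (hd : ∀ᶠ y in 𝓝 (e x), ContDiffAt ℝ ∞ (fun y => e' (f (e.symm y))) y)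
    {A : Model n ≃L[ℝ] Model n}
    (hA : fderiv ℝ (fun y => e' (f (e.symm y))) (e x) = (A : Model n →L[ℝ] Model n)) :
    IsLocalDiffeomorphAt (𝓡 (2 * n)) (𝓡 (2 * n)) ∞ f x := by
  set F := fun y => e' (f (e.symm y)) with hF
  have hs : ∀ᶠ y in 𝓝 (e x), ContDiffAt ℝ ∞ F y ∧ y ∈ e.target ∧ f (e.symm y) ∈ e'.source := by
    have hc : ContinuousAt (fun y => f (e.symm y)) (e x) := by
      refine ContinuousAt.comp (g := f) ?_ (e.continuousAt_symm (e.map_source hx))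
      rwa [e.left_inv hx]
    filter_upwards [hd, e.open_target.mem_nhds (e.map_source hx),
      hc.preimage_mem_nhds (e'.open_source.mem_nhds (by rwa [e.left_inv hx]))] with y h1 h2 h3
    exact ⟨h1, h2, h3⟩
  obtain ⟨U, hU, hUo, hxU⟩ := eventually_nhds_iff.1 hs
  have hA' : HasFDerivAt F (A : Model n →L[ℝ] Model n) (e x) := by
    rw [← hA]
    exact (hd.self_of_nhds.differentiableAt (by simp)).hasFDerivAt
  obtain ⟨g, hg, hgU, hgF, hgs, hgt⟩ := exists_openPartialHomeomorph_of_contDiffAt hUo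
    (fun y hy => (hU y hy).1) hxU hA'
  let k := (e.trans g).trans e'.symm
  have hk : ∀ z ∈ k.source, z ∈ e.source ∧ e z ∈ g.source ∧ g (e z) ∈ e'.target := by
    intro z hz
    simp only [k, OpenPartialHomeomorph.trans_source, Set.mem_inter_iff, Set.mem_preimage,
      OpenPartialHomeomorph.symm_source, OpenPartialHomeomorph.coe_trans,
      Function.comp_apply] at hz
    exact ⟨hz.1.1, hz.1.2, hz.2⟩
  have hk' : ∀ z ∈ k.target, z ∈ e'.source ∧ e' z ∈ g.target ∧ g.symm (e' z) ∈ e.target := by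
    intro z hz
    simp only [k, OpenPartialHomeomorph.trans_target, Set.mem_inter_iff, Set.mem_preimage,
      OpenPartialHomeomorph.symm_target, OpenPartialHomeomorph.symm_symm] at hz
    exact ⟨hz.1, hz.2.1, hz.2.2⟩
  let K : PartialDiffeomorph (𝓡 (2 * n)) (𝓡 (2 * n)) M M ∞ :=
    { toPartialEquiv := k.toPartialEquiv
      open_source := k.open_source
      open_target := k.open_target
      contMDiffOn_toFun := by
        refine (contMDiffOn_symm_of_mem_maximalAtlas he').comp
          ((contMDiffOn_iff_contDiffOn.2 hgs).comp ((contMDiffOn_of_mem_maximalAtlas he).mono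
            fun z hz => (hk z hz).1) fun z hz => (hk z hz).2.1) fun z hz => (hk z hz).2.2
      contMDiffOn_invFun := by
        refine (contMDiffOn_symm_of_mem_maximalAtlas he).comp
          ((contMDiffOn_iff_contDiffOn.2 hgt).comp ((contMDiffOn_of_mem_maximalAtlas he').mono
            fun z hz => (hk' z hz).1) fun z hz => (hk' z hz).2.1) fun z hz => (hk' z hz).2.2 }
  refine ⟨K, ?_, ?_⟩
  · change x ∈ k.source
    simp only [k, OpenPartialHomeomorph.trans_source, Set.mem_inter_iff, Set.mem_preimage,
      OpenPartialHomeomorph.symm_source, OpenPartialHomeomorph.coe_trans, Function.comp_apply]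
    refine ⟨⟨hx, hg⟩, ?_⟩
    rw [hgF, hF]
    simp only [e.left_inv hx]
    exact e'.map_source hfx
  · intro z hz
    obtain ⟨h1, h2, -⟩ := hk z hz
    change f z = e'.symm (g (e z))
    have h4 := (hU _ (hgU h2)).2.2
    rw [e.left_inv h1] at h4
    rw [hgF, hF]
    simp only [e.left_inv h1, e'.left_inv h4]

/-- The image of a component is open and compact, and meets that component because points do not
leave theirs; so it contains it. Connectedness of `M` is not needed. -/
theorem surjective_of_isLocalDiffeomorph [T2Space M] [CompactSpace M] {f : M → M}
    (hf : IsLocalDiffeomorph (𝓡 (2 * n)) (𝓡 (2 * n)) ∞ f)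
    (hc : ∀ x, f x ∈ connectedComponent x) : Function.Surjective f := by
  have : LocallyConnectedSpace M := ChartedSpace.locallyConnectedSpace (Model n) M
  intro y
  have hcl : IsClosed (f '' connectedComponent y) :=
    (isClosed_connectedComponent.isCompact.image hf.contMDiff.continuous).isClosed
  have hop : IsOpen (f '' connectedComponent y) :=
    hf.isOpenMap _ isOpen_connectedComponent
  have hfy : f y ∈ connectedComponent y := hc y
  have hsub : connectedComponent y ⊆ f '' connectedComponent y :=
    isPreconnected_connectedComponent.subset_isClopen ⟨hcl, hop⟩
      ⟨f y, hfy, Set.mem_image_of_mem f mem_connectedComponent⟩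
  obtain ⟨x, -, hx⟩ := hsub mem_connectedComponent
  exact ⟨x, hx⟩

variable {P : Type*} [TopologicalSpace P] {Φ : P → M → M} {π : P}

theorem fderiv_family_id {M P : Type*} [TopologicalSpace M] {Φ : P → M → M} {π : P} {x : M}
    (hid : ∀ x, Φ π x = x)
    {e : OpenPartialHomeomorph M (Model n)} (hx : x ∈ e.source) :
    fderiv ℝ (fun y => e (Φ π (e.symm y))) (e x) = ContinuousLinearMap.id ℝ (Model n) := by
  have h : (fun y => e (Φ π (e.symm y))) =ᶠ[𝓝 (e x)] fun y => y := by
    filter_upwards [e.open_target.mem_nhds (e.map_source hx)] with y hy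
    rw [hid, e.right_inv hy]
  rw [h.fderiv_eq]
  exact fderiv_id

variable [IsManifold (𝓡 (2 * n)) ∞ M]

theorem eventually_isLocalDiffeomorphAt (hid : ∀ x, Φ π x = x)
    (hΦ : ∀ x, FamilyAt (n := n) Φ π x) (x : M) :
    ∀ᶠ q : P × M in 𝓝 (π, x),
      IsLocalDiffeomorphAt (𝓡 (2 * n)) (𝓡 (2 * n)) ∞ (Φ q.1) q.2 := by
  have he : chartAt (Model n) x ∈ charts n M := IsManifold.chart_mem_maximalAtlas _
  set e := chartAt (Model n) x
  have hx : x ∈ e.source := mem_chart_source _ x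
  have hF := (hΦ x).paramC1At he he hx (by rwa [hid])
  have h1 : ∀ᶠ q : P × Model n in 𝓝 (π, e x),
      fderiv ℝ (fun y => e (Φ q.1 (e.symm y))) q.2 ∈
        Set.range ((↑) : (Model n ≃L[ℝ] Model n) → Model n →L[ℝ] Model n) := by
    refine hF.continuousAt_fderiv.eventually (ContinuousLinearEquiv.isOpen.mem_nhds ?_)
    simp only [fderiv_family_id hid hx]
    exact ⟨ContinuousLinearEquiv.refl ℝ _, rfl⟩
  filter_upwards [(tendsto_prod_chart π hx).eventually (h1.and hF.eventually_nhds),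
    continuousAt_snd.eventually (e.open_source.mem_nhds hx), (hΦ x).eventually,
    (hΦ x).continuousAt.eventually (e.open_source.mem_nhds
      (by simpa only [hid] using hx))] with q h2 h3 h4 h5
  obtain ⟨⟨A, hA⟩, h6⟩ := h2
  have hc : ContinuousAt (Φ q.1) q.2 :=
    ContinuousAt.comp (f := fun z => (q.1, z)) h4.continuousAt
      (continuousAt_const.prodMk continuousAt_id)
  refine isLocalDiffeomorphAt_of_fderiv hc he he h3 h5 ?_ hA.symm
  have h7 : Filter.Tendsto (fun y : Model n => (q.1, y)) (𝓝 (e q.2)) (𝓝 (q.1, e q.2)) :=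
    (continuousAt_const.prodMk continuousAt_id).tendsto
  exact (h7.eventually h6).mono fun y hy => hy.1

/-- On a ball in the chart, the derivative stays within `1/2` of the identity. By the mean value
inequality, a difference of values is within `‖u - v‖ / 2` of `u - v`, so equal values force `u =
v`. -/
theorem eventually_injective_local (hid : ∀ x, Φ π x = x)
    (hΦ : ∀ x, FamilyAt (n := n) Φ π x) (x : M) :
    ∀ᶠ q : P × (M × M) in 𝓝 (π, (x, x)), Φ q.1 q.2.1 = Φ q.1 q.2.2 → q.2.1 = q.2.2 := by
  have he : chartAt (Model n) x ∈ charts n M := IsManifold.chart_mem_maximalAtlas _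
  set e := chartAt (Model n) x
  have hx : x ∈ e.source := mem_chart_source _ x
  have hF := (hΦ x).paramC1At he he hx (by rwa [hid])
  have h1 : ∀ᶠ q : P × Model n in 𝓝 (π, e x),
      fderiv ℝ (fun y => e (Φ q.1 (e.symm y))) q.2 ∈
        Metric.closedBall (ContinuousLinearMap.id ℝ (Model n)) (1 / 2) := by
    refine hF.continuousAt_fderiv.eventually (Metric.closedBall_mem_nhds_of_mem ?_)
    simp only [fderiv_family_id hid hx]
    exact Metric.mem_ball_self (by norm_num)
  have h2 := h1.and hF.eventually
  rw [nhds_prod_eq, Filter.eventually_prod_iff] at h2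
  obtain ⟨p₁, hp₁, p₂, hp₂, h12⟩ := h2
  obtain ⟨ε, hε, hball⟩ := Metric.eventually_nhds_iff_ball.1 hp₂
  have hV : ∀ᶠ z in 𝓝 x, z ∈ e.source ∧ e z ∈ Metric.ball (e x) ε :=
    (e.open_source.eventually_mem hx).and
      ((e.continuousAt hx).eventually (Metric.ball_mem_nhds _ hε))
  have hq1 : ∀ᶠ q : P × (M × M) in 𝓝 (π, (x, x)), p₁ q.1 := continuousAt_fst.eventually hp₁
  have hq2 : ∀ᶠ q : P × (M × M) in 𝓝 (π, (x, x)), q.2.1 ∈ e.source ∧ e q.2.1 ∈ Metric.ball (e x) ε :=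
    ((continuous_fst.comp continuous_snd).continuousAt (x := (π, (x, x)))).eventually hV
  have hq3 : ∀ᶠ q : P × (M × M) in 𝓝 (π, (x, x)), q.2.2 ∈ e.source ∧ e q.2.2 ∈ Metric.ball (e x) ε :=
    ((continuous_snd.comp continuous_snd).continuousAt (x := (π, (x, x)))).eventually hV
  filter_upwards [hq1, hq2, hq3] with q k1 k2 k3 heq
  have hmv := (convex_ball (e x) ε).norm_image_sub_le_of_norm_fderiv_le' (𝕜 := ℝ)
    (f := fun y => e (Φ q.1 (e.symm y))) (φ := ContinuousLinearMap.id ℝ (Model n)) (C := 1 / 2)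
    (fun y hy => (h12 k1 (hball y hy)).2.differentiableAt)
    (fun y hy => by
      have := (h12 k1 (hball y hy)).1
      rwa [mem_closedBall_iff_norm] at this) k2.2 k3.2
  simp only [e.left_inv k2.1, e.left_inv k3.1, heq, sub_self, zero_sub, norm_neg,
    ContinuousLinearMap.id_apply] at hmv
  have h0 : ‖e q.2.2 - e q.2.1‖ = 0 := by
    have := norm_nonneg (e q.2.2 - e q.2.1)
    linarith
  exact e.injOn k2.1 k3.1 (sub_eq_zero.1 (norm_eq_zero.1 h0)).symm

variable [T2Space M] [CompactSpace M]

/-- Compactness of `M × M`: near the diagonal by the local estimate, elsewhere by separating the two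
points. -/
theorem eventually_injective (hid : ∀ x, Φ π x = x) (hΦ : ∀ x, FamilyAt (n := n) Φ π x) :
    ∀ᶠ p in 𝓝 π, Function.Injective (Φ p) := by
  have h : ∀ᶠ p in 𝓝 π, ∀ a ∈ (Set.univ : Set (M × M)), Φ p a.1 = Φ p a.2 → a.1 = a.2 := by
    refine isCompact_univ.eventually_forall_of_forall_eventually ?_
    rintro ⟨x, x'⟩ -
    by_cases hxx : x = x'
    · subst hxx
      exact eventually_injective_local hid hΦ x
    · obtain ⟨U, V, hU, hV, hxU, hxV, hUV⟩ := t2_separation hxx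
      have h1 : ∀ᶠ q : P × (M × M) in 𝓝 (π, (x, x')), Φ q.1 q.2.1 ∈ U :=
        (ContinuousAt.comp (x := (π, (x, x'))) (f := fun q : P × (M × M) => (q.1, q.2.1))
          (hΦ x).continuousAt (by fun_prop)).eventually
          (hU.mem_nhds (by simpa [hid] using hxU))
      have h2 : ∀ᶠ q : P × (M × M) in 𝓝 (π, (x, x')), Φ q.1 q.2.2 ∈ V :=
        (ContinuousAt.comp (x := (π, (x, x'))) (f := fun q : P × (M × M) => (q.1, q.2.2))
          (hΦ x').continuousAt (by fun_prop)).eventually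
          (hV.mem_nhds (by simpa [hid] using hxV))
      filter_upwards [h1, h2] with q k1 k2 heq
      exact absurd heq (hUV.ne_of_mem k1 k2)
  filter_upwards [h] with p hp x x' hxx
  exact hp (x, x') (Set.mem_univ _) hxx

theorem eventually_diffeomorph (hid : ∀ x, Φ π x = x) (hΦ : ∀ x, FamilyAt (n := n) Φ π x) :
    ∀ᶠ p in 𝓝 π, ∃ φ : Diff n M, ⇑φ = Φ p := by
  have : LocallyConnectedSpace M := ChartedSpace.locallyConnectedSpace (Model n) M
  have h : ∀ᶠ p in 𝓝 π, ∀ x ∈ (Set.univ : Set M),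
      IsLocalDiffeomorphAt (𝓡 (2 * n)) (𝓡 (2 * n)) ∞ (Φ p) x ∧ Φ p x ∈ connectedComponent x := by
    refine isCompact_univ.eventually_forall_of_forall_eventually fun x _ => ?_
    filter_upwards [eventually_isLocalDiffeomorphAt hid hΦ x,
      (hΦ x).continuousAt.eventually (isOpen_connectedComponent.mem_nhds
        (by simpa only [hid] using mem_connectedComponent (x := x))),
      continuousAt_snd.eventually (isOpen_connectedComponent.mem_nhds
        (mem_connectedComponent (x := x)))] with q h1 h2 h3
    exact ⟨h1, connectedComponent_eq h3 ▸ h2⟩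
  filter_upwards [h, eventually_injective hid hΦ] with p h1 h2
  have hl : IsLocalDiffeomorph (𝓡 (2 * n)) (𝓡 (2 * n)) ∞ (Φ p) :=
    fun x => (h1 x (Set.mem_univ x)).1
  exact exists_diffeomorph_of_bijective hl
    ⟨h2, surjective_of_isLocalDiffeomorph hl fun x => (h1 x (Set.mem_univ x)).2⟩

end Diffeo

/-! ### Division by a coordinate -/

section DivCoord

variable {n : ℕ}

theorem mul_divCoord {i : Fin (2 * n)} {f : Model n → ℝ} {y : Model n} (h : y i = 0 → f y = 0) :
    y i * divCoord i f y = f y := by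
  unfold divCoord
  split_ifs with h0
  · rw [h0, zero_mul, h h0]
  · field_simp

theorem continuousAt_divCoord_of_ne {X : Type*} [TopologicalSpace X] {i : Fin (2 * n)}
    {f : X → Model n → ℝ} {x : X} {y : Model n} (hy : y i ≠ 0)
    (hf : ContinuousAt (fun q : X × Model n => f q.1 q.2) (x, y)) :
    ContinuousAt (fun q : X × Model n => divCoord i (f q.1) q.2) (x, y) := by
  have hc : ContinuousAt (fun q : X × Model n => coordL i q.2) (x, y) :=
    ((coordL i).continuous.comp continuous_snd).continuousAt
  have h1 : ContinuousAt (fun q : X × Model n => f q.1 q.2 / coordL i q.2) (x, y) :=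
    hf.div hc hy
  refine h1.congr ?_
  filter_upwards [hc.eventually_ne hy] with q hq
  exact (if_neg hq).symm

/-- Hadamard's lemma: the quotient of a smooth function by a coordinate on whose zero set it
vanishes is continuous. -/
theorem continuousAt_divCoord {i : Fin (2 * n)} {f : Model n → ℝ} {U : Set (Model n)}
    (hU : IsOpen U) (hf : ∀ y ∈ U, ContDiffAt ℝ 1 f y) (h0 : ∀ y ∈ U, y i = 0 → f y = 0)
    {y : Model n} (hy : y ∈ U) : ContinuousAt (divCoord i f) y := by
  by_cases hyi : y i = 0
  swap
  · have h1 : ContinuousAt (fun q : Unit × Model n => f q.2) ((), y) :=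
      ContinuousAt.comp (f := Prod.snd) (hf y hy).continuousAt continuousAt_snd
    have h2 := continuousAt_divCoord_of_ne (X := Unit) (f := fun _ => f) (x := ()) hyi h1
    exact ContinuousAt.comp (f := fun y' : Model n => ((), y')) h2
      (continuousAt_const.prodMk continuousAt_id)
  have hval : divCoord i f y = fderiv ℝ f y (EuclideanSpace.single i 1) := if_pos hyi
  rw [ContinuousAt, hval, Metric.tendsto_nhds]
  intro ε hε
  have hcoord : Continuous fun y' : Model n => y' i := (coordL i).continuous
  have hproj : ContinuousAt (fun y' : Model n =>
      (y', y' - y' i • EuclideanSpace.single i (1 : ℝ))) y := by fun_prop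
  -- Strict differentiability is applied to `y'` and its projection to `{y_i = 0}`, where `f`
  -- vanishes: `f(y') - y'_i ∂_i f(y)` is small relative to `y'_i`. The constant `ε / 2` yields a
  -- strict inequality at the end.
  have hstrict := ((hf y hy).hasStrictFDerivAt one_ne_zero).isLittleO.def
    (half_pos hε)
  have h1 : ∀ᶠ y' in 𝓝 y, ‖f y' - f (y' - y' i • EuclideanSpace.single i (1 : ℝ)) -
      fderiv ℝ f y (y' - (y' - y' i • EuclideanSpace.single i (1 : ℝ)))‖ ≤
        ε / 2 * ‖y' - (y' - y' i • EuclideanSpace.single i (1 : ℝ))‖ := by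
    refine hproj.eventually (p := fun q : Model n × Model n =>
      ‖f q.1 - f q.2 - fderiv ℝ f y (q.1 - q.2)‖ ≤ ε / 2 * ‖q.1 - q.2‖) ?_
    simp only [hyi, zero_smul, sub_zero]
    exact hstrict
  have h2 : ∀ᶠ y' in 𝓝 y, y' - y' i • EuclideanSpace.single i (1 : ℝ) ∈ U := by
    have : ContinuousAt (fun y' : Model n => y' - y' i • EuclideanSpace.single i (1 : ℝ)) y := by
      fun_prop
    refine this.eventually (hU.mem_nhds ?_)
    simpa only [hyi, zero_smul, sub_zero] using hy
  have h3 : ∀ᶠ y' in 𝓝 y, dist (fderiv ℝ f y' (EuclideanSpace.single i 1))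
      (fderiv ℝ f y (EuclideanSpace.single i 1)) < ε := by
    have : ContinuousAt (fun y' => fderiv ℝ f y' (EuclideanSpace.single i 1)) y :=
      ((hf y hy).continuousAt_fderiv one_ne_zero).clm_apply continuousAt_const
    exact Metric.tendsto_nhds.1 this ε hε
  filter_upwards [h1, h2, h3] with y' k1 k2 k3
  unfold divCoord
  split_ifs with hi
  · exact k3
  · have hz : f (y' - y' i • EuclideanSpace.single i (1 : ℝ)) = 0 :=
      h0 _ k2 (by simp)
    rw [hz, sub_sub_cancel, sub_zero, map_smul, norm_smul, PiLp.norm_single, norm_one,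
      mul_one, smul_eq_mul] at k1
    have hpos : 0 < ‖y' i‖ := norm_pos_iff.2 hi
    have heq : f y' / y' i - fderiv ℝ f y (EuclideanSpace.single i 1) =
        (f y' - y' i * fderiv ℝ f y (EuclideanSpace.single i 1)) / y' i := by
      field_simp
    rw [dist_eq_norm, heq, norm_div, div_lt_iff₀ hpos]
    nlinarith

/-- The derivative of `y_i β` at a point of `{y_i = 0}`, for a continuous function `β`. -/
theorem fderiv_coord_mul {i : Fin (2 * n)} {g β : Model n → ℝ} {y : Model n} (hy : y i = 0)
    (hβ : ContinuousAt β y) (hg : ∀ᶠ y' in 𝓝 y, g y' = y' i * β y') :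
    fderiv ℝ g y (EuclideanSpace.single i 1) = β y := by
  have h : HasFDerivAt g (β y • coordL i) y := by
    rw [hasFDerivAt_iff_isLittleO]
    -- This is the Taylor remainder of `y_i β`. Since one factor tends to zero and the other is
    -- linear, continuity of `β` suffices.
    have h1 : (fun y' : Model n => (β y' - β y) * coordL i (y' - y)) =o[𝓝 y]
        fun y' : Model n => (1 : ℝ) * ‖y' - y‖ := by
      refine Asymptotics.IsLittleO.mul_isBigO ?_ ?_
      · rw [Asymptotics.isLittleO_one_iff]
        simpa using hβ.tendsto.sub_const (β y)
      · exact ((coordL i).isBigO_comp _ _).norm_right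
    simp only [one_mul] at h1
    refine (Asymptotics.isLittleO_norm_right.1 h1).congr' ?_ Filter.EventuallyEq.rfl
    filter_upwards [hg] with y' hy'
    rw [hy', hg.self_of_nhds, hy]
    simp only [map_sub, coordL_apply, hy, smul_apply, smul_eq_mul]
    ring
  rw [h.fderiv]
  simp [coordL_apply]

theorem divCoord_neg (i : Fin (2 * n)) (f : Model n → ℝ) (y : Model n) :
    divCoord i (fun y => -f y) y = -divCoord i f y := by
  unfold divCoord
  split_ifs
  · rw [fderiv_fun_neg]
    rfl
  · exact neg_div _ _

end DivCoord

/-! ### Joint continuity of inverses -/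

/-- Off a neighbourhood of the preimage of `z`, `F x` avoids `z`. The complement is compact, so this
persists for nearby parameters and values, and the preimage cannot leave the neighbourhood. -/
theorem continuous_symm_uncurry {X M : Type*} [TopologicalSpace X] [TopologicalSpace M]
    [T2Space M] [CompactSpace M] {F : X → M ≃ M} (hF : Continuous fun q : X × M => F q.1 q.2) :
    Continuous fun q : X × M => (F q.1).symm q.2 := by
  rw [continuous_iff_continuousAt]
  rintro ⟨x, z⟩
  intro U hU
  obtain ⟨V, hVU, hV, hmV⟩ := mem_nhds_iff.1 hU
  have h : ∀ᶠ q : X × M in 𝓝 (x, z), ∀ m ∈ Vᶜ, F q.1 m ≠ q.2 := by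
    refine hV.isClosed_compl.isCompact.eventually_forall_of_forall_eventually fun m hm => ?_
    have hc : ContinuousAt (fun r : (X × M) × M => (F r.1.1 r.2, r.1.2)) ((x, z), m) :=
      (Continuous.prodMk (hF.comp (f := fun r : (X × M) × M => (r.1.1, r.2)) (by fun_prop))
        (by fun_prop)).continuousAt
    have hne : F x m ≠ z := by
      rintro rfl
      exact hm (by simpa using hmV)
    exact hc.eventually (isClosed_diagonal.isOpen_compl.mem_nhds hne)
  rw [Filter.mem_map]
  filter_upwards [h] with q hq
  apply hVU
  by_contra hc
  exact hq _ hc (by simp)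

/-! ### Properties of nearby Poisson structures -/

section Good

variable {n : ℕ} {M : Type*} [TopologicalSpace M] [ChartedSpace (Model n) M]

/-- In some chart at `x`, `⋀ⁿw` and its derivative do not both vanish at `x`. -/
def TransverseAt (w : BivectorField n M) (x : M) : Prop :=
  ∃ e ∈ charts n M, x ∈ e.source ∧
    (w.wedgePowComponent e (e x) ≠ 0 ∨ fderiv ℝ (w.wedgePowComponent e) (e x) ≠ 0)

/-- `TransverseAt` looks at a single chart. If value and derivative both vanished in another chart,
the product rule with the Jacobian determinant would make both vanish in the first. -/
theorem wedgePowTransverse_of_transverseAt {w : BivectorField n M} (h : ∀ x, TransverseAt w x) :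
    w.WedgePowTransverse := by
  rw [wedgePowTransverse_iff]
  intro e₂ he₂ y hy h0 hd
  obtain ⟨x, hx₂, rfl⟩ : ∃ x ∈ e₂.source, e₂ x = y :=
    ⟨e₂.symm y, e₂.map_target hy, e₂.right_inv hy⟩
  obtain ⟨e, he, hx, hor⟩ := h x
  have h1 := wedgePowComponent_change he₂ he w hx₂ hx
  rw [h0, mul_zero] at h1
  refine (hor.resolve_left (not_not.2 h1)) ?_
  have hτ : DifferentiableAt ℝ (fun y => e₂ (e.symm y)) (e x) :=
    (contDiffAt_transition he he₂ (e.map_source hx)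
      (by rwa [e.left_inv hx])).differentiableAt (by simp)
  have hD : DifferentiableAt ℝ (fun y => (jacobian (fun y => e (e₂.symm y)) y).det) (e₂ x) :=
    (contDiffAt_det_jacobian (contDiffAt_transition he₂ he (e₂.map_source hx₂)
      (by rwa [e₂.left_inv hx₂]))).differentiableAt (by simp)
  have hw : HasFDerivAt (w.wedgePowComponent e₂) (0 : Model n →L[ℝ] ℝ) (e₂ x) := by
    rw [← hd]
    exact ((contDiffAt_wedgePowComponent w he₂ (e₂.map_source hx₂)).differentiableAt
      (by simp)).hasFDerivAt
  have hprod := hD.hasFDerivAt.mul hw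
  rw [h0, smul_zero, zero_smul, add_zero] at hprod
  have hcomp : HasFDerivAt (fun y => (jacobian (fun y => e (e₂.symm y)) (e₂ (e.symm y))).det *
      w.wedgePowComponent e₂ (e₂ (e.symm y))) (0 : Model n →L[ℝ] ℝ) (e x) := by
    have h2 := HasFDerivAt.comp (g := fun y => (jacobian (fun y => e (e₂.symm y)) y).det *
      w.wedgePowComponent e₂ y) (f := fun y => e₂ (e.symm y)) (e x)
      (by rw [e.left_inv hx]; exact hprod) hτ.hasFDerivAt
    rw [ContinuousLinearMap.zero_comp] at h2
    exact h2
  refine (hcomp.congr_of_eventuallyEq ?_).fderiv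
  filter_upwards [e.open_target.mem_nhds (e.map_source hx),
    (e.continuousAt_symm (e.map_source hx)).preimage_mem_nhds
      (e₂.open_source.mem_nhds (by rwa [e.left_inv hx]))] with y hy1 hy2
  have h3 := wedgePowComponent_change he₂ he w hy2 (e.map_target hy1)
  rwa [e.right_inv hy1] at h3

theorem eventually_transverseAt [IsManifold (𝓡 (2 * n)) ∞ M] {π : Poiss n M}
    (hπ : π.1.IsLogSymplectic) (x : M) :
    ∀ᶠ q : Poiss n M × M in 𝓝 (π, x), TransverseAt q.1.1 q.2 := by
  have he : chartAt (Model n) x ∈ charts n M := IsManifold.chart_mem_maximalAtlas _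
  set e := chartAt (Model n) x
  have hx : x ∈ e.source := mem_chart_source _ x
  have hW := paramC1At_wedgePowComponent he π (e.map_source hx)
  have hxev : ∀ᶠ q : Poiss n M × M in 𝓝 (π, x), q.2 ∈ e.source :=
    continuousAt_snd.eventually (e.open_source.mem_nhds hx)
  by_cases h0 : π.1.wedgePowComponent e (e x) = 0
  · have hd := (wedgePowTransverse_iff π.1).1 hπ.2 e he (e x) (e.map_source hx) h0
    filter_upwards [hxev, (tendsto_prod_chart π hx).eventually
      (hW.continuousAt_fderiv.eventually_ne hd)] with q h1 h2
    exact ⟨e, he, h1, Or.inr h2⟩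
  · filter_upwards [hxev, (tendsto_prod_chart π hx).eventually
      (hW.continuousAt.eventually_ne h0)] with q h1 h2
    exact ⟨e, he, h1, Or.inl h2⟩

/-- Near `(p, x)`, either both `⋀ⁿp` and `⋀ⁿπ ∘ Φ p` do not vanish, or they are multiples of each
other. -/
def MatchesNear (π : Poiss n M) (Φ : Poiss n M → M → M) (p : Poiss n M) (x : M) : Prop :=
  (Φ p x ∉ π.1.singularLocus ∧ x ∉ p.1.singularLocus) ∨
    ∃ e' ∈ charts n M, ∃ e ∈ charts n M, x ∈ e'.source ∧ Φ p x ∈ e.source ∧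
      ∃ r ≠ 0, RatioAt π Φ e' e p x r

theorem MatchesNear.mem_iff {π p : Poiss n M} {Φ : Poiss n M → M → M} {x : M}
    (h : MatchesNear π Φ p x) : Φ p x ∈ π.1.singularLocus ↔ x ∈ p.1.singularLocus := by
  rcases h with ⟨h1, h2⟩ | ⟨e', he', e, he, hx, hΦx, r, hr, c, -, rfl, hev⟩
  · exact iff_of_false h1 h2
  · have h := hev.self_of_nhds
    simp only [e'.left_inv hx] at h
    rw [wedgePow_eq_zero_iff he π.1 hΦx, wedgePow_eq_zero_iff he' p.1 hx, h, mul_eq_zero,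
      or_iff_right hr]

theorem eventually_matchesNear [IsManifold (𝓡 (2 * n)) ∞ M] {π : Poiss n M}
    {Φ : Poiss n M → M → M} (hΦ : IsFamilyThroughId π Φ)
    (hm : ∀ x ∈ π.1.singularLocus, MatchesAt π Φ x) (x : M) :
    ∀ᶠ q : Poiss n M × M in 𝓝 (π, x), MatchesNear π Φ q.1 q.2 := by
  by_cases hxZ : x ∈ π.1.singularLocus
  · obtain ⟨e, he, hx, hr⟩ := hm x hxZ
    filter_upwards [hr.eventually one_ne_zero hx,
      continuousAt_snd.eventually (e.open_source.mem_nhds hx),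
      (hΦ.2 x).continuousAt.eventually (e.open_source.mem_nhds
        (by simpa only [hΦ.1] using hx))] with q h1 h2 h3
    exact Or.inr ⟨e, he, e, he, h2, h3, h1⟩
  · have he : chartAt (Model n) x ∈ charts n M := IsManifold.chart_mem_maximalAtlas _
    set e := chartAt (Model n) x
    have hx : x ∈ e.source := mem_chart_source _ x
    have h0 : π.1.wedgePowComponent e (e x) ≠ 0 := fun h =>
      hxZ ((wedgePow_eq_zero_iff he π.1 hx).2 h)
    filter_upwards [(tendsto_prod_chart π hx).eventually
      ((paramC1At_wedgePowComponent he π (e.map_source hx)).continuousAt.eventually_ne h0),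
      continuousAt_snd.eventually (e.open_source.mem_nhds hx),
      (hΦ.2 x).continuousAt.eventually ((isClosed_singularLocus π.1).isOpen_compl.mem_nhds
        (by simp only [hΦ.1]; exact hxZ))] with q h1 h2 h3
    exact Or.inl ⟨h3, fun h => h1 ((wedgePow_eq_zero_iff he q.1.1 h2).1 h)⟩

/-- The properties of the Poisson structures near `π` on which the theorem rests. -/
structure IsGood (π : Poiss n M) (Φ : Poiss n M → M → M) (p : Poiss n M) : Prop where
  diffeo : ∃ φ : Diff n M, ⇑φ = Φ p
  family : ∀ x, FamilyAt (n := n) Φ p x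
  transverse : ∀ x, TransverseAt p.1 x
  matches_near : ∀ x, MatchesNear π Φ p x

theorem eventually_isGood [T2Space M] [CompactSpace M] [IsManifold (𝓡 (2 * n)) ∞ M]
    {π : Poiss n M} (hπ : π.1.IsLogSymplectic) {Φ : Poiss n M → M → M}
    (hΦ : IsFamilyThroughId π Φ) (hm : ∀ x ∈ π.1.singularLocus, MatchesAt π Φ x) :
    ∀ᶠ p in 𝓝 π, IsGood π Φ p := by
  have h : ∀ᶠ p in 𝓝 π, ∀ x ∈ (Set.univ : Set M),
      FamilyAt (n := n) Φ p x ∧ TransverseAt p.1 x ∧ MatchesNear π Φ p x := by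
    refine isCompact_univ.eventually_forall_of_forall_eventually fun x _ => ?_
    exact (hΦ.2 x).eventually.and ((eventually_transverseAt hπ x).and
      (eventually_matchesNear hΦ hm x))
  filter_upwards [h, eventually_diffeomorph hΦ.1 hΦ.2] with p h1 h2
  exact ⟨h2, fun x => (h1 x (Set.mem_univ x)).1, fun x => (h1 x (Set.mem_univ x)).2.1,
    fun x => (h1 x (Set.mem_univ x)).2.2⟩

end Good

/-! ### The components of the push-forward -/

section Local

variable {n : ℕ} {M : Type*} [TopologicalSpace M] [ChartedSpace (Model n) M]

theorem ParamC1At.continuousAt_partialDeriv {P : Type*} [TopologicalSpace P]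
    {f : P → Model n → ℝ} {p : P} {y : Model n} (h : ParamC1At f p y) (a : Fin (2 * n)) :
    ContinuousAt (fun q : P × Model n => partialDeriv a (f q.1) q.2) (p, y) :=
  h.continuousAt_fderiv.clm_apply continuousAt_const

theorem ParamC1At.continuousAt_jacobian {P : Type*} [TopologicalSpace P]
    {F : P → Model n → Model n} {p : P} {y : Model n} (h : ParamC1At F p y)
    (j a : Fin (2 * n)) :
    ContinuousAt (fun q : P × Model n => jacobian (F q.1) q.2 j a) (p, y) :=
  (ParamC1At.contDiff_comp (coordL j).contDiff h).continuousAt_partialDeriv a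

/-- The components in the chart `e` of the push-forward of `q.1` by `Φ q.1`, at the image of the
point with coordinates `q.2` in the chart `e'`. -/
def pushComponent (Φ : Poiss n M → M → M) (e' e : OpenPartialHomeomorph M (Model n))
    (j k : Fin (2 * n)) (q : Poiss n M × Model n) : ℝ :=
  ∑ a, ∑ b, jacobian (fun u => e (Φ q.1 (e'.symm u))) q.2 j a *
    jacobian (fun u => e (Φ q.1 (e'.symm u))) q.2 k b * component q.1.1.toFun e' a b q.2

theorem component_pushforward_eq [IsManifold (𝓡 (2 * n)) ∞ M] {Φ : Poiss n M → M → M}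
    {p : Poiss n M} {φ : Diff n M} (hφ : ⇑φ = Φ p) {e' e : OpenPartialHomeomorph M (Model n)}
    (he' : e' ∈ charts n M) (he : e ∈ charts n M) {y : Model n} (hy : y ∈ e.target)
    (hx : φ.symm (e.symm y) ∈ e'.source) (j k : Fin (2 * n)) :
    component (pushforward φ p.1).toFun e j k y =
      pushComponent Φ e' e j k (p, e' (φ.symm (e.symm y))) := by
  have hx₂ : φ.symm (e.symm y) ∈ (pullChart φ e).source := by
    rw [pullChart_source, Set.mem_preimage, φ.apply_symm_apply]
    exact e.map_target hy
  have h := component_change he' (pullChart_mem_charts φ he) p.1.toFun hx hx₂ j k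
  simp only [pullChart_apply, φ.apply_symm_apply, e.right_inv hy] at h
  rw [component_pushforward, h, hφ]
  rfl

variable {Φ : Poiss n M → M → M} {p : Poiss n M} {x : M}

theorem continuousAt_pushComponent (hΦ : FamilyAt (n := n) Φ p x)
    {e' e : OpenPartialHomeomorph M (Model n)} (he' : e' ∈ charts n M) (he : e ∈ charts n M)
    (hx : x ∈ e'.source) (hΦx : Φ p x ∈ e.source) (j k : Fin (2 * n)) :
    ContinuousAt (pushComponent Φ e' e j k) (p, e' x) := by
  have hF := hΦ.paramC1At he' he hx hΦx
  refine tendsto_finsetSum _ fun a _ => tendsto_finsetSum _ fun b _ => ?_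
  exact ((hF.continuousAt_jacobian j a).mul (hF.continuousAt_jacobian k b)).mul
    (paramC1At_component he' p (e'.map_source hx) a b).continuousAt

/-- For `j ≠ i`, the line through `y` in direction `j` stays in `{y_i = 0}`. -/
theorem partialDeriv_eq_zero_of_vanish {f : Model n → ℝ} {U : Set (Model n)} (hU : IsOpen U)
    {i j : Fin (2 * n)} (hji : j ≠ i) (h0 : ∀ y ∈ U, y i = 0 → f y = 0) {y : Model n}
    (hy : y ∈ U) (hyi : y i = 0) (hf : DifferentiableAt ℝ f y) : partialDeriv j f y = 0 := by
  have h1 : HasDerivAt (fun t : ℝ => f (y + t • EuclideanSpace.single j (1 : ℝ)))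
      (partialDeriv j f y) 0 := hf.hasFDerivAt.hasLineDerivAt _
  refine h1.unique ((hasDerivAt_const (0 : ℝ) (0 : ℝ)).congr_of_eventuallyEq ?_)
  have hc : ContinuousAt (fun t : ℝ => y + t • EuclideanSpace.single j (1 : ℝ)) 0 := by fun_prop
  filter_upwards [hc.eventually (hU.mem_nhds (by simpa using hy))] with t ht
  exact h0 _ ht (by simp [hyi, hji.symm])

/-- The contraction of the push-forward of a Poisson structure with `df`, if the pull-back of `f`
is a multiple of `⋀ⁿp`. -/
theorem sum_partialDeriv_mul_pushComponent [T2Space M] [IsManifold (𝓡 (2 * n)) ∞ M]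
    {e' e : OpenPartialHomeomorph M (Model n)}
    (he' : e' ∈ charts n M) {u : Model n} (hu : u ∈ e'.target) {f c : Model n → ℝ}
    (hF : DifferentiableAt ℝ (fun u => e (Φ p (e'.symm u))) u)
    (hf : DifferentiableAt ℝ f (e (Φ p (e'.symm u)))) (hc : DifferentiableAt ℝ c u)
    (h : ∀ᶠ u' in 𝓝 u, f (e (Φ p (e'.symm u'))) = c u' * p.1.wedgePowComponent e' u')
    (k : Fin (2 * n)) :
    ∑ j, partialDeriv j f (e (Φ p (e'.symm u))) * pushComponent Φ e' e j k (p, u) =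
      p.1.wedgePowComponent e' u * ∑ b, jacobian (fun u => e (Φ p (e'.symm u))) u k b *
        (∑ a, partialDeriv a c u * component p.1.toFun e' a b u +
          c u * ∑ a, partialDeriv a (component p.1.toFun e' a b) u) := by
  have hg : DifferentiableAt ℝ (p.1.wedgePowComponent e') u :=
    (contDiffAt_wedgePowComponent p.1 he' hu).differentiableAt (by simp)
  have h1 : ∀ a, ∑ j, partialDeriv j f (e (Φ p (e'.symm u))) *
      jacobian (fun u => e (Φ p (e'.symm u))) u j a =
      partialDeriv a c u * p.1.wedgePowComponent e' u +
        c u * partialDeriv a (p.1.wedgePowComponent e') u := by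
    intro a
    rw [← partialDeriv_comp (F := fun u => e (Φ p (e'.symm u))) hF hf a, partialDeriv,
      Filter.EventuallyEq.fderiv_eq h, fderiv_fun_mul hc hg]
    simp only [partialDeriv, _root_.add_apply, _root_.smul_apply, smul_eq_mul]
    ring
  calc _ = ∑ b, ∑ a, (∑ j, partialDeriv j f (e (Φ p (e'.symm u))) *
        jacobian (fun u => e (Φ p (e'.symm u))) u j a) *
        (jacobian (fun u => e (Φ p (e'.symm u))) u k b * component p.1.toFun e' a b u) := by
        simp only [pushComponent, Finset.mul_sum, Finset.sum_mul]
        rw [Finset.sum_comm_cycle]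
        refine Finset.sum_congr rfl fun b _ => ?_
        rw [Finset.sum_comm]
        exact Finset.sum_congr rfl fun a _ => Finset.sum_congr rfl fun j _ => by ring
    _ = ∑ b, jacobian (fun u => e (Φ p (e'.symm u))) u k b *
        (p.1.wedgePowComponent e' u * ∑ a, partialDeriv a c u * component p.1.toFun e' a b u +
          c u * ∑ a, component p.1.toFun e' a b u *
            partialDeriv a (p.1.wedgePowComponent e') u) := by
        refine Finset.sum_congr rfl fun b _ => ?_
        simp only [h1, Finset.mul_sum, ← Finset.sum_add_distrib]
        exact Finset.sum_congr rfl fun a _ => by ring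
    _ = _ := by
        rw [Finset.mul_sum]
        refine Finset.sum_congr rfl fun b _ => ?_
        -- The Poisson condition enters here: the term with the derivative of `⋀ⁿp` is also a
        -- multiple of `⋀ⁿp`, so the whole contraction is.
        rw [sum_component_mul_partialDeriv_wedgePowComponent p.2 he' hu b]
        ring

variable {π : Poiss n M}

theorem wedgePowComponent_eq_zero_iff_of_isAdapted {w : BivectorField n M}
    {e : OpenPartialHomeomorph M (Model n)} {i : Fin (2 * n)}
    (he : IsAdapted w.singularLocus e i) {y : Model n} (hy : y ∈ e.target) :
    w.wedgePowComponent e y = 0 ↔ y i = 0 := by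
  have h1 := wedgePow_eq_zero_iff he.1 w (e.map_target hy)
  have h2 := he.2 _ (e.map_target hy)
  rw [e.right_inv hy] at h1 h2
  exact h1.symm.trans h2

/-- Near the singular locus, the components of the push-forward that involve the normal coordinate
are continuous multiples of that coordinate. -/
theorem exists_pushComponent_eq_coord_mul [T2Space M] [IsManifold (𝓡 (2 * n)) ∞ M]
    (hπ : π.1.IsLogSymplectic)
    {e' e : OpenPartialHomeomorph M (Model n)} {i : Fin (2 * n)} (he' : e' ∈ charts n M)
    (he : IsAdapted π.1.singularLocus e i) (hx : x ∈ e'.source) (hΦx : Φ p x ∈ e.source)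
    (hi : e (Φ p x) i = 0) (hΦ : FamilyAt (n := n) Φ p x) {r : ℝ} (hr : r ≠ 0)
    (hratio : RatioAt π Φ e' e p x r) (k : Fin (2 * n)) :
    ∃ B : Poiss n M × Model n → ℝ, ∀ᶠ q : Poiss n M × Model n in 𝓝 (p, e' x),
      ContinuousAt B q ∧
        pushComponent Φ e' e i k q = e (Φ q.1 (e'.symm q.2)) i * B q := by
  obtain ⟨c, hc, rfl, hev⟩ := hratio
  set f := π.1.wedgePowComponent e with hfdef
  have hfs : ∀ y ∈ e.target, ContDiffAt ℝ ∞ f y := fun y hy =>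
    contDiffAt_wedgePowComponent π.1 he.1 hy
  have hf0 : ∀ y ∈ e.target, y i = 0 → f y = 0 := fun y hy =>
    (wedgePowComponent_eq_zero_iff_of_isAdapted he hy).2
  have hpd : ∀ j, ∀ y ∈ e.target, ContDiffAt ℝ 1 (partialDeriv j f) y := fun j y hy =>
    ((hfs y hy).fderiv_right (m := 1) (by norm_cast)).clm_apply contDiffAt_const
  have hpd0 : ∀ j, j ≠ i → ∀ y ∈ e.target, y i = 0 → partialDeriv j f y = 0 :=
    fun j hj y hy hyi => partialDeriv_eq_zero_of_vanish e.open_target hj hf0 hy hyi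
      ((hfs y hy).differentiableAt (by simp))
  have hy0 : e (Φ p x) ∈ e.target := e.map_source hΦx
  -- On `{y_i = 0}` the tangential derivatives of `f` vanish, so transversality falls on the normal
  -- one.
  have hpi : partialDeriv i f (e (Φ p x)) ≠ 0 := by
    intro h
    refine (wedgePowTransverse_iff π.1).1 hπ.2 e he.1 _ hy0 (hf0 _ hy0 hi) ?_
    ext v
    rw [fderiv_apply_eq_sum]
    refine Finset.sum_eq_zero fun j _ => ?_
    by_cases hj : j = i
    · rw [hj, h, zero_mul]
    · rw [hpd0 j hj _ hy0 hi, zero_mul]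
  have hF := hΦ.paramC1At he' he.1 hx hΦx
  let Y : Poiss n M × Model n → Model n := fun q => e (Φ q.1 (e'.symm q.2))
  let E : Poiss n M × Model n → ℝ := fun q =>
    ∑ b, jacobian (fun u => e (Φ q.1 (e'.symm u))) q.2 k b *
      (∑ a, partialDeriv a (c q.1) q.2 * component q.1.1.toFun e' a b q.2 +
        c q.1 q.2 * ∑ a, partialDeriv a (component q.1.1.toFun e' a b) q.2)
  have hYc : ContinuousAt Y (p, e' x) := hF.continuousAt
  have hYx : Y (p, e' x) = e (Φ p x) := by simp only [Y, e'.left_inv hx]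
  have hYt : ∀ᶠ q in 𝓝 (p, e' x), Y q ∈ e.target :=
    hYc.eventually (e.open_target.mem_nhds (by rwa [hYx]))
  have hYi : ∀ᶠ q in 𝓝 (p, e' x), partialDeriv i f (Y q) ≠ 0 := by
    refine (ContinuousAt.comp (f := Y) (g := partialDeriv i f) ?_ hYc).eventually_ne ?_
    · rw [hYx]
      exact (hpd i _ hy0).continuousAt
    · simpa only [Function.comp, hYx] using hpi
  have hu : ∀ᶠ q : Poiss n M × Model n in 𝓝 (p, e' x), q.2 ∈ e'.target :=
    continuousAt_snd.eventually (e'.open_target.mem_nhds (e'.map_source hx))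
  have hsrc : ∀ᶠ q : Poiss n M × Model n in 𝓝 (p, e' x),
      FamilyAt (n := n) Φ q.1 (e'.symm q.2) ∧ Φ q.1 (e'.symm q.2) ∈ e.source :=
    (tendsto_prod_symm p hx).eventually (hΦ.eventually.and
      (hΦ.continuousAt.eventually (e.open_source.mem_nhds hΦx)))
  -- In `∑_j ∂_j f · w^{jk} = ⋀ⁿp · E`, both `⋀ⁿp = f / c` and the `∂_j f` with `j ≠ i` are
  -- divisible by `y_i`. Solving for the term `j = i` gives this quotient, and `E` contains only
  -- first derivatives, which vary continuously.
  refine ⟨fun q => (divCoord i f (Y q) / c q.1 q.2 * E q -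
    ∑ j ∈ Finset.univ.erase i, divCoord i (partialDeriv j f) (Y q) *
      pushComponent Φ e' e j k q) / partialDeriv i f (Y q), ?_⟩
  filter_upwards [hF.eventually, hc.eventually, hc.continuousAt.eventually_ne hr, hev,
    hev.eventually_nhds, hYt, hYi, hu, hsrc] with q h1 h2 h3 h4 h5 h6 h7 h8 h9
  obtain ⟨p', u⟩ := q
  simp only at h1 h2 h3 h4 h8 h9
  have hYq : ContinuousAt Y (p', u) := h1.continuousAt
  constructor
  · have hE : ContinuousAt E (p', u) := by
      refine tendsto_finsetSum _ fun b _ => (h1.continuousAt_jacobian k b).mul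
        (ContinuousAt.add (tendsto_finsetSum _ fun a _ => ?_)
          (h2.continuousAt.mul (tendsto_finsetSum _ fun a _ => ?_)))
      · exact (h2.continuousAt_partialDeriv a).mul
          (paramC1At_component he' p' h8 a b).continuousAt
      · exact (paramC1At_component he' p' h8 a b).continuousAt_partialDeriv a
    have hdf : ContinuousAt (fun q => divCoord i f (Y q)) (p', u) :=
      ContinuousAt.comp (f := Y) (continuousAt_divCoord e.open_target
        (fun y hy => (hfs y hy).of_le (by norm_cast)) hf0 h6) hYq
    refine (((hdf.div h2.continuousAt h3).mul hE).sub (tendsto_finsetSum _ fun j hj => ?_)).div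
      (ContinuousAt.comp (f := Y) (hpd i _ h6).continuousAt hYq) h7
    refine ContinuousAt.mul ?_ ?_
    · exact ContinuousAt.comp (f := Y) (continuousAt_divCoord e.open_target (hpd j)
        (hpd0 j (Finset.ne_of_mem_erase hj)) h6) hYq
    · have := continuousAt_pushComponent h9.1 he' he.1 (e'.map_target h8) h9.2 j k
      rwa [e'.right_inv h8] at this
  · have hslice : ∀ᶠ u' in 𝓝 u, f (e (Φ p' (e'.symm u'))) =
        c p' u' * p'.1.wedgePowComponent e' u' := by
      have : ContinuousAt (fun u' : Model n => (p', u')) u := by fun_prop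
      exact this.eventually h5
    have hsum := sum_partialDeriv_mul_pushComponent (e := e) he' h8 h1.differentiableAt
      ((hfs _ h6).differentiableAt (by simp)) h2.differentiableAt hslice k
    rw [← Finset.add_sum_erase _ _ (Finset.mem_univ i)] at hsum
    have hrest : ∑ j ∈ Finset.univ.erase i, partialDeriv j f (e (Φ p' (e'.symm u))) *
        pushComponent Φ e' e j k (p', u) = Y (p', u) i * ∑ j ∈ Finset.univ.erase i,
          divCoord i (partialDeriv j f) (Y (p', u)) * pushComponent Φ e' e j k (p', u) := by
      rw [Finset.mul_sum]
      refine Finset.sum_congr rfl fun j hj => ?_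
      rw [← mul_assoc, mul_divCoord (hpd0 j (Finset.ne_of_mem_erase hj) _ h6)]
    have hfY : p'.1.wedgePowComponent e' u = Y (p', u) i * (divCoord i f (Y (p', u)) / c p' u) := by
      rw [mul_div_assoc', mul_divCoord (hf0 _ h6), eq_div_iff h3, mul_comm]
      exact h4.symm
    rw [hrest, hfY] at hsum
    change _ = Y (p', u) i * _
    rw [mul_div_assoc', eq_div_iff h7]
    change partialDeriv i f (Y (p', u)) * _ + _ = _ * E (p', u) at hsum
    linear_combination hsum

end Local

/-! ### Continuity of the push-forward -/

section Global

variable {n : ℕ} {M : Type*} [TopologicalSpace M] [ChartedSpace (Model n) M] {π : Poiss n M}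
  {Φ : Poiss n M → M → M}

theorem IsGood.isLogSymplectic {p : Poiss n M} (h : IsGood π Φ p) : p.1.IsLogSymplectic :=
  ⟨p.2, wedgePowTransverse_of_transverseAt h.transverse⟩

theorem IsGood.mem_singularLocus_iff {p : Poiss n M} (h : IsGood π Φ p) {ψ : Diff n M}
    (hψ : ⇑ψ = Φ p) (x : M) : ψ x ∈ π.1.singularLocus ↔ x ∈ p.1.singularLocus := by
  rw [hψ]
  exact (h.matches_near x).mem_iff

theorem IsGood.image_singularLocus {p : Poiss n M} (h : IsGood π Φ p) {ψ : Diff n M}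
    (hψ : ⇑ψ = Φ p) : ψ '' p.1.singularLocus = π.1.singularLocus := by
  ext z
  obtain ⟨x, rfl⟩ : ∃ x, ψ x = z := ψ.surjective z
  rw [Function.Injective.mem_set_image (f := ψ) ψ.injective, h.mem_singularLocus_iff hψ]

theorem IsGood.singularLocus_pushforward [IsManifold (𝓡 (2 * n)) ∞ M] {p : Poiss n M}
    (h : IsGood π Φ p) {ψ : Diff n M} (hψ : ⇑ψ = Φ p) :
    (pushforward ψ p.1).singularLocus = π.1.singularLocus := by
  ext z
  obtain ⟨x, rfl⟩ : ∃ x, ψ x = z := ψ.surjective z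
  rw [mem_singularLocus_pushforward, h.mem_singularLocus_iff hψ]

variable {V : Set (Poiss n M)} {φ : V → Diff n M}

/-- The point of `M` that `φ v` maps to the point with coordinates `y` in the chart `e`. -/
def preimagePoint (φ : V → Diff n M) (e : OpenPartialHomeomorph M (Model n))
    (q : V × Model n) : M :=
  (φ q.1).symm (e.symm q.2)

theorem apply_preimagePoint (hφ : ∀ v, ⇑(φ v) = Φ v.1) (e : OpenPartialHomeomorph M (Model n))
    (q : V × Model n) : Φ q.1.1 (preimagePoint φ e q) = e.symm q.2 := by
  rw [← hφ]
  exact (φ q.1).apply_symm_apply _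

variable [T2Space M] [CompactSpace M]

theorem continuousAt_preimagePoint (hV : ∀ p ∈ V, IsGood π Φ p) (hφ : ∀ v, ⇑(φ v) = Φ v.1)
    {e : OpenPartialHomeomorph M (Model n)} {q : V × Model n} (hq : q.2 ∈ e.target) :
    ContinuousAt (preimagePoint φ e) q := by
  have h1 : Continuous fun r : V × M => (φ r.1).toEquiv r.2 := by
    rw [continuous_iff_continuousAt]
    rintro ⟨v, x⟩
    have h2 : ContinuousAt (fun r : V × M => Φ r.1.1 r.2) (v, x) :=
      ContinuousAt.comp (f := fun r : V × M => (r.1.1, r.2)) (x := (v, x))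
        ((hV v.1 v.2).family x).continuousAt (by fun_prop)
    exact h2.congr (Filter.Eventually.of_forall fun r => congrFun (hφ r.1).symm r.2)
  have h3 := continuous_symm_uncurry (F := fun v => (φ v).toEquiv) h1
  exact ContinuousAt.comp (f := fun r : V × Model n => (r.1, e.symm r.2)) h3.continuousAt
    (continuousAt_fst.prodMk (ContinuousAt.comp (f := Prod.snd) (e.continuousAt_symm hq)
      continuousAt_snd))

theorem continuousAt_prod_chart_preimagePoint (hV : ∀ p ∈ V, IsGood π Φ p)
    (hφ : ∀ v, ⇑(φ v) = Φ v.1) {e e' : OpenPartialHomeomorph M (Model n)} {q : V × Model n}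
    (hq : q.2 ∈ e.target) (hx : preimagePoint φ e q ∈ e'.source) :
    ContinuousAt (fun q : V × Model n => (q.1.1, e' (preimagePoint φ e q))) q :=
  ContinuousAt.prodMk (by fun_prop) (ContinuousAt.comp (f := preimagePoint φ e)
    (e'.continuousAt hx) (continuousAt_preimagePoint hV hφ hq))

theorem eventually_preimagePoint_mem (hV : ∀ p ∈ V, IsGood π Φ p)
    (hφ : ∀ v, ⇑(φ v) = Φ v.1) {e e' : OpenPartialHomeomorph M (Model n)} {q : V × Model n}
    (hq : q.2 ∈ e.target) (hx : preimagePoint φ e q ∈ e'.source) :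
    ∀ᶠ r in 𝓝 q, r.2 ∈ e.target ∧ preimagePoint φ e r ∈ e'.source :=
  (continuousAt_snd.eventually (e.open_target.mem_nhds hq)).and
    ((continuousAt_preimagePoint hV hφ hq).eventually (e'.open_source.mem_nhds hx))

variable [IsManifold (𝓡 (2 * n)) ∞ M]

theorem continuousAt_component_pushforward (hV : ∀ p ∈ V, IsGood π Φ p)
    (hφ : ∀ v, ⇑(φ v) = Φ v.1) {e : OpenPartialHomeomorph M (Model n)} (he : e ∈ charts n M)
    (j k : Fin (2 * n)) {q : V × Model n} (hq : q.2 ∈ e.target) :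
    ContinuousAt (fun r : V × Model n =>
      component (pushforward (φ r.1) r.1.1.1).toFun e j k r.2) q := by
  have hx := mem_chart_source (Model n) (preimagePoint φ e q)
  have he' : chartAt (Model n) (preimagePoint φ e q) ∈ charts n M :=
    IsManifold.chart_mem_maximalAtlas _
  set e' := chartAt (Model n) (preimagePoint φ e q)
  have hsrc : Φ q.1.1 (preimagePoint φ e q) ∈ e.source := by
    rw [apply_preimagePoint hφ]
    exact e.map_target hq
  have h := ContinuousAt.comp
    (f := fun q : V × Model n => (q.1.1, e' (preimagePoint φ e q))) (x := q)
    (continuousAt_pushComponent ((hV q.1.1 q.1.2).family _) he' he hx hsrc j k)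
    (continuousAt_prod_chart_preimagePoint hV hφ hq hx)
  refine h.congr ?_
  filter_upwards [eventually_preimagePoint_mem hV hφ hq hx] with r hr
  exact (component_pushforward_eq (hφ r.1) he' he hr.1 hr.2 j k).symm

/-- Near the singular locus, the components of the push-forward that involve the normal coordinate
are continuous multiples of that coordinate. -/
theorem exists_component_pushforward_eq_coord_mul (hπ : π.1.IsLogSymplectic)
    (hV : ∀ p ∈ V, IsGood π Φ p) (hφ : ∀ v, ⇑(φ v) = Φ v.1)
    {e : OpenPartialHomeomorph M (Model n)} {i : Fin (2 * n)}
    (he : IsAdapted π.1.singularLocus e i) (k : Fin (2 * n)) {q : V × Model n}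
    (hq : q.2 ∈ e.target) (hqi : q.2 i = 0) :
    ∃ β : V × Model n → ℝ, ∀ᶠ r in 𝓝 q, ContinuousAt β r ∧
      component (pushforward (φ r.1) r.1.1.1).toFun e i k r.2 = r.2 i * β r := by
  have hx := mem_chart_source (Model n) (preimagePoint φ e q)
  have he' : chartAt (Model n) (preimagePoint φ e q) ∈ charts n M :=
    IsManifold.chart_mem_maximalAtlas _
  set e' := chartAt (Model n) (preimagePoint φ e q)
  have hΦq := apply_preimagePoint hφ e q
  have hsrc : Φ q.1.1 (preimagePoint φ e q) ∈ e.source := by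
    rw [hΦq]
    exact e.map_target hq
  have hi : e (Φ q.1.1 (preimagePoint φ e q)) i = 0 := by rwa [hΦq, e.right_inv hq]
  have hZ : Φ q.1.1 (preimagePoint φ e q) ∈ π.1.singularLocus := (he.2 _ hsrc).2 hi
  have hgood := hV q.1.1 q.1.2
  -- On the singular locus the first alternative of `MatchesNear` is impossible; the ratio from the
  -- second is carried to the charts `e'` and `e`.
  obtain ⟨r, hr, hratio⟩ : ∃ r ≠ 0, RatioAt π Φ e' e q.1.1 (preimagePoint φ e q) r := by
    rcases hgood.matches_near (preimagePoint φ e q) with h | ⟨e₁', he₁', e₁, he₁, hx₁, hΦ₁, r, hr, h⟩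
    · exact absurd hZ h.1
    · refine ⟨_, ?_, h.change_charts (hgood.family _) he₁ he₁' he.1 he' hx₁ hx hΦ₁ hsrc⟩
      refine div_ne_zero (mul_ne_zero hr ?_) ?_
      · exact det_jacobian_transition_ne_zero he₁ he.1 (e₁.map_source hΦ₁)
          (by rwa [e₁.left_inv hΦ₁])
      · exact det_jacobian_transition_ne_zero he₁' he' (e₁'.map_source hx₁)
          (by rwa [e₁'.left_inv hx₁])
  obtain ⟨B, hB⟩ := exists_pushComponent_eq_coord_mul hπ he' he hx hsrc hi (hgood.family _) hr
    hratio k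
  refine ⟨fun q => B (q.1.1, e' (preimagePoint φ e q)), ?_⟩
  filter_upwards [eventually_preimagePoint_mem hV hφ hq hx,
    (continuousAt_prod_chart_preimagePoint hV hφ hq hx).eventually hB] with s h1 h2
  refine ⟨ContinuousAt.comp (f := fun q : V × Model n => (q.1.1, e' (preimagePoint φ e q)))
    h2.1 (continuousAt_prod_chart_preimagePoint hV hφ h1.1 h1.2), ?_⟩
  have h3 := h2.2
  simp only [e'.left_inv h1.2, apply_preimagePoint hφ, e.right_inv h1.1] at h3
  rw [← h3]
  exact component_pushforward_eq (hφ s.1) he' he.1 h1.1 h1.2 i k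

/-- Near `{y_i = 0}` both branches of `divCoord` equal the continuous factor `β`: the quotient by
division, the derivative by `fderiv_coord_mul`. -/
theorem continuousAt_divCoord_component_pushforward (hπ : π.1.IsLogSymplectic)
    (hV : ∀ p ∈ V, IsGood π Φ p) (hφ : ∀ v, ⇑(φ v) = Φ v.1)
    {e : OpenPartialHomeomorph M (Model n)} {i : Fin (2 * n)}
    (he : IsAdapted π.1.singularLocus e i) (k : Fin (2 * n)) {q : V × Model n}
    (hq : q.2 ∈ e.target) :
    ContinuousAt (fun r : V × Model n =>
      divCoord i (component (pushforward (φ r.1) r.1.1.1).toFun e i k) r.2) q := by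
  by_cases hqi : q.2 i = 0
  · obtain ⟨β, hβ⟩ := exists_component_pushforward_eq_coord_mul hπ hV hφ he k hq hqi
    refine hβ.self_of_nhds.1.congr ?_
    filter_upwards [hβ, hβ.eventually_nhds] with r hr hr'
    by_cases hri : r.2 i = 0
    · have hc : ContinuousAt (fun y : Model n => (r.1, y)) r.2 := by fun_prop
      rw [divCoord, if_pos hri]
      exact (fderiv_coord_mul hri (ContinuousAt.comp (f := fun y : Model n => (r.1, y)) hr.1 hc)
        ((hc.eventually hr').mono fun y hy => hy.2)).symm
    · rw [divCoord, if_neg hri, hr.2]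
      field_simp
  · exact continuousAt_divCoord_of_ne (X := V)
      (f := fun v => component (pushforward (φ v) v.1.1).toFun e i k) hqi
      (continuousAt_component_pushforward hV hφ he.1 i k hq)

theorem continuousAt_bComponent_pushforward (hπ : π.1.IsLogSymplectic)
    (hV : ∀ p ∈ V, IsGood π Φ p) (hφ : ∀ v, ⇑(φ v) = Φ v.1)
    {e : OpenPartialHomeomorph M (Model n)} {i : Fin (2 * n)}
    (he : IsAdapted π.1.singularLocus e i) (j k : Fin (2 * n)) {q : V × Model n}
    (hq : q.2 ∈ e.target) :
    ContinuousAt (fun r : V × Model n =>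
      bComponent (pushforward (φ r.1) r.1.1.1).toFun e i j k r.2) q := by
  by_cases hj : j = i
  · simp only [bComponent, hj, true_or, if_true]
    exact continuousAt_divCoord_component_pushforward hπ hV hφ he k hq
  by_cases hk : k = i
  · simp only [bComponent, hk, or_true, if_true]
    have h : ∀ v : V, component (pushforward (φ v) v.1.1).toFun e j i =
        fun y => -component (pushforward (φ v) v.1.1).toFun e i j y :=
      fun v => funext fun y => component_swap _ e j i y
    simp only [h, divCoord_neg]
    exact (continuousAt_divCoord_component_pushforward hπ hV hφ he j hq).neg
  · simp only [bComponent, hj, hk, or_self, if_false]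
    exact continuousAt_component_pushforward hV hφ he.1 j k hq

/-- The push-forward as a section of `⋀² T_Z M`. -/
def pushforwardB (hπ : π.1.IsLogSymplectic) (hV : ∀ p ∈ V, IsGood π Φ p)
    (hφ : ∀ v, ⇑(φ v) = Φ v.1) (v : V) : BBivectorField n π.1.singularLocus where
  toBivectorField := pushforward (φ v) v.1.1
  tangent e i he j y hy hyi := by
    obtain ⟨β, hβ⟩ := exists_component_pushforward_eq_coord_mul hπ hV hφ he j (q := (v, y)) hy hyi
    have h := hβ.self_of_nhds.2
    simp only [hyi, zero_mul] at h
    exact h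

theorem continuous_pushforwardB (hπ : π.1.IsLogSymplectic) (hV : ∀ p ∈ V, IsGood π Φ p)
    (hφ : ∀ v, ⇑(φ v) = Φ v.1) : Continuous (pushforwardB hπ hV hφ) := by
  refine continuous_iff_coinduced_le.2 (le_inf ?_ ?_)
  · refine le_iInf₂ fun e he => le_iInf fun _ => le_iInf₂ fun j k => ?_
    refine continuous_iff_coinduced_le.1 (continuous_induced_rng.2
      (continuous_ofFun_of_continuousAt fun K hK => ⟨hK.1, fun v y hy => ?_⟩))
    exact continuousAt_component_pushforward hV hφ he j k (q := (v, y)) (hK.2 hy)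
  · refine le_iInf₂ fun e i => le_iInf fun he => le_iInf₂ fun j k => ?_
    refine continuous_iff_coinduced_le.1 (continuous_induced_rng.2
      (continuous_ofFun_of_continuousAt fun K hK => ⟨hK.1, fun v y hy => ?_⟩))
    exact continuousAt_bComponent_pushforward hπ hV hφ he j k (q := (v, y)) (hK.2 hy)

end Global

end LogSymp

end

/-! ### The stability theorem -/

theorem mainTheorem5 (n : ℕ) {M : Type*} [TopologicalSpace M] [T2Space M] [CompactSpace M]
    [ChartedSpace (LogSymp.Model n) M] [IsManifold (𝓡 (2 * n)) ∞ M]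
    (π : LogSymp.Poiss n M) (hπ : π.1.IsLogSymplectic) (Z : Set M)
    (hZ : Z = π.1.singularLocus) :
    ∃ (V : Set (LogSymp.Poiss n M)) (hπV : π ∈ V) (Φ : V → LogSymp.Diff n M)
      (Ψ : V → LogSymp.Log n Z),
      IsOpen V ∧
      (∀ π' : V, π'.1.1.IsLogSymplectic ∧ Φ π' '' π'.1.1.singularLocus = Z) ∧
      Φ ⟨π, hπV⟩ = Diffeomorph.refl (𝓡 (2 * n)) M ∞ ∧
      (∀ π' : V, LogSymp.IsPushforward (Φ π') π'.1.1 (Ψ π').1.toBivectorField) ∧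
      Continuous Ψ := by
  subst hZ
  obtain ⟨Φ, hΦ, hm⟩ := LogSymp.exists_family_matchesAt hπ
  obtain ⟨V, hV, hVopen, hπV⟩ := mem_nhds_iff.1 (LogSymp.eventually_isGood hπ hΦ hm)
  choose φ hφ using fun v : V => (hV v.2).diffeo
  refine ⟨V, hπV, φ, fun v => ⟨LogSymp.pushforwardB hπ (fun p hp => hV hp) hφ v,
    LogSymp.isLogSymplectic_pushforward (φ v) (hV v.2).isLogSymplectic,
    (hV v.2).singularLocus_pushforward (hφ v)⟩, hVopen, ?_, ?_, ?_, ?_⟩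
  · exact fun v => ⟨(hV v.2).isLogSymplectic, (hV v.2).image_singularLocus (hφ v)⟩
  · refine Diffeomorph.ext fun x => ?_
    rw [hφ]
    exact hΦ.1 x
  · exact fun v => LogSymp.isPushforward_pushforward (φ v) v.1.1
  · exact (LogSymp.continuous_pushforwardB hπ (fun p hp => hV hp) hφ).subtype_mk _
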